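/- **Conventions.** Let $\mathbb V=\{0,1\}^*$ be the set of finite words on $\{0,1\}$; the empty word $\varnothing$ is the root of the complete infinite binary tree, and $v0$, $v1$ are the left and right children of $v\in\mathbb V$. A labeled binary tree $\mathcal T$ is a function from a set of nodes in $\mathbb V$ to labels. For a sequence $y=(y_1,y_2,\dots)$ (finite or infinite) of distinct real numbers, $\mathcal T\langle y\rangle$ is the binary search tree (BST) obtained by inserting successively $y_1,y_2,\dots$, starting from the empty tree: a new label moves left at larger labels and right at smaller labels until it reaches an empty place. For a finite nonempty tree $\mathcal T$ and $v\in\mathbb V$, let $$t(\mathcal T,v)=\frac{1}{|\mathcal T|}\,\bigl|\{u\in\mathcal T : v \text{ is a prefix of } u\}\bigr| .$$ Let $\Psi$ be the set of functions $\psi:\mathbb V\to[0,1]$ with $\psi(\varnothing)=1$ and $\psi(v)=\psi(v0)+\psi(v1)$ for all $v\in\mathbb V$. Random finite binary trees $\mathcal T_n$ converge in distribution for the subtree size topology to a random element $\psi$ of $\Psi$ if the random functions $t(\mathcal T_n,\cdot)$ converge in distribution to $\psi$ for the topology of pointwise convergence on $\mathbb V$. A permuton is a probability measure $\mu$ on $[0,1]^2$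 whose two marginals are the uniform measure on $[0,1]$. For a permuton $\mu$ and $n\ge 1$, let $\mathcal P^n_\mu$ be a set of $n$ i.i.d. points with law $\mu$, and let $\mathcal T\langle\mathcal P^n_\mu\rangle$ be the BST of their $y$-coordinates, inserted in increasing order of their $x$-coordinates. For a probability measure $m$ on $[0,1]$ without atoms, let $Y_1,Y_2,\dots$ be i.i.d. with law $m$ and $\mathcal T^m=\mathcal T\langle Y_1,Y_2,\dots\rangle$. Almost surely this tree is complete, that is, $\mathcal T^m(v)$ is defined for every $v\in\mathbb V$. Set $\mathcal T^m_{\mathrm{left}}(v)=0$ if $v$ consists only of zeros and $\mathcal T^m_{\mathrm{left}}(v)=\mathcal T^m(v')$ if $v=v'10^k$ with $k\ge0$; set $\mathcal T^m_{\mathrm{right}}(v)=1$ if $v$ consists only of ones and $\mathcal T^m_{\mathrm{right}}(v)=\mathcal T^m(v')$ if $v=v'01^k$ with $k\ge0$. Let $\psi_m=\mathcal T^m_{\mathrm{right}}-\mathcal T^m_{\mathrm{left}}$, which is almost surely an element of $\Psi$. **Theorem.** Let $\mu$ be a permuton. 1. Suppose that there is a probability measure $\mu_0$ on $[0,1]$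 without atoms such that $$\frac1x\,\mu\bigl([0,x]\times\cdot\bigr)\longrightarrow\mu_0\quad\text{weakly as } x\to0^+ . \qquad (\ast)$$ Then, as $n\to\infty$, $\mathcal T\langle\mathcal P^n_\mu\rangle$ converges in distribution for the subtree size topology to $\psi_{\mu_0}$. 2. Conversely, if $\mathcal T\langle\mathcal P^n_\mu\rangle$ converges in distribution for the subtree size topology as $n\to\infty$ to some random element of $\Psi$, then there exists a probability measure $\mu_0$ on $[0,1]$ (possibly with atoms) for which $(\ast)$ holds. -/

import Mathlib

open MeasureTheory ProbabilityTheory Filter Topology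
open scoped unitInterval

namespace PermutonBST

/-! ### Binary trees, and binary search trees of finite sequences

Nodes of the complete infinite binary tree are finite words over `{0, 1}`, encoded as lists of
Booleans read from the root: `[]` is the root, `v ++ [false]` (the word `v0`) is the left child
and `v ++ [true]` (the word `v1`) the right child of `v`. -/

section Trees

variable {α : Type*}

/-- The label `T(v)` of the node `v` in the labelled binary tree `T`; it is `none` when `v` is not
a node of `T`. This identifies `T` with a partial function on words. -/
def label : BinaryTree α → List Bool → Option α
  | .nil, _ => none
  | .node a _ _, [] => some a
  | .node _ l _, false :: v => label l v
  | .node _ _ r, true :: v => label r v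

/-- The finite set of nodes of a finite binary tree. -/
def nodes : BinaryTree α → Finset (List Bool)
  | .nil => ∅
  | .node _ l r => insert [] ((nodes l).image (List.cons false) ∪ (nodes r).image (List.cons true))

/-- The nodes of `T` are the words that carry a label. -/
theorem mem_nodes (T : BinaryTree α) (v : List Bool) : v ∈ nodes T ↔ (label T v).isSome := by
  induction T generalizing v with
  | nil => simp [nodes, label]
  | node a l r hl hr =>
    rcases v with _ | ⟨_ | _, v⟩ <;> simp [nodes, label, hl, hr]

/-- `t(T, v)`: the proportion of nodes of `T` having the word `v` as a prefix, that is, which are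
descendants of `v` (including `v` itself). -/
noncomputable def subtreeProportion (T : BinaryTree α) (v : List Bool) : ℝ :=
  (((nodes T).filter (fun u => v <+: u)).card : ℝ) / ((nodes T).card : ℝ)

variable [LinearOrder α]

/-- Insertion of a new label in a binary search tree: go left below larger labels and right below
smaller ones until an empty place is reached (only labels not yet present are meant to be
inserted; a repeated label would go right). -/
def bstInsert (x : α) : BinaryTree α → BinaryTree α
  | .nil => .node x .nil .nil
  | .node y l r => if x < y then .node y (bstInsert x l) r else .node y l (bstInsert x r)

/-- The binary search tree of the sequence `y`, whose elements are inserted one after the other,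
starting from the empty tree. -/
def bst (y : List α) : BinaryTree α :=
  y.foldl (fun T x => bstInsert x T) .nil

/-- Insertion does not change the labels of the nodes already present. -/
theorem label_bstInsert {T : BinaryTree α} {x a : α} {v : List Bool} (h : label T v = some a) :
    label (bstInsert x T) v = some a := by
  induction T generalizing v with
  | nil => simp [label] at h
  | node y l r hl hr =>
    rcases v with _ | ⟨_ | _, v⟩ <;> simp only [label] at h <;> simp only [bstInsert] <;>
      split <;> simp_all [label]

/-- The binary search tree of the first `n` terms of an infinite sequence. -/
def bstPrefix (Y : ℕ → α) (n : ℕ) : BinaryTree α :=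
  bst ((List.range n).map Y)

theorem bstPrefix_succ (Y : ℕ → α) (n : ℕ) :
    bstPrefix Y (n + 1) = bstInsert (Y n) (bstPrefix Y n) := by
  simp [bstPrefix, bst, List.range_succ]

theorem label_bstPrefix_mono {Y : ℕ → α} {m n : ℕ} (hmn : m ≤ n) {v : List Bool} {a : α}
    (h : label (bstPrefix Y m) v = some a) : label (bstPrefix Y n) v = some a := by
  induction n, hmn using Nat.le_induction with
  | base => exact h
  | succ k _ ih => rw [bstPrefix_succ]; exact label_bstInsert ih

open Classical in
/-- The (infinite) binary search tree of an infinite sequence `Y`, as a partial function on words: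
the increasing union of the binary search trees of the initial segments of `Y`
(see `infiniteBST_eq_some_iff`). -/
noncomputable def infiniteBST (Y : ℕ → α) (v : List Bool) : Option α :=
  if h : ∃ n, (label (bstPrefix Y n) v).isSome then label (bstPrefix Y (Nat.find h)) v else none

theorem infiniteBST_eq_some_iff (Y : ℕ → α) (v : List Bool) (a : α) :
    infiniteBST Y v = some a ↔ ∃ n, label (bstPrefix Y n) v = some a := by
  classical
  unfold infiniteBST
  constructor
  · intro h
    split at h
    · exact ⟨_, h⟩
    · simp at h
  · rintro ⟨n, hn⟩
    have hn' : (label (bstPrefix Y n) v).isSome := by simp [hn]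
    have h : ∃ n, (label (bstPrefix Y n) v).isSome := ⟨n, hn'⟩
    rw [dif_pos h]
    obtain ⟨b, hb⟩ := Option.isSome_iff_exists.mp (Nat.find_spec h)
    have h1 := label_bstPrefix_mono (Nat.find_min' h hn') hb
    rw [hb, ← hn, h1]

end Trees

/-! ### The neighbouring ancestors and the limit object -/

/-- Auxiliary to `leftAncestor`: the word is read from its last letter to its first. -/
def leftAncestorRev (T : List Bool → ℝ) : List Bool → ℝ
  | [] => 0
  | false :: r => leftAncestorRev T r
  | true :: r => T r.reverse

/-- Auxiliary to `rightAncestor`: the word is read from its last letter to its first. -/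
def rightAncestorRev (T : List Bool → ℝ) : List Bool → ℝ
  | [] => 1
  | true :: r => rightAncestorRev T r
  | false :: r => T r.reverse

/-- `T_left(v)`: it is `0` if `v` consists only of zeros, and `T(v')` if `v = v'10^k`. -/
def leftAncestor (T : List Bool → ℝ) (v : List Bool) : ℝ := leftAncestorRev T v.reverse

/-- `T_right(v)`: it is `1` if `v` consists only of ones, and `T(v')` if `v = v'01^k`. -/
def rightAncestor (T : List Bool → ℝ) (v : List Bool) : ℝ := rightAncestorRev T v.reverse

theorem leftAncestor_zeros (T : List Bool → ℝ) (k : ℕ) :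
    leftAncestor T (List.replicate k false) = 0 := by
  unfold leftAncestor
  rw [List.reverse_replicate]
  induction k with
  | zero => rfl
  | succ k ih => simpa [List.replicate_succ, leftAncestorRev] using ih

theorem leftAncestor_append (T : List Bool → ℝ) (v : List Bool) (k : ℕ) :
    leftAncestor T (v ++ true :: List.replicate k false) = T v := by
  have h : leftAncestorRev T (List.replicate k false ++ (true :: v.reverse)) = T v := by
    induction k with
    | zero => simp [leftAncestorRev]
    | succ k ih => simpa [List.replicate_succ, leftAncestorRev] using ih
  simpa [leftAncestor] using h

theorem rightAncestor_ones (T : List Bool → ℝ) (k : ℕ) :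
    rightAncestor T (List.replicate k true) = 1 := by
  unfold rightAncestor
  rw [List.reverse_replicate]
  induction k with
  | zero => rfl
  | succ k ih => simpa [List.replicate_succ, rightAncestorRev] using ih

theorem rightAncestor_append (T : List Bool → ℝ) (v : List Bool) (k : ℕ) :
    rightAncestor T (v ++ false :: List.replicate k true) = T v := by
  have h : rightAncestorRev T (List.replicate k true ++ (false :: v.reverse)) = T v := by
    induction k with
    | zero => simp [rightAncestorRev]
    | succ k ih => simpa [List.replicate_succ, rightAncestorRev] using ih
  simpa [rightAncestor] using h

/-- The function `ψ = T_right - T_left` of the infinite binary search tree `T` of the sequence `Y`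
(the default label `0` is used only when this tree is not complete). -/
noncomputable def psi (Y : ℕ → I) (v : List Bool) : ℝ :=
  let T : List Bool → ℝ := fun u => (((infiniteBST Y u).getD 0 : I) : ℝ)
  rightAncestor T v - leftAncestor T v

/-- The set `Ψ` of functions `ψ` from words to `[0, 1]` with `ψ(∅) = 1` and
`ψ(v) = ψ(v0) + ψ(v1)` for every word `v`. -/
def Psi : Set (List Bool → ℝ) :=
  {ψ | (∀ v, ψ v ∈ Set.Icc (0 : ℝ) 1) ∧ ψ [] = 1 ∧
    ∀ v, ψ v = ψ (v ++ [false]) + ψ (v ++ [true])}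

/-- Convergence in distribution of the random finite trees `T n` to the random element `ψ` of `Ψ`
for the subtree size topology, that is, the topology of pointwise convergence of the functions
`t(T n, ·)` (the product topology on real functions on words). -/
structure SubtreeSizeTendsto {α : Type*} {Ω : ℕ → Type*} {Ω' : Type*}
    [∀ n, MeasurableSpace (Ω n)] [MeasurableSpace Ω']
    (T : ∀ n, Ω n → BinaryTree α) (ψ : Ω' → List Bool → ℝ)
    (P : ∀ n, Measure (Ω n)) [∀ n, IsProbabilityMeasure (P n)]
    (P' : Measure Ω') [IsProbabilityMeasure P'] : Prop where
  mem_Psi : ∀ᵐ ω ∂P', ψ ω ∈ Psi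
  tendsto : TendstoInDistribution (fun n ω => subtreeProportion (T n ω)) atTop ψ P P'

/-! ### Permutons and their samples -/

/-- A permuton: a probability measure on the unit square whose two marginals are uniform. -/
structure IsPermuton (μ : ProbabilityMeasure (I × I)) : Prop where
  map_fst : (μ : Measure (I × I)).map Prod.fst = volume
  map_snd : (μ : Measure (I × I)).map Prod.snd = volume

/-- The measure `(1/x) μ([0, x] × ·)` on `[0, 1]`, for `x > 0`. -/
noncomputable def leftSlice (μ : ProbabilityMeasure (I × I)) (x : ℝ) : FiniteMeasure I :=
  (x.toNNReal)⁻¹ • (μ.toFiniteMeasure.restrict {p | (p.1 : ℝ) ≤ x}).map Prod.snd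

/-- `(1/x) μ([0, x] × ·)` converges weakly to the probability measure `μ₀` as `x → 0⁺`. -/
def HasLeftLimit (μ : ProbabilityMeasure (I × I)) (μ₀ : ProbabilityMeasure I) : Prop :=
  Tendsto (leftSlice μ) (𝓝[>] 0) (𝓝 μ₀.toFiniteMeasure)

/-- The binary search tree of the points `p 0, …, p (n - 1)` of the unit square: the
`y`-coordinates are inserted in increasing order of the `x`-coordinates. -/
noncomputable def pointsBST {n : ℕ} (p : Fin n → I × I) : BinaryTree I :=
  bst (List.ofFn fun k => (p (Tuple.sort (fun i => (p i).1) k)).2)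

end PermutonBST

open PermutonBST

/-!
The shape of a binary search tree depends only on the comparisons between the inserted labels, and
the labels in the subtree at a word `v` are exactly those lying strictly between the two
neighbouring ancestors of `v`, provided that these are present (`abs_subtreeProportion_sub_gap_le`
is the quantitative form). The second coordinates of an i.i.d. sample of a permuton are i.i.d.
uniform, so by a uniform law of large numbers (`exists_uniform_law`) the proportion of nodes below
`v` is close to the gap between these ancestors. Thus the subtree size function of the whole tree
is determined, up to a small error, by its first few labels, as soon as these fill the first levels.

The first labels inserted are the ordinates of the leftmost points of the sample. Integrating over
the leftmost point gives a recursion (`leftmostExp_cons`): given its abscissa `s`, the other points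
are i.i.d. conditioned to lie to the right of `s`, and `s` is of order `1 / n`. Hence, under the
slice condition, the ordinates of the first `k` points become asymptotically i.i.d. with law `μ₀`
(`tendsto_leftmostExp`). Only bounded measurable test functions with convergent slice averages are
allowed here; indicators of the cells of a grid qualify because `μ₀` has no atoms, and the shape of
the tree of the first `k` labels is read off from their cells once these are distinct
(`tendsto_integral_cells`, `cell_bst`). On the limit side, an i.i.d. sequence with an atomless law
is almost surely scattered (`ae_isScattered`): it visits every interval between two of its values,
so that its tree is complete. Hence finitely many labels fill the first levels with probability
close to one, and the two approximations meet (`tendsto_integral_subtreeProportion`).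

For the converse, the proportion of nodes in the left subtree of the root is close to the label of
the root, that is, to the ordinate of the leftmost point. So the mean of a continuous function `f`
of that ordinate converges; this mean is `∫ n (1 - s) ^ (n - 1) f(y) dμ(s, y)`, and a Tauberian
theorem of Karamata type (`hasSliceMean_of_tendsto_powAverage`: approximate an indicator by polynomials in
`(1 - s) ^ n`) turns it into convergence of the averages of `f` over the thin slices `[0, x] × I`.
The limit is the mean of `f` under the law of the limiting proportion of the left subtree.
-/

namespace PermutonBST

/-! ### The shape of a binary search tree depends only on comparisons -/

section Shape

variable {ι α : Type*}

open Classical in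
/-- Insertion in a binary search tree of indices, compared through the relation `r`. -/
noncomputable def insertBy (r : ι → ι → Prop) (x : ι) : BinaryTree ι → BinaryTree ι
  | .nil => .node x .nil .nil
  | .node y l s => if r x y then .node y (insertBy r x l) s else .node y l (insertBy r x s)

/-- The binary search tree of a list of indices, compared through the relation `r`. -/
noncomputable def bstBy (r : ι → ι → Prop) (L : List ι) : BinaryTree ι :=
  L.foldl (fun T x => insertBy r x T) .nil

theorem label_map (T : BinaryTree ι) (f : ι → α) (v : List Bool) :
    label (T.map f) v = (label T v).map f := by
  induction T generalizing v with
  | nil => simp [BinaryTree.map, label]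
  | node a l r hl hr => rcases v with _ | ⟨_ | _, v⟩ <;> simp [BinaryTree.map, label, hl, hr]

theorem nodes_map (T : BinaryTree ι) (f : ι → α) : nodes (T.map f) = nodes T := by
  ext v
  simp [mem_nodes, label_map]

theorem bstInsert_map [LinearOrder α] (y : ι → α) (x : ι) (T : BinaryTree ι) :
    bstInsert (y x) (T.map y) = (insertBy (fun i j => y i < y j) x T).map y := by
  induction T with
  | nil => simp [BinaryTree.map, bstInsert, insertBy]
  | node a l r hl hr =>
    simp only [BinaryTree.map, bstInsert, insertBy]
    split <;> simp [BinaryTree.map, hl, hr]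

/-- The binary search tree of the values `y i`, for `i` in a list, is the tree of the indices,
relabelled by `y`. In particular, its shape depends only on the comparisons between values. -/
theorem bst_map [LinearOrder α] (y : ι → α) (L : List ι) :
    bst (L.map y) = (bstBy (fun i j => y i < y j) L).map y := by
  induction L using List.reverseRecOn with
  | nil => simp [bst, bstBy, BinaryTree.map]
  | append_singleton L x ih =>
    simp only [bst, bstBy, List.map_append, List.foldl_append, List.map_cons, List.map_nil,
      List.foldl_cons, List.foldl_nil] at ih ⊢
    rw [ih, bstInsert_map]

end Shape

/-! ### Neighbouring ancestors -/

section Ancestors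

@[simp] theorem leftAncestor_nil (g : List Bool → ℝ) : leftAncestor g [] = 0 := rfl

@[simp] theorem rightAncestor_nil (g : List Bool → ℝ) : rightAncestor g [] = 1 := rfl

@[simp] theorem leftAncestor_concat (g : List Bool → ℝ) (v : List Bool) (b : Bool) :
    leftAncestor g (v ++ [b]) = if b then g v else leftAncestor g v := by
  cases b <;> simp [leftAncestor, leftAncestorRev]

@[simp] theorem rightAncestor_concat (g : List Bool → ℝ) (v : List Bool) (b : Bool) :
    rightAncestor g (v ++ [b]) = if b then rightAncestor g v else g v := by
  cases b <;> simp [rightAncestor, rightAncestorRev]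

/-- The function `T_right - T_left` of a labelling `g` of the words. -/
noncomputable def gap (g : List Bool → ℝ) (v : List Bool) : ℝ :=
  rightAncestor g v - leftAncestor g v

theorem gap_nil (g : List Bool → ℝ) : gap g [] = 1 := by simp [gap]

theorem gap_eq_add (g : List Bool → ℝ) (v : List Bool) :
    gap g v = gap g (v ++ [false]) + gap g (v ++ [true]) := by
  simp [gap]

theorem psi_eq_gap (Y : ℕ → I) :
    psi Y = gap (fun u => (((infiniteBST Y u).getD 0 : I) : ℝ)) := rfl

theorem abs_leftAncestor_sub_le {g g' : List Bool → ℝ} {δ : ℝ} (hδ : 0 ≤ δ) (v : List Bool)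
    (h : ∀ u, u.length < v.length → |g u - g' u| ≤ δ) :
    |leftAncestor g v - leftAncestor g' v| ≤ δ := by
  induction v using List.reverseRecOn with
  | nil => simpa using hδ
  | append_singleton v b ih =>
    cases b
    · simpa using ih fun u hu => h u (by simp; omega)
    · simpa using h v (by simp)

theorem abs_rightAncestor_sub_le {g g' : List Bool → ℝ} {δ : ℝ} (hδ : 0 ≤ δ) (v : List Bool)
    (h : ∀ u, u.length < v.length → |g u - g' u| ≤ δ) :
    |rightAncestor g v - rightAncestor g' v| ≤ δ := by
  induction v using List.reverseRecOn with
  | nil => simpa using hδ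
  | append_singleton v b ih =>
    cases b
    · simpa using h v (by simp)
    · simpa using ih fun u hu => h u (by simp; omega)

theorem abs_gap_sub_le {g g' : List Bool → ℝ} {δ : ℝ} (hδ : 0 ≤ δ) (v : List Bool)
    (h : ∀ u, u.length < v.length → |g u - g' u| ≤ δ) : |gap g v - gap g' v| ≤ 2 * δ := by
  have h1 := abs_le.1 (abs_leftAncestor_sub_le hδ v h)
  have h2 := abs_le.1 (abs_rightAncestor_sub_le hδ v h)
  rw [abs_le]
  constructor <;> simp only [gap] <;> linarith [h1.1, h1.2, h2.1, h2.2]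

theorem leftAncestor_congr {g g' : List Bool → ℝ} {v : List Bool}
    (h : ∀ u, u.length < v.length → g u = g' u) : leftAncestor g v = leftAncestor g' v := by
  have := abs_leftAncestor_sub_le (g := g) (g' := g') le_rfl v fun u hu => by simp [h u hu]
  exact sub_eq_zero.1 (abs_nonpos_iff.1 this)

theorem rightAncestor_congr {g g' : List Bool → ℝ} {v : List Bool}
    (h : ∀ u, u.length < v.length → g u = g' u) : rightAncestor g v = rightAncestor g' v := by
  have := abs_rightAncestor_sub_le (g := g) (g' := g') le_rfl v fun u hu => by simp [h u hu]
  exact sub_eq_zero.1 (abs_nonpos_iff.1 this)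

theorem leftAncestor_mem (g : List Bool → ℝ) (v : List Bool) :
    leftAncestor g v = 0 ∨ ∃ u, u.length < v.length ∧ leftAncestor g v = g u := by
  induction v using List.reverseRecOn with
  | nil => simp
  | append_singleton v b ih =>
    cases b
    · rcases ih with h | ⟨u, hu, h⟩
      · left; simpa using h
      · right; exact ⟨u, by simp; omega, by simpa using h⟩
    · right; exact ⟨v, by simp, by simp⟩

theorem rightAncestor_mem (g : List Bool → ℝ) (v : List Bool) :
    rightAncestor g v = 1 ∨ ∃ u, u.length < v.length ∧ rightAncestor g v = g u := by
  induction v using List.reverseRecOn with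
  | nil => simp
  | append_singleton v b ih =>
    cases b
    · right; exact ⟨v, by simp, by simp⟩
    · rcases ih with h | ⟨u, hu, h⟩
      · left; simpa using h
      · right; exact ⟨u, by simp; omega, by simpa using h⟩

/-- `leftAncestor`, computed from the root downwards, with `lo` as the default label. -/
noncomputable def leftFrom (g : List Bool → ℝ) (lo : ℝ) : List Bool → ℝ
  | [] => lo
  | false :: v => leftFrom (fun u => g (false :: u)) lo v
  | true :: v => leftFrom (fun u => g (true :: u)) (g []) v

/-- `rightAncestor`, computed from the root downwards, with `hi` as the default label. -/
noncomputable def rightFrom (g : List Bool → ℝ) (hi : ℝ) : List Bool → ℝ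
  | [] => hi
  | false :: v => rightFrom (fun u => g (false :: u)) (g []) v
  | true :: v => rightFrom (fun u => g (true :: u)) hi v

theorem leftFrom_concat (g : List Bool → ℝ) (lo : ℝ) (v : List Bool) (b : Bool) :
    leftFrom g lo (v ++ [b]) = if b then g v else leftFrom g lo v := by
  induction v generalizing g lo with
  | nil => cases b <;> rfl
  | cons c v ih => cases c <;> simp [leftFrom, ih]

theorem rightFrom_concat (g : List Bool → ℝ) (hi : ℝ) (v : List Bool) (b : Bool) :
    rightFrom g hi (v ++ [b]) = if b then rightFrom g hi v else g v := by
  induction v generalizing g hi with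
  | nil => cases b <;> rfl
  | cons c v ih => cases c <;> simp [rightFrom, ih]

theorem leftFrom_eq (g : List Bool → ℝ) (v : List Bool) :
    leftFrom g 0 v = leftAncestor g v := by
  induction v using List.reverseRecOn with
  | nil => rfl
  | append_singleton v b ih => rw [leftFrom_concat, leftAncestor_concat, ih]

theorem rightFrom_eq (g : List Bool → ℝ) (v : List Bool) :
    rightFrom g 1 v = rightAncestor g v := by
  induction v using List.reverseRecOn with
  | nil => rfl
  | append_singleton v b ih => rw [rightFrom_concat, rightAncestor_concat, ih]

end Ancestors

/-! ### Subtrees of a binary search tree are intervals of labels -/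

section Intervals

variable {α : Type*}

/-- The list of the labels of a tree. -/
def labels : BinaryTree α → List α
  | .nil => []
  | .node a l r => a :: (labels l ++ labels r)

/-- The search property, with strict inequalities on both sides. -/
def IsSearchTree [LT α] : BinaryTree α → Prop
  | .nil => True
  | .node a l r => (∀ x ∈ labels l, x < a) ∧ (∀ x ∈ labels r, a < x) ∧
      IsSearchTree l ∧ IsSearchTree r

theorem labels_bstInsert [LinearOrder α] (x : α) (T : BinaryTree α) :
    (labels (bstInsert x T)).Perm (x :: labels T) := by
  induction T with
  | nil => simp [bstInsert, labels]
  | node a l r hl hr =>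
    simp only [bstInsert]
    split
    · simp only [labels]
      exact ((hl.append_right _).cons a).trans (List.Perm.swap _ _ _)
    · simp only [labels]
      refine (((hr.append_left (labels l)).trans List.perm_middle).cons a).trans
        (List.Perm.swap _ _ _)

theorem labels_bst [LinearOrder α] (L : List α) : (labels (bst L)).Perm L := by
  induction L using List.reverseRecOn with
  | nil => simp [bst, labels]
  | append_singleton L x ih =>
    have : bst (L ++ [x]) = bstInsert x (bst L) := by simp [bst]
    rw [this]
    exact (labels_bstInsert x _).trans ((ih.cons x).trans (List.perm_append_singleton x L).symm)

theorem IsSearchTree.bstInsert [LinearOrder α] {x : α} {T : BinaryTree α} (hT : IsSearchTree T)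
    (hx : x ∉ labels T) : IsSearchTree (bstInsert x T) := by
  induction T with
  | nil => simp [PermutonBST.bstInsert, IsSearchTree, labels]
  | node a l r hl hr =>
    obtain ⟨h1, h2, h3, h4⟩ := hT
    simp only [labels, List.mem_cons, List.mem_append, not_or] at hx
    simp only [PermutonBST.bstInsert]
    split_ifs with h
    · refine ⟨fun z hz => ?_, h2, hl h3 hx.2.1, h4⟩
      rcases List.mem_cons.1 ((labels_bstInsert x l).mem_iff.1 hz) with rfl | hz
      exacts [h, h1 z hz]
    · refine ⟨h1, fun z hz => ?_, h3, hr h4 hx.2.2⟩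
      rcases List.mem_cons.1 ((labels_bstInsert x r).mem_iff.1 hz) with rfl | hz
      exacts [lt_of_le_of_ne (not_lt.1 h) (Ne.symm hx.1), h2 z hz]

theorem isSearchTree_bst [LinearOrder α] {L : List α} (hL : L.Nodup) : IsSearchTree (bst L) := by
  induction L using List.reverseRecOn with
  | nil => simp [bst, IsSearchTree]
  | append_singleton L x ih =>
    have : bst (L ++ [x]) = PermutonBST.bstInsert x (bst L) := by simp [bst]
    rw [this]
    rw [List.nodup_append] at hL
    refine (ih hL.1).bstInsert fun h => ?_
    exact hL.2.2 x ((labels_bst L).mem_iff.1 h) x (by simp) rfl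

theorem cons_mem_nodes_node {a : α} {l r : BinaryTree α} {b : Bool} {u : List Bool} :
    b :: u ∈ nodes (.node a l r) ↔ u ∈ nodes (if b then r else l) := by
  cases b <;> simp [mem_nodes, label]

theorem nil_mem_nodes_node {a : α} {l r : BinaryTree α} : [] ∈ nodes (.node a l r) := by
  simp [mem_nodes, label]

theorem card_nodes (T : BinaryTree α) : (nodes T).card = (labels T).length := by
  induction T with
  | nil => simp [nodes, labels]
  | node a l r hl hr =>
    have hd : Disjoint ((nodes l).image (List.cons false)) ((nodes r).image (List.cons true)) := by
      rw [Finset.disjoint_left]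
      intro u hu hu'
      obtain ⟨w, -, rfl⟩ := Finset.mem_image.1 hu
      simp at hu'
    rw [nodes, Finset.card_insert_of_notMem (by simp), Finset.card_union_of_disjoint hd,
      Finset.card_image_of_injective _ (List.cons_injective),
      Finset.card_image_of_injective _ (List.cons_injective), hl, hr]
    simp [labels]

theorem card_nodes_filter_cons (a : α) (l r : BinaryTree α) (b : Bool) (v : List Bool) :
    ((nodes (.node a l r)).filter (fun u => b :: v <+: u)).card =
      ((nodes (if b then r else l)).filter (fun u => v <+: u)).card := by
  rw [← Finset.card_image_of_injective ((nodes (if b then r else l)).filter (fun u => v <+: u))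
    (List.cons_injective (a := b))]
  congr 1
  ext u
  simp only [Finset.mem_filter, Finset.mem_image]
  constructor
  · rintro ⟨h1, h2⟩
    obtain ⟨w, rfl⟩ := h2
    exact ⟨v ++ w, ⟨cons_mem_nodes_node.1 h1, List.prefix_append _ _⟩, rfl⟩
  · rintro ⟨w, ⟨h1, h2⟩, rfl⟩
    exact ⟨cons_mem_nodes_node.2 h1, by simpa using h2⟩

theorem mem_nodes_of_prefix {T : BinaryTree α} {u v : List Bool} (h : u <+: v)
    (hv : v ∈ nodes T) : u ∈ nodes T := by
  induction T generalizing u v with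
  | nil => simp [nodes] at hv
  | node a l r hl hr =>
    rcases u with _ | ⟨b, u⟩
    · exact nil_mem_nodes_node
    · obtain ⟨w, rfl⟩ := h
      rw [List.cons_append, cons_mem_nodes_node] at hv
      rw [cons_mem_nodes_node]
      cases b
      · exact hl (List.prefix_append _ _) hv
      · exact hr (List.prefix_append _ _) hv

/-- In a search tree all of whose labels are in `(lo, hi)`, if `v` is a node or an empty place
below a node, then the subtree at `v` contains the labels lying between the neighbouring
ancestors of `v`. -/
theorem card_subtree_eq_countP_from {T : BinaryTree ℝ} (hT : IsSearchTree T) {lo hi : ℝ}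
    (hlohi : lo < hi) (hlab : ∀ x ∈ labels T, lo < x ∧ x < hi) {v : List Bool}
    (hv : ∀ u, u <+: v → u ≠ v → u ∈ nodes T) :
    lo ≤ leftFrom (fun u => (label T u).getD 0) lo v ∧
    rightFrom (fun u => (label T u).getD 0) hi v ≤ hi ∧
    leftFrom (fun u => (label T u).getD 0) lo v < rightFrom (fun u => (label T u).getD 0) hi v ∧
    ((nodes T).filter (fun u => v <+: u)).card =
      (labels T).countP (fun x => leftFrom (fun u => (label T u).getD 0) lo v < x ∧
        x < rightFrom (fun u => (label T u).getD 0) hi v) := by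
  induction T generalizing lo hi v with
  | nil =>
    rcases v with _ | ⟨b, v⟩
    · simp [leftFrom, rightFrom, hlohi, labels, nodes]
    · simpa [nodes] using hv [] (by simp) (by simp)
  | node a l r hl hr =>
    obtain ⟨h1, h2, h3, h4⟩ := hT
    simp only [labels, List.mem_cons, List.mem_append, or_imp, forall_and, forall_eq] at hlab
    obtain ⟨⟨hloa, hll, hlr⟩, hahi, hhl, hhr⟩ := hlab
    rcases v with _ | ⟨_ | _, v⟩
    · refine ⟨le_rfl, le_rfl, hlohi, ?_⟩
      simp only [List.nil_prefix, Finset.filter_true, leftFrom, rightFrom]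
      rw [card_nodes, eq_comm, List.countP_eq_length]
      intro x hx
      simp only [labels, List.mem_cons, List.mem_append] at hx
      refine decide_eq_true ?_
      rcases hx with rfl | hx | hx
      exacts [⟨hloa, hahi⟩, ⟨hll x hx, hhl x hx⟩, ⟨hlr x hx, hhr x hx⟩]
    · have hv' : ∀ u, u <+: v → u ≠ v → u ∈ nodes l := fun u hu huv => by
        have := hv (false :: u) (by simpa using hu) (by simpa using huv)
        simpa [cons_mem_nodes_node] using this
      obtain ⟨i1, i2, i3, i4⟩ := hl h3 hloa (fun x hx => ⟨hll x hx, h1 x hx⟩) hv'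
      change lo ≤ leftFrom (fun u => (label l u).getD 0) lo v ∧
        rightFrom (fun u => (label l u).getD 0) a v ≤ hi ∧
        leftFrom (fun u => (label l u).getD 0) lo v <
          rightFrom (fun u => (label l u).getD 0) a v ∧
        ((nodes (BinaryTree.node a l r)).filter (fun u => false :: v <+: u)).card =
          (labels (BinaryTree.node a l r)).countP
            (fun x => leftFrom (fun u => (label l u).getD 0) lo v < x ∧
              x < rightFrom (fun u => (label l u).getD 0) a v)
      refine ⟨i1, i2.trans hahi.le, i3, ?_⟩
      rw [card_nodes_filter_cons, if_neg (by simp), i4]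
      have hr0 : (labels r).countP (fun x => leftFrom (fun u => (label l u).getD 0) lo v < x ∧
          x < rightFrom (fun u => (label l u).getD 0) a v) = 0 :=
        List.countP_eq_zero.2 fun x hx => by simpa using fun _ => i2.trans (h2 x hx).le
      simp only [labels, List.countP_cons, List.countP_append]
      rw [hr0, if_neg, add_zero, add_zero]
      simpa using fun _ => i2
    · have hv' : ∀ u, u <+: v → u ≠ v → u ∈ nodes r := fun u hu huv => by
        have := hv (true :: u) (by simpa using hu) (by simpa using huv)
        simpa [cons_mem_nodes_node] using this
      obtain ⟨i1, i2, i3, i4⟩ := hr h4 hahi (fun x hx => ⟨h2 x hx, hhr x hx⟩) hv'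
      change lo ≤ leftFrom (fun u => (label r u).getD 0) a v ∧
        rightFrom (fun u => (label r u).getD 0) hi v ≤ hi ∧
        leftFrom (fun u => (label r u).getD 0) a v <
          rightFrom (fun u => (label r u).getD 0) hi v ∧
        ((nodes (BinaryTree.node a l r)).filter (fun u => true :: v <+: u)).card =
          (labels (BinaryTree.node a l r)).countP
            (fun x => leftFrom (fun u => (label r u).getD 0) a v < x ∧
              x < rightFrom (fun u => (label r u).getD 0) hi v)
      refine ⟨hloa.le.trans i1, i2, i3, ?_⟩
      rw [card_nodes_filter_cons, if_pos (by simp), i4]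
      have hl0 : (labels l).countP (fun x => leftFrom (fun u => (label r u).getD 0) a v < x ∧
          x < rightFrom (fun u => (label r u).getD 0) hi v) = 0 :=
        List.countP_eq_zero.2 fun x hx => by
          simpa using fun h => absurd (h1 x hx) (not_lt.2 (i1.trans h.le))
      simp only [labels, List.countP_cons, List.countP_append]
      rw [hl0, if_neg, zero_add, add_zero]
      simpa using fun h => absurd h (not_lt.2 i1)

/-- The labels of a finite tree, as a total function with default label `0`. -/
noncomputable def labelFun (T : BinaryTree I) (u : List Bool) : ℝ := (((label T u).getD 0 : I) : ℝ)

theorem labelFun_eq_getD_map (T : BinaryTree I) :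
    labelFun T = fun u => (label (T.map (fun x : I => (x : ℝ))) u).getD 0 := by
  ext u
  rw [labelFun, label_map]
  cases label T u <;> simp

theorem bst_map_coe (L : List I) :
    bst (L.map (fun x : I => (x : ℝ))) = (bst L).map (fun x : I => (x : ℝ)) := by
  rw [bst_map (fun x : I => (x : ℝ))]
  conv_rhs => rw [← List.map_id L, bst_map, ← BinaryTree.comp_map]
  simp

theorem leftAncestor_lt_rightAncestor_and_card {L : List I} (hL : L.Nodup)
    (hpos : ∀ x ∈ L, (0 : ℝ) < x ∧ (x : ℝ) < 1) {v : List Bool}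
    (hv : ∀ u, u <+: v → u ≠ v → u ∈ nodes (bst L)) :
    leftAncestor (labelFun (bst L)) v < rightAncestor (labelFun (bst L)) v ∧
    ((nodes (bst L)).filter (fun u => v <+: u)).card =
      L.countP (fun x : I => leftAncestor (labelFun (bst L)) v < x ∧
        x < rightAncestor (labelFun (bst L)) v) := by
  have hL' : (L.map (fun x : I => (x : ℝ))).Nodup := hL.map Subtype.val_injective
  have key := card_subtree_eq_countP_from (isSearchTree_bst hL') (zero_lt_one (α := ℝ))
    (v := v) ?_ ?_
  · rw [bst_map_coe, ← labelFun_eq_getD_map, leftFrom_eq, rightFrom_eq, nodes_map,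
      ← bst_map_coe, (labels_bst _).countP_eq, List.countP_map] at key
    exact ⟨key.2.2.1, key.2.2.2⟩
  · intro x hx
    rw [(labels_bst _).mem_iff] at hx
    obtain ⟨z, hz, rfl⟩ := List.mem_map.1 hx
    exact hpos z hz
  · rwa [bst_map_coe, nodes_map]

end Intervals

/-! ### Trees that are full up to a given depth -/

section Full

variable {α : Type*}

/-- All words of length less than `d` are nodes of `T`. -/
def IsFull (T : BinaryTree α) (d : ℕ) : Prop := ∀ u : List Bool, u.length < d → u ∈ nodes T

theorem label_bst_append [LinearOrder α] {L : List α} (L' : List α) {v : List Bool} {a : α}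
    (h : label (bst L) v = some a) : label (bst (L ++ L')) v = some a := by
  induction L' using List.reverseRecOn with
  | nil => simpa using h
  | append_singleton L' x ih =>
    have : bst (L ++ (L' ++ [x])) = bstInsert x (bst (L ++ L')) := by simp [bst]
    rw [this]
    exact label_bstInsert ih

theorem nodes_bst_append [LinearOrder α] (L L' : List α) :
    nodes (bst L) ⊆ nodes (bst (L ++ L')) := by
  intro u hu
  rw [mem_nodes, Option.isSome_iff_exists] at hu
  obtain ⟨a, ha⟩ := hu
  rw [mem_nodes, label_bst_append L' ha]
  rfl

theorem labelFun_bst_append {L : List I} (L' : List I) {u : List Bool} (hu : u ∈ nodes (bst L)) :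
    labelFun (bst (L ++ L')) u = labelFun (bst L) u := by
  rw [mem_nodes, Option.isSome_iff_exists] at hu
  obtain ⟨a, ha⟩ := hu
  rw [labelFun, labelFun, label_bst_append L' ha, ha]

theorem labelFun_mem (T : BinaryTree I) (u : List Bool) : labelFun T u ∈ Set.Icc (0 : ℝ) 1 :=
  ((label T u).getD 0).2

theorem leftAncestor_mem_Icc {g : List Bool → ℝ} (hg : ∀ u, g u ∈ Set.Icc (0 : ℝ) 1)
    (v : List Bool) : leftAncestor g v ∈ Set.Icc (0 : ℝ) 1 := by
  rcases leftAncestor_mem g v with h | ⟨u, -, h⟩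
  · simp [h]
  · rw [h]; exact hg u

theorem rightAncestor_mem_Icc {g : List Bool → ℝ} (hg : ∀ u, g u ∈ Set.Icc (0 : ℝ) 1)
    (v : List Bool) : rightAncestor g v ∈ Set.Icc (0 : ℝ) 1 := by
  rcases rightAncestor_mem g v with h | ⟨u, -, h⟩
  · simp [h]
  · rw [h]; exact hg u

theorem proper_prefix_length_lt {u v : List Bool} (h : u <+: v) (hne : u ≠ v) :
    u.length < v.length :=
  lt_of_le_of_ne h.length_le fun h' => hne (h.eq_of_length h')

/-- If every interval contains a proportion of labels close to its length and if the first labels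
already fill the levels above `v`, then the proportion of nodes below `v` is close to the length
of the interval between the neighbouring ancestors of `v`. -/
theorem abs_subtreeProportion_sub_gap_le {L : List I} (hL : L.Nodup)
    (hpos : ∀ x ∈ L, (0 : ℝ) < x ∧ (x : ℝ) < 1) {k d : ℕ} (hfull : IsFull (bst (L.take k)) d)
    {δ : ℝ} (hδ : ∀ a ∈ Set.Icc (0 : ℝ) 1, ∀ b ∈ Set.Icc (0 : ℝ) 1, a < b →
      |(L.countP (fun x : I => a < x ∧ x < b) : ℝ) / L.length - (b - a)| ≤ δ)
    {v : List Bool} (hv : v.length ≤ d) :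
    |subtreeProportion (bst L) v - gap (labelFun (bst (L.take k))) v| ≤ δ := by
  have hL' : L = L.take k ++ L.drop k := (List.take_append_drop k L).symm
  have hnode : ∀ u : List Bool, u.length < v.length → u ∈ nodes (bst (L.take k)) :=
    fun u hu => hfull u (hu.trans_le hv)
  have hlab : ∀ u : List Bool, u.length < v.length →
      labelFun (bst (L.take k)) u = labelFun (bst L) u := fun u hu => by
    conv_rhs => rw [hL']
    exact (labelFun_bst_append _ (hnode u hu)).symm
  have hnode' : ∀ u, u <+: v → u ≠ v → u ∈ nodes (bst L) := fun u hu hne => by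
    rw [hL']
    exact nodes_bst_append _ _ (hnode u (proper_prefix_length_lt hu hne))
  obtain ⟨h1, h2⟩ := leftAncestor_lt_rightAncestor_and_card hL hpos hnode'
  rw [gap, leftAncestor_congr hlab, rightAncestor_congr hlab, subtreeProportion, h2, card_nodes,
    (labels_bst L).length_eq]
  exact hδ _ (leftAncestor_mem_Icc (labelFun_mem _) v) _ (rightAncestor_mem_Icc (labelFun_mem _) v)
    h1

/-- The labelling of the words obtained from a tree of integers by dividing the labels by `N`. -/
noncomputable def gridLabel (N : ℕ) (T : BinaryTree ℕ) (u : List Bool) : ℝ :=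
  ((label T u).getD 0 : ℕ) / (N : ℝ)

/-- The cell of the grid of mesh `1 / N` that contains a point. -/
noncomputable def cell (N : ℕ) (y : I) : ℕ := ⌊(N : ℝ) * y⌋₊

theorem cell_le (N : ℕ) (y : I) : cell N y ≤ N := by
  apply Nat.floor_le_of_le
  have := y.2.2
  nlinarith [(Nat.cast_nonneg N : (0 : ℝ) ≤ N)]

theorem abs_sub_cell_le {N : ℕ} (hN : 0 < N) (y : I) : |(y : ℝ) - cell N y / N| ≤ 1 / N := by
  have hN' : (0 : ℝ) < N := by exact_mod_cast hN
  have h1 : (cell N y : ℝ) ≤ N * y := Nat.floor_le (mul_nonneg hN'.le y.2.1)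
  have h2 : (N : ℝ) * y < cell N y + 1 := Nat.lt_floor_add_one _
  have : (y : ℝ) - cell N y / N = (N * y - cell N y) / N := by field_simp
  rw [this, abs_div, abs_of_pos hN']
  gcongr
  rw [abs_le]
  constructor <;> linarith

theorem cell_mono (N : ℕ) : Monotone (cell N) := fun _ _ h =>
  Nat.floor_mono (mul_le_mul_of_nonneg_left h (Nat.cast_nonneg N))

/-- When points lie in distinct cells of a grid, replacing them by their cells does not change the
shape of their binary search tree. -/
theorem cell_bst {k N : ℕ} (hN : 0 < N) {y : Fin k → I}
    (hinj : Function.Injective fun i => cell N (y i)) :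
    nodes (bst (List.ofFn fun i => cell N (y i))) = nodes (bst (List.ofFn y)) ∧
    ∀ u, |labelFun (bst (List.ofFn y)) u -
      gridLabel N (bst (List.ofFn fun i => cell N (y i))) u| ≤ 1 / N := by
  have hr : (fun i j => cell N (y i) < cell N (y j)) = fun i j => y i < y j := by
    ext i j
    constructor
    · intro h
      by_contra h'
      exact absurd (cell_mono N (not_lt.1 h')) (not_le.2 h)
    · intro h
      refine lt_of_le_of_ne (cell_mono N h.le) fun h' => ?_
      rw [hinj h'] at h
      exact lt_irrefl _ h
  have h1 : bst (List.ofFn y) = (bstBy (fun i j => y i < y j) (List.finRange k)).map y := by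
    rw [← bst_map, List.ofFn_eq_map]
  have h2 : bst (List.ofFn fun i => cell N (y i)) =
      (bstBy (fun i j => y i < y j) (List.finRange k)).map (fun i => cell N (y i)) := by
    rw [← hr, ← bst_map (fun i => cell N (y i)), List.ofFn_eq_map]
  refine ⟨by rw [h1, h2, nodes_map, nodes_map], fun u => ?_⟩
  rw [labelFun, gridLabel, h1, h2, label_map, label_map]
  cases label (bstBy (fun i j => y i < y j) (List.finRange k)) u with
  | none => simp
  | some i => simpa using abs_sub_cell_le hN (y i)

theorem bst_ofFn_eq_bstPrefix (Y : ℕ → I) (k : ℕ) :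
    bst (List.ofFn fun i : Fin k => Y i) = bstPrefix Y k := by
  rw [bstPrefix]
  congr 1
  refine List.ext_getElem (by simp) fun i h1 h2 => by simp

theorem psi_eq_gap_of_isFull {Y : ℕ → I} {k d : ℕ} (h : IsFull (bstPrefix Y k) d) {v : List Bool}
    (hv : v.length ≤ d) : psi Y v = gap (labelFun (bstPrefix Y k)) v := by
  have hlab : ∀ u : List Bool, u.length < v.length →
      (((infiniteBST Y u).getD 0 : I) : ℝ) = labelFun (bstPrefix Y k) u := fun u hu => by
    have := h u (hu.trans_le hv)
    rw [mem_nodes, Option.isSome_iff_exists] at this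
    obtain ⟨a, ha⟩ := this
    rw [labelFun, ha, (infiniteBST_eq_some_iff Y u a).2 ⟨k, ha⟩]
  rw [psi_eq_gap, gap, gap, leftAncestor_congr hlab, rightAncestor_congr hlab]

theorem nodes_bstPrefix_mono [LinearOrder α] {Y : ℕ → α} {m n : ℕ} (hmn : m ≤ n) :
    nodes (bstPrefix Y m) ⊆ nodes (bstPrefix Y n) := by
  intro u hu
  rw [mem_nodes, Option.isSome_iff_exists] at hu
  obtain ⟨a, ha⟩ := hu
  rw [mem_nodes, label_bstPrefix_mono hmn ha]
  rfl

theorem isSome_infiniteBST_iff [LinearOrder α] {Y : ℕ → α} {u : List Bool} :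
    (infiniteBST Y u).isSome ↔ ∃ n, u ∈ nodes (bstPrefix Y n) := by
  simp only [mem_nodes, Option.isSome_iff_exists, infiniteBST_eq_some_iff]
  exact exists_comm

theorem eventually_isFull_bstPrefix [LinearOrder α] {Y : ℕ → α} {d : ℕ}
    (h : ∀ u : List Bool, u.length < d → (infiniteBST Y u).isSome) :
    ∀ᶠ k in atTop, IsFull (bstPrefix Y k) d := by
  have hfin : {u : List Bool | u.length < d}.Finite := List.finite_length_lt Bool d
  have := (hfin.eventually_all (l := atTop) (p := fun u k => u ∈ nodes (bstPrefix Y k))).2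
    fun u hu => by
      obtain ⟨n, hn⟩ := isSome_infiniteBST_iff.1 (h u hu)
      filter_upwards [eventually_ge_atTop n] with k hk using nodes_bstPrefix_mono hk hn
  exact this

/-- The values of `Y` are distinct, differ from `0` and `1`, and visit every open interval whose
endpoints are values of `Y` or endpoints of `[0, 1]`. -/
structure IsScattered (Y : ℕ → I) : Prop where
  injective : Function.Injective Y
  pos : ∀ k, (0 : ℝ) < Y k
  lt_one : ∀ k, (Y k : ℝ) < 1
  exists_between : ∀ a b : I, (a = 0 ∨ ∃ j, a = Y j) → (b = 1 ∨ ∃ j, b = Y j) → a < b →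
    ∃ m, a < Y m ∧ Y m < b

theorem IsScattered.leftAncestor_lt {Y : ℕ → I} (hY : IsScattered Y) {n : ℕ} {v : List Bool}
    (h : IsFull (bstPrefix Y n) v.length) :
    leftAncestor (labelFun (bstPrefix Y n)) v < rightAncestor (labelFun (bstPrefix Y n)) v ∧
    ((nodes (bstPrefix Y n)).filter (fun u => v <+: u)).card =
      ((List.range n).map Y).countP (fun x : I => leftAncestor (labelFun (bstPrefix Y n)) v < x ∧
        x < rightAncestor (labelFun (bstPrefix Y n)) v) := by
  refine leftAncestor_lt_rightAncestor_and_card (List.nodup_range.map hY.injective) ?_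
    fun u hu hne => h u (proper_prefix_length_lt hu hne)
  intro x hx
  obtain ⟨i, -, rfl⟩ := List.mem_map.1 hx
  exact ⟨hY.pos i, hY.lt_one i⟩

theorem exists_labelFun_eq {Y : ℕ → I} {n : ℕ} {u : List Bool} (hu : u ∈ nodes (bstPrefix Y n)) :
    ∃ j, labelFun (bstPrefix Y n) u = Y j := by
  rw [mem_nodes, Option.isSome_iff_exists, bstPrefix, bst_map, label_map] at hu
  obtain ⟨a, ha⟩ := hu
  rw [labelFun, bstPrefix, bst_map, label_map, ha]
  obtain ⟨j, -, rfl⟩ := Option.map_eq_some_iff.1 ha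
  exact ⟨j, rfl⟩

/-- A scattered sequence has a complete binary search tree. -/
theorem IsScattered.isSome_infiniteBST {Y : ℕ → I} (hY : IsScattered Y) (v : List Bool) :
    (infiniteBST Y v).isSome := by
  induction hd : v.length using Nat.strong_induction_on generalizing v with
  | _ d ih =>
    obtain ⟨n, hn⟩ := (eventually_isFull_bstPrefix (Y := Y) (d := v.length)
      fun u hu => ih u.length (hd ▸ hu) u rfl).exists
    have hlt := (hY.leftAncestor_lt hn).1
    obtain ⟨a, ha, haY⟩ : ∃ a : I, (a : ℝ) = leftAncestor (labelFun (bstPrefix Y n)) v ∧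
        (a = 0 ∨ ∃ j, a = Y j) := by
      rcases leftAncestor_mem (labelFun (bstPrefix Y n)) v with h | ⟨u, hu, h⟩
      · exact ⟨0, by simp [h], Or.inl rfl⟩
      · obtain ⟨j, hj⟩ := exists_labelFun_eq (hn u hu)
        exact ⟨Y j, by rw [h, hj], Or.inr ⟨j, rfl⟩⟩
    obtain ⟨b, hb, hbY⟩ : ∃ b : I, (b : ℝ) = rightAncestor (labelFun (bstPrefix Y n)) v ∧
        (b = 1 ∨ ∃ j, b = Y j) := by
      rcases rightAncestor_mem (labelFun (bstPrefix Y n)) v with h | ⟨u, hu, h⟩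
      · exact ⟨1, by simp [h], Or.inl rfl⟩
      · obtain ⟨j, hj⟩ := exists_labelFun_eq (hn u hu)
        exact ⟨Y j, by rw [h, hj], Or.inr ⟨j, rfl⟩⟩
    rw [← ha, ← hb] at hlt
    obtain ⟨m, hm1, hm2⟩ := hY.exists_between a b haY hbY hlt
    -- once `Y m` has been inserted, it is in the subtree of `v`
    have hnN : n ≤ max n (m + 1) := le_max_left _ _
    have hfull : IsFull (bstPrefix Y (max n (m + 1))) v.length :=
      fun u hu => nodes_bstPrefix_mono hnN (hn u hu)
    have hlab : ∀ u : List Bool, u.length < v.length →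
        labelFun (bstPrefix Y (max n (m + 1))) u = labelFun (bstPrefix Y n) u := fun u hu => by
      have := hn u hu
      rw [mem_nodes, Option.isSome_iff_exists] at this
      obtain ⟨c, hc⟩ := this
      rw [labelFun, labelFun, hc, label_bstPrefix_mono hnN hc]
    have hcard := (hY.leftAncestor_lt hfull).2
    rw [leftAncestor_congr hlab, rightAncestor_congr hlab, ← ha, ← hb] at hcard
    have hpos : 0 < ((List.range (max n (m + 1))).map Y).countP
        (fun x : I => (a : ℝ) < x ∧ (x : ℝ) < b) := by
      rw [List.countP_pos_iff]
      exact ⟨Y m, List.mem_map.2 ⟨m, by simp, rfl⟩, by simpa using ⟨hm1, hm2⟩⟩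
    rw [← hcard, Finset.card_pos] at hpos
    obtain ⟨u, hu⟩ := hpos
    rw [Finset.mem_filter] at hu
    exact isSome_infiniteBST_iff.2 ⟨_, mem_nodes_of_prefix hu.2 hu.1⟩

theorem IsScattered.psi_mem_Psi {Y : ℕ → I} (hY : IsScattered Y) : psi Y ∈ Psi := by
  refine ⟨fun v => ?_, gap_nil _, fun v => gap_eq_add _ v⟩
  obtain ⟨n, hn⟩ := (eventually_isFull_bstPrefix (Y := Y) (d := v.length)
      fun u _ => hY.isSome_infiniteBST u).exists
  rw [psi_eq_gap_of_isFull hn le_rfl, gap]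
  have h1 := (hY.leftAncestor_lt hn).1
  have h2 := leftAncestor_mem_Icc (labelFun_mem (bstPrefix Y n)) v
  have h3 := rightAncestor_mem_Icc (labelFun_mem (bstPrefix Y n)) v
  constructor <;> linarith [h2.1, h3.2]

end Full

/-! ### Points of the unit square sorted by their first coordinate -/

section Sorted

variable {n : ℕ}

/-- The second coordinates of the points `p i`, in increasing order of the first coordinates. -/
noncomputable def sortedY (p : Fin n → I × I) : List I :=
  List.ofFn fun k => (p (Tuple.sort (fun i => (p i).1) k)).2

theorem pointsBST_eq_bst (p : Fin n → I × I) : pointsBST p = bst (sortedY p) := rfl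

theorem length_sortedY (p : Fin n → I × I) : (sortedY p).length = n := by simp [sortedY]

theorem sortedY_perm (p : Fin n → I × I) : (sortedY p).Perm (List.ofFn fun i => (p i).2) :=
  Equiv.Perm.ofFn_comp_perm (Tuple.sort fun i => (p i).1) (fun i => (p i).2)

theorem sortedY_eq_cons {p : Fin (n + 1) → I × I} (hp : Function.Injective fun i => (p i).1)
    {i : Fin (n + 1)} (hi : ∀ j, (p i).1 < (i.removeNth p j).1) :
    sortedY p = (p i).2 :: sortedY (i.removeNth p) := by
  have hsort : ∀ {m : ℕ} (q : Fin m → I × I), (Function.Injective fun i => (q i).1) →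
      (List.ofFn (q ∘ Tuple.sort fun i => (q i).1)).Pairwise (fun a b => a.1 < b.1) := by
    intro m q hq
    rw [List.pairwise_ofFn]
    intro a b hab
    refine lt_of_le_of_ne (Tuple.monotone_sort (fun i => (q i).1) hab.le) fun h => ?_
    exact hab.ne ((Tuple.sort fun i => (q i).1).injective (hq h))
  have hmem : ∀ {m : ℕ} (q : Fin m → I × I) (a : I × I),
      a ∈ List.ofFn (q ∘ Tuple.sort fun i => (q i).1) ↔ ∃ j, q j = a := by
    intro m q a
    rw [List.mem_ofFn]
    exact ((Tuple.sort fun i => (q i).1).surjective.exists (p := fun j => q j = a)).symm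
  have hrem : Function.Injective fun j => (i.removeNth p j).1 := fun a b hab =>
    Fin.succAbove_right_injective (hp hab)
  have h1 := hsort p hp
  have h2 : (p i :: List.ofFn (i.removeNth p ∘ Tuple.sort fun j => (i.removeNth p j).1)).Pairwise
      (fun a b => a.1 < b.1) := by
    refine List.Pairwise.cons (fun a ha => ?_) (hsort _ hrem)
    obtain ⟨j, rfl⟩ := (hmem _ _).1 ha
    exact hi j
  have hnd : ∀ {l : List (I × I)}, l.Pairwise (fun a b => a.1 < b.1) → l.Nodup := fun h =>
    h.imp fun {a b} hab => by rintro rfl; exact lt_irrefl _ hab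
  have hperm : (List.ofFn (p ∘ Tuple.sort fun i => (p i).1)).Perm
      (p i :: List.ofFn (i.removeNth p ∘ Tuple.sort fun j => (i.removeNth p j).1)) := by
    rw [List.perm_ext_iff_of_nodup (hnd h1) (hnd h2)]
    intro a
    rw [hmem, List.mem_cons, hmem, Fin.exists_iff_succAbove i]
    simp only [Fin.removeNth, eq_comm]
  have heq := List.Perm.eq_of_pairwise (le := fun a b : I × I => a.1 < b.1)
    (fun a b _ _ hab hba => absurd (hab.trans hba) (lt_irrefl _)) h1 h2 hperm
  have := congrArg (List.map Prod.snd) heq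
  simpa [sortedY, List.map_ofFn, Function.comp_def] using this

theorem measurableSet_sort_eq (τ : Equiv.Perm (Fin n)) :
    MeasurableSet {p : Fin n → I × I | Tuple.sort (fun i => (p i).1) = τ} := by
  have : {p : Fin n → I × I | Tuple.sort (fun i => (p i).1) = τ} =
      {p | (∀ i j, i ≤ j → (p (τ i)).1 ≤ (p (τ j)).1) ∧
        ∀ i j, i < j → (p (τ i)).1 = (p (τ j)).1 → τ i < τ j} := by
    ext p
    exact eq_comm.trans Tuple.eq_sort_iff
  rw [this]
  measurability

/-- To check that a function of the sorted points is measurable, the sorting permutation may be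
frozen. -/
theorem measurable_of_sort {β : Type*} [MeasurableSpace β]
    {G : Equiv.Perm (Fin n) → (Fin n → I × I) → β} (hG : ∀ τ, Measurable (G τ)) :
    Measurable fun p : Fin n → I × I => G (Tuple.sort fun i => (p i).1) p := by
  intro s hs
  have : (fun p : Fin n → I × I => G (Tuple.sort fun i => (p i).1) p) ⁻¹' s =
      ⋃ τ, {p | Tuple.sort (fun i => (p i).1) = τ} ∩ G τ ⁻¹' s := by
    ext p
    simp
  rw [this]
  exact MeasurableSet.iUnion fun τ => (measurableSet_sort_eq τ).inter (hG τ hs)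

/-- A function of finitely many points that depends measurably on them once the comparisons
between them are frozen is measurable. -/
theorem measurable_of_comparisons {β : Type*} [MeasurableSpace β]
    {G : (Fin n → Fin n → Prop) → (Fin n → I) → β} (hG : ∀ r, Measurable (G r)) :
    Measurable fun y : Fin n → I => G (fun i j => y i < y j) y := by
  intro s hs
  have : (fun y : Fin n → I => G (fun i j => y i < y j) y) ⁻¹' s =
      ⋃ r : Fin n → Fin n → Prop, {y | (fun i j => y i < y j) = r} ∩ G r ⁻¹' s := by
    ext y
    simp
  rw [this]
  refine MeasurableSet.iUnion fun r => MeasurableSet.inter ?_ (hG r hs)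
  have : {y : Fin n → I | (fun i j => y i < y j) = r} = {y | ∀ i j, (y i < y j ↔ r i j)} := by
    ext y
    simp [funext_iff]
  rw [this]
  simp only [Set.ofPred_forall]
  refine MeasurableSet.iInter fun i => MeasurableSet.iInter fun j => ?_
  have hm : MeasurableSet {y : Fin n → I | y i < y j} :=
    measurableSet_lt (measurable_pi_apply i) (measurable_pi_apply j)
  by_cases h : r i j
  · simp only [h, iff_true]
    exact hm
  · simp only [h, iff_false]
    exact hm.compl

theorem measurable_subtreeProportion_pointsBST :
    Measurable fun p : Fin n → I × I => subtreeProportion (pointsBST p) := by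
  refine measurable_pi_lambda _ fun v => ?_
  refine measurable_of_sort (G := fun τ p => subtreeProportion (bst (List.ofFn fun k =>
    (p (τ k)).2)) v) fun τ => ?_
  have h : Measurable fun y : Fin n → I => subtreeProportion (bst (List.ofFn y)) v := by
    have := measurable_of_comparisons (n := n) (G := fun r _ =>
      (((nodes (bstBy r (List.finRange n))).filter (fun u => v <+: u)).card : ℝ) /
        ((nodes (bstBy r (List.finRange n))).card : ℝ)) fun r => measurable_const
    convert this using 2 with y
    rw [subtreeProportion, List.ofFn_eq_map, bst_map, nodes_map]
  exact h.comp (measurable_pi_lambda _ fun k => measurable_snd.comp (measurable_pi_apply (τ k)))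

theorem measurable_labelFun_bst_ofFn (u : List Bool) :
    Measurable fun y : Fin n → I => labelFun (bst (List.ofFn y)) u := by
  have := measurable_of_comparisons (n := n) (G := fun r y =>
    ((((label (bstBy r (List.finRange n)) u).map y).getD 0 : I) : ℝ)) fun r => by
      cases label (bstBy r (List.finRange n)) u with
      | none => simp
      | some i =>
        simp only [Option.map_some, Option.getD_some]
        exact measurable_subtype_coe.comp (measurable_pi_apply i)
  convert this using 2 with y
  rw [labelFun, List.ofFn_eq_map, bst_map, label_map]

theorem measurable_gap {X : Type*} [MeasurableSpace X] {g : X → List Bool → ℝ}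
    (hg : ∀ u, Measurable fun x => g x u) (v : List Bool) : Measurable fun x => gap (g x) v := by
  suffices h : (Measurable fun x => leftAncestor (g x) v) ∧
      Measurable fun x => rightAncestor (g x) v from h.2.sub h.1
  induction v using List.reverseRecOn with
  | nil => simp
  | append_singleton v b ih =>
    cases b
    · simpa using ⟨ih.1, hg v⟩
    · simpa using ⟨hg v, ih.2⟩

theorem measurable_psi : Measurable (psi : (ℕ → I) → List Bool → ℝ) := by
  refine measurable_pi_lambda _ fun v => ?_
  refine measurable_gap (g := fun Y u => (((infiniteBST Y u).getD 0 : I) : ℝ)) (fun u => ?_) v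
  refine measurable_of_tendsto_metrizable (f := fun n (Y : ℕ → I) => labelFun (bstPrefix Y n) u)
    (fun n => ?_) ?_
  · simp_rw [← bst_ofFn_eq_bstPrefix]
    exact (measurable_labelFun_bst_ofFn u).comp
      (measurable_pi_lambda _ fun i => measurable_pi_apply (i : ℕ))
  · rw [tendsto_pi_nhds]
    intro Y
    refine tendsto_const_nhds.congr' ?_
    by_cases h : (infiniteBST Y u).isSome
    · obtain ⟨a, ha⟩ := Option.isSome_iff_exists.1 h
      obtain ⟨n, hn⟩ := (infiniteBST_eq_some_iff Y u a).1 ha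
      filter_upwards [eventually_ge_atTop n] with m hm
      simp only [labelFun, label_bstPrefix_mono hm hn, ha]
    · refine Eventually.of_forall fun n => ?_
      have : label (bstPrefix Y n) u = none := by
        by_contra h'
        obtain ⟨a, ha⟩ := Option.ne_none_iff_exists'.1 h'
        exact h (by rw [(infiniteBST_eq_some_iff Y u a).2 ⟨n, ha⟩]; rfl)
      simp only [labelFun, this, Option.not_isSome_iff_eq_none.1 h]

end Sorted

/-! ### Independence: distinct values -/

section Distinct

theorem ae_injective_of_iIndepFun {ι Ω α : Type*} [Countable ι] [MeasurableSpace Ω]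
    [MeasurableSpace α] [MeasurableEq α] {P : Measure Ω} [IsProbabilityMeasure P]
    {X : ι → Ω → α} (hX : ∀ i, AEMeasurable (X i) P) (hind : iIndepFun X P)
    (hatom : ∀ i c, P.map (X i) {c} = 0) :
    ∀ᵐ ω ∂P, Function.Injective fun i => X i ω := by
  have key : ∀ i j, i ≠ j → ∀ᵐ ω ∂P, X i ω ≠ X j ω := by
    intro i j hij
    have h1 := (indepFun_iff_map_prod_eq_prod_map_map (hX i) (hX j)).1 (hind.indepFun hij)
    have := Measure.isProbabilityMeasure_map (hX i)
    have := Measure.isProbabilityMeasure_map (hX j)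
    have hs : MeasurableSet {q : α × α | q.1 = q.2} :=
      measurableSet_eq_fun measurable_fst measurable_snd
    have h2 : ((P.map (X i)).prod (P.map (X j))) {q : α × α | q.1 = q.2} = 0 := by
      rw [Measure.measure_prod_null hs]
      refine Eventually.of_forall fun a => ?_
      have : (Prod.mk a ⁻¹' {q : α × α | q.1 = q.2}) = {a} := by
        ext b; simp [eq_comm]
      change P.map (X j) (Prod.mk a ⁻¹' {q : α × α | q.1 = q.2}) = 0
      rw [this]
      exact hatom j a
    rw [← h1, Measure.map_apply_of_aemeasurable ((hX i).prodMk (hX j)) hs] at h2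
    rw [ae_iff]
    simpa using h2
  have : ∀ᵐ ω ∂P, ∀ i j, i ≠ j → X i ω ≠ X j ω := by
    rw [ae_all_iff]; intro i
    rw [ae_all_iff]; intro j
    by_cases hij : i = j
    · simp [hij]
    · filter_upwards [key i j hij] with ω hω _ using hω
  filter_upwards [this] with ω hω i j h
  by_contra hij
  exact hω i j hij h

variable {μ : Measure (I × I)} [IsProbabilityMeasure μ]

theorem ae_injective_pi {n : ℕ} {g : I × I → I} (hg : Measurable g) (hatom : μ.map g = volume) :
    ∀ᵐ p ∂(Measure.pi fun _ : Fin n => μ), Function.Injective fun i => g (p i) := by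
  have hm : ∀ i : Fin n, Measurable fun p : Fin n → I × I => g (p i) :=
    fun i => hg.comp (measurable_pi_apply i)
  refine ae_injective_of_iIndepFun (fun i => (hm i).aemeasurable)
    (iIndepFun_pi (μ := fun _ : Fin n => μ) (X := fun _ => g) fun _ => hg.aemeasurable)
    fun i c => ?_
  have : (fun p : Fin n → I × I => g (p i)) = g ∘ Function.eval i := rfl
  rw [this, ← Measure.map_map hg (measurable_pi_apply i),
    (measurePreserving_eval (fun _ : Fin n => μ) i).map_eq, hatom]
  exact measure_singleton c

end Distinct

/-! ### The leftmost points of an i.i.d. sample -/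

section Leftmost

/-- The product `f₀(y₀) f₁(y₁) ⋯` along two lists, up to the end of the list of functions; it is
`0` when there are fewer points than functions. -/
noncomputable def prodAlong : List (I → ℝ) → List I → ℝ
  | [], _ => 1
  | _ :: _, [] => 0
  | f :: fs, y :: L => f y * prodAlong fs L

theorem abs_prodAlong_le {fs : List (I → ℝ)} (hfs : ∀ f ∈ fs, ∀ y, |f y| ≤ 1) (L : List I) :
    |prodAlong fs L| ≤ 1 := by
  induction fs generalizing L with
  | nil => simp [prodAlong]
  | cons f fs ih =>
    cases L with
    | nil => simp [prodAlong]
    | cons y L =>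
      rw [prodAlong, abs_mul]
      exact mul_le_one₀ (hfs f (by simp) y) (abs_nonneg _)
        (ih (fun g hg => hfs g (by simp [hg])) L)

theorem measurable_prodAlong_ofFn {n : ℕ} {fs : List (I → ℝ)} (hfs : ∀ f ∈ fs, Measurable f) :
    Measurable fun y : Fin n → I => prodAlong fs (List.ofFn y) := by
  induction fs generalizing n with
  | nil => simp [prodAlong]
  | cons f fs ih =>
    cases n with
    | zero => simp [prodAlong]
    | succ n =>
      simp only [List.ofFn_succ, prodAlong]
      refine ((hfs f (by simp)).comp (measurable_pi_apply 0)).mul ?_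
      exact (ih fun g hg => hfs g (by simp [hg])).comp
        (measurable_pi_lambda _ fun k : Fin n => measurable_pi_apply k.succ)

theorem measurable_prodAlong_sortedY {n : ℕ} {fs : List (I → ℝ)} (hfs : ∀ f ∈ fs, Measurable f) :
    Measurable fun p : Fin n → I × I => prodAlong fs (sortedY p) :=
  measurable_of_sort (G := fun τ p => prodAlong fs (List.ofFn fun k => (p (τ k)).2)) fun τ =>
    (measurable_prodAlong_ofFn hfs).comp
      (measurable_pi_lambda _ fun k => measurable_snd.comp (measurable_pi_apply (τ k)))

/-- The set of families of points that all lie strictly to the right of the abscissa `x`. -/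
def rightOf (n : ℕ) (x : ℝ) : Set (Fin n → I × I) := {p | ∀ i, x < (p i).1}

theorem measurableSet_rightOf (n : ℕ) (x : ℝ) : MeasurableSet (rightOf n x) := by
  have : rightOf n x = ⋂ i, {p | x < ((p i).1 : ℝ)} := by ext p; simp [rightOf]
  rw [this]
  exact MeasurableSet.iInter fun i => measurableSet_lt measurable_const (by fun_prop)

/-- The expectation of `f₀(y₀) f₁(y₁) ⋯`, where `y₀, y₁, …` are the second coordinates of the
leftmost points, in order, of `n` i.i.d. points with law `μ`, on the event that all of them are to
the right of `x`. -/
noncomputable def leftmostExp (μ : Measure (I × I)) (fs : List (I → ℝ)) (n : ℕ) (x : ℝ) : ℝ :=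
  ∫ p, (rightOf n x).indicator (fun p => prodAlong fs (sortedY p)) p ∂(Measure.pi fun _ => μ)

theorem volume_Ioi_coe {x : ℝ} (hx : x ∈ Set.Icc (0 : ℝ) 1) :
    (volume : Measure I) {t : I | x < t} = ENNReal.ofReal (1 - x) := by
  have : {t : I | x < t} = Set.Ioi ⟨x, hx⟩ := rfl
  rw [this, unitInterval.volume_Ioi]

theorem measure_fst_gt {μ : Measure (I × I)} (hμ : μ.map Prod.fst = volume) {x : ℝ}
    (hx : x ∈ Set.Icc (0 : ℝ) 1) :
    μ {q : I × I | x < q.1} = ENNReal.ofReal (1 - x) := by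
  rw [← volume_Ioi_coe hx, ← hμ, Measure.map_apply measurable_fst]
  · rfl
  · exact measurableSet_lt measurable_const measurable_subtype_coe

variable {μ : Measure (I × I)} [IsProbabilityMeasure μ]

theorem integrable_of_abs_le {X : Type*} [MeasurableSpace X] {m : Measure X} [IsFiniteMeasure m]
    {f : X → ℝ} (hf : Measurable f) {C : ℝ} (h : ∀ x, |f x| ≤ C) : Integrable f m :=
  Integrable.of_bound hf.aestronglyMeasurable C (Eventually.of_forall h)

theorem measureReal_rightOf (hμ : μ.map Prod.fst = volume) (n : ℕ) {x : ℝ}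
    (hx : x ∈ Set.Icc (0 : ℝ) 1) :
    (Measure.pi fun _ : Fin n => μ).real (rightOf n x) = (1 - x) ^ n := by
  have : rightOf n x = Set.univ.pi fun _ => {q : I × I | x < q.1} := by
    ext p; simp [rightOf]
  rw [Measure.real, this, Measure.pi_pi]
  simp [measure_fst_gt hμ hx, ENNReal.toReal_ofReal (sub_nonneg.2 hx.2)]

theorem leftmostExp_nil (hμ : μ.map Prod.fst = volume) (n : ℕ) {x : ℝ}
    (hx : x ∈ Set.Icc (0 : ℝ) 1) : leftmostExp μ [] n x = (1 - x) ^ n := by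
  rw [← measureReal_rightOf hμ n hx, leftmostExp]
  simp only [prodAlong]
  rw [integral_indicator (measurableSet_rightOf n x)]
  simp

theorem abs_leftmostExp_le (hμ : μ.map Prod.fst = volume) {fs : List (I → ℝ)}
    (hfs : ∀ f ∈ fs, ∀ y, |f y| ≤ 1) (n : ℕ) {x : ℝ} (hx : x ∈ Set.Icc (0 : ℝ) 1) :
    |leftmostExp μ fs n x| ≤ (1 - x) ^ n := by
  rw [← measureReal_rightOf hμ n hx, leftmostExp, integral_indicator (measurableSet_rightOf n x)]
  have := norm_setIntegral_le_of_norm_le_const (μ := Measure.pi fun _ : Fin n => μ)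
    (s := rightOf n x) (f := fun p => prodAlong fs (sortedY p)) (C := 1)
    (measure_lt_top _ _) fun p _ => abs_prodAlong_le hfs _
  simpa using this

theorem measurable_leftmostExp {fs : List (I → ℝ)} (hfs : ∀ f ∈ fs, Measurable f) (n : ℕ) :
    Measurable (leftmostExp μ fs n) := by
  have hs : MeasurableSet {z : ℝ × (Fin n → I × I) | z.2 ∈ rightOf n z.1} := by
    have : {z : ℝ × (Fin n → I × I) | z.2 ∈ rightOf n z.1} =
      ⋂ i, {z | z.1 < ((z.2 i).1 : ℝ)} := by ext p; simp [rightOf]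
    rw [this]
    exact MeasurableSet.iInter fun i => measurableSet_lt measurable_fst (by fun_prop)
  have hm : Measurable fun z : ℝ × (Fin n → I × I) =>
      (rightOf n z.1).indicator (fun p => prodAlong fs (sortedY p)) z.2 :=
    ((measurable_prodAlong_sortedY hfs).comp measurable_snd).indicator hs
  exact (hm.stronglyMeasurable.integral_prod_right
    (ν := Measure.pi fun _ : Fin n => μ)).measurable

/-- Recursion on the leftmost point: it is any of the `n + 1` points, and, given its position `q`,
the other points are i.i.d. and have to be to the right of `q`. -/
theorem leftmostExp_cons (hμ : μ.map Prod.fst = volume) {f : I → ℝ} {fs : List (I → ℝ)}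
    (hf : Measurable f) (hfb : ∀ y, |f y| ≤ 1) (hfs : ∀ f ∈ fs, Measurable f)
    (hfsb : ∀ f ∈ fs, ∀ y, |f y| ≤ 1) (n : ℕ) (x : ℝ) :
    leftmostExp μ (f :: fs) (n + 1) x =
      (n + 1) * ∫ q in {q : I × I | x < q.1}, f q.2 * leftmostExp μ fs n q.1 ∂μ := by
  have hS : MeasurableSet {q : I × I | x < q.1} := measurableSet_lt measurable_const (by fun_prop)
  have hs : MeasurableSet {z : (I × I) × (Fin n → I × I) | z.2 ∈ rightOf n z.1.1} := by
    have : {z : (I × I) × (Fin n → I × I) | z.2 ∈ rightOf n z.1.1} =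
      ⋂ i, {z | (z.1.1 : ℝ) < ((z.2 i).1 : ℝ)} := by ext p; simp [rightOf]
    rw [this]
    exact MeasurableSet.iInter fun i => measurableSet_lt (by fun_prop) (by fun_prop)
  let H : (I × I) × (Fin n → I × I) → ℝ := fun z =>
    {q : I × I | x < q.1}.indicator (fun q => f q.2) z.1 *
      (rightOf n z.1.1).indicator (fun p => prodAlong fs (sortedY p)) z.2
  have hHm : Measurable H :=
    (((hf.comp measurable_snd).indicator hS).comp measurable_fst).mul
      (((measurable_prodAlong_sortedY hfs).comp measurable_snd).indicator hs)
  have hHb : ∀ z, |H z| ≤ 1 := fun z => by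
    rw [abs_mul]
    refine mul_le_one₀ ?_ (abs_nonneg _) ?_
    · by_cases h : z.1 ∈ {q : I × I | x < q.1} <;> simp [h, hfb]
    · by_cases h : z.2 ∈ rightOf n z.1.1 <;> simp [h, abs_prodAlong_le hfsb]
  have hHi : Integrable H (μ.prod (Measure.pi fun _ : Fin n => μ)) := integrable_of_abs_le hHm hHb
  have hpres : ∀ i : Fin (n + 1), MeasurePreserving
      (MeasurableEquiv.piFinSuccAbove (fun _ => I × I) i) (Measure.pi fun _ => μ)
        (μ.prod (Measure.pi fun _ => μ)) := fun i =>
    measurePreserving_piFinSuccAbove (fun _ : Fin (n + 1) => μ) i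
  have hHint : ∫ z, H z ∂(μ.prod (Measure.pi fun _ : Fin n => μ)) =
      ∫ q in {q : I × I | x < q.1}, f q.2 * leftmostExp μ fs n q.1 ∂μ := by
    rw [integral_prod _ hHi, ← integral_indicator hS]
    refine integral_congr_ae (Eventually.of_forall fun q => ?_)
    simp only [H]
    rw [integral_const_mul]
    by_cases h : q ∈ {q : I × I | x < q.1} <;> simp [h, leftmostExp]
  have hae : ∀ᵐ p ∂(Measure.pi fun _ : Fin (n + 1) => μ),
      (rightOf (n + 1) x).indicator (fun p => prodAlong (f :: fs) (sortedY p)) p =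
        ∑ i : Fin (n + 1), H (MeasurableEquiv.piFinSuccAbove (fun _ => I × I) i p) := by
    filter_upwards [ae_injective_pi (n := n + 1) measurable_fst hμ] with p hp
    -- the leftmost point
    obtain ⟨i, -, hi⟩ := Finset.exists_min_image Finset.univ (fun i => (p i).1)
      Finset.univ_nonempty
    have hi' : ∀ j, (p i).1 < (i.removeNth p j).1 := fun j =>
      lt_of_le_of_ne (hi _ (Finset.mem_univ _)) fun h => Fin.succAbove_ne i j (hp h).symm
    have hval : ∀ k, MeasurableEquiv.piFinSuccAbove (fun _ => I × I) k p =
        (p k, k.removeNth p) := fun k => rfl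
    rw [Finset.sum_eq_single i]
    · rw [hval]
      have hr : i.removeNth p ∈ rightOf n (p i).1 := fun j => hi' j
      simp only [H]
      rw [Set.indicator_of_mem hr]
      by_cases hx : x < ((p i).1 : ℝ)
      · have h1 : p ∈ rightOf (n + 1) x := fun j =>
          hx.trans_le (Subtype.coe_le_coe.2 (hi j (Finset.mem_univ _)))
        rw [Set.indicator_of_mem h1, sortedY_eq_cons hp hi', prodAlong,
          Set.indicator_of_mem (by exact hx)]
      · have h1 : p ∉ rightOf (n + 1) x := fun h => hx (h i)
        rw [Set.indicator_of_notMem h1, Set.indicator_of_notMem (by exact hx), zero_mul]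
    · intro k _ hk
      rw [hval]
      have hr : k.removeNth p ∉ rightOf n (p k).1 := fun h => by
        obtain ⟨j, hj⟩ := Fin.exists_succAbove_eq hk.symm
        have h2 : ((p k).1 : ℝ) < (p (k.succAbove j)).1 := h j
        rw [hj] at h2
        exact absurd (hi k (Finset.mem_univ _)) (not_le.2 h2)
      simp only [H]
      rw [Set.indicator_of_notMem hr, mul_zero]
    · simp
  rw [leftmostExp, integral_congr_ae hae, integral_finsetSum]
  · have : ∀ i : Fin (n + 1), ∫ p, H (MeasurableEquiv.piFinSuccAbove (fun _ => I × I) i p)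
        ∂(Measure.pi fun _ : Fin (n + 1) => μ) = ∫ z, H z ∂(μ.prod (Measure.pi fun _ => μ)) :=
      fun i => (hpres i).integral_comp' H
    simp_rw [this]
    rw [hHint]
    simp
  · intro i _
    exact (hpres i).integrable_comp_of_integrable hHi

end Leftmost

/-! ### Asymptotics of the leftmost points -/

section Asymptotics

variable {μ : Measure (I × I)}

theorem measurePreserving_fst_coe (hμ : μ.map Prod.fst = volume) :
    MeasurePreserving (fun q : I × I => (q.1 : ℝ)) μ (volume.restrict (Set.Icc 0 1)) :=
  unitInterval.measurePreserving_coe.comp ⟨measurable_fst, hμ⟩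

theorem integral_fst (hμ : μ.map Prod.fst = volume) {h : ℝ → ℝ} (hh : Measurable h) :
    ∫ q, h q.1 ∂μ = ∫ t in (0 : ℝ)..1, h t := by
  rw [intervalIntegral.integral_of_le zero_le_one, ← integral_Icc_eq_integral_Ioc,
    ← (measurePreserving_fst_coe hμ).map_eq,
    integral_map (measurePreserving_fst_coe hμ).measurable.aemeasurable
      hh.aestronglyMeasurable]

/-- The integral of `f` against the measure `μ([0, t] × ·)`. -/
noncomputable def sliceIntegral (μ : Measure (I × I)) (f : I → ℝ) (t : ℝ) : ℝ :=
  ∫ q in {q : I × I | (q.1 : ℝ) ≤ t}, f q.2 ∂μ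

/-- The averages of `f` against `(1/x) μ([0, x] × ·)` converge to `m` as `x → 0⁺`. -/
def HasSliceMean (μ : Measure (I × I)) (f : I → ℝ) (m : ℝ) : Prop :=
  Tendsto (fun x => x⁻¹ * sliceIntegral μ f x) (𝓝[>] 0) (𝓝 m)

theorem measurableSet_fst_le (t : ℝ) : MeasurableSet {q : I × I | (q.1 : ℝ) ≤ t} :=
  measurableSet_le (by fun_prop) measurable_const

variable [IsProbabilityMeasure μ]

theorem measureReal_fst_le (hμ : μ.map Prod.fst = volume) {t : ℝ} (ht : t ∈ Set.Icc (0 : ℝ) 1) :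
    μ.real {q : I × I | (q.1 : ℝ) ≤ t} = t := by
  have : {q : I × I | (q.1 : ℝ) ≤ t} = {q : I × I | t < q.1}ᶜ := by ext q; simp
  rw [this, probReal_compl_eq_one_sub, Measure.real, measure_fst_gt hμ ht,
    ENNReal.toReal_ofReal (sub_nonneg.2 ht.2)]
  · ring
  · exact measurableSet_lt measurable_const (by fun_prop)

theorem abs_sliceIntegral_le (hμ : μ.map Prod.fst = volume) {f : I → ℝ} {C : ℝ}
    (hfb : ∀ y, |f y| ≤ C) {t : ℝ} (ht : t ∈ Set.Icc (0 : ℝ) 1) :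
    |sliceIntegral μ f t| ≤ C * t := by
  have := norm_setIntegral_le_of_norm_le_const (μ := μ)
    (s := {q : I × I | (q.1 : ℝ) ≤ t}) (f := fun q => f q.2) (C := C)
    (measure_lt_top _ _) fun q _ => hfb _
  rwa [measureReal_fst_le hμ ht] at this

theorem HasSliceMean.abs_le_one (hμ : μ.map Prod.fst = volume) {f : I → ℝ} {m : ℝ}
    (hfb : ∀ y, |f y| ≤ 1) (hm : HasSliceMean μ f m) : |m| ≤ 1 := by
  refine le_of_tendsto hm.abs ?_
  filter_upwards [Ioc_mem_nhdsGT (zero_lt_one (α := ℝ))] with x hx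
  rw [abs_mul, abs_inv, abs_of_pos hx.1, inv_mul_le_iff₀ hx.1]
  linarith [abs_sliceIntegral_le hμ hfb ⟨hx.1.le, hx.2⟩]

theorem HasSliceMean.exists_bound (hμ : μ.map Prod.fst = volume) {f : I → ℝ} {m : ℝ}
    (hfb : ∀ y, |f y| ≤ 1) (hm : HasSliceMean μ f m) {ε : ℝ} (hε : 0 < ε) :
    ∃ K, 0 ≤ K ∧ ∀ t ∈ Set.Icc (0 : ℝ) 1, |sliceIntegral μ f t - m * t| ≤ ε * t + K * t ^ 2 := by
  have hm1 := hm.abs_le_one hμ hfb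
  have h1 : ∀ᶠ x in 𝓝[>] (0 : ℝ), |x⁻¹ * sliceIntegral μ f x - m| < ε := by
    have := (Metric.tendsto_nhds.1 hm) ε hε
    simpa [Real.dist_eq] using this
  obtain ⟨η, hη, hη'⟩ := (mem_nhdsGT_iff_exists_Ioo_subset).1 h1
  have hη0 : (0 : ℝ) < η := hη
  refine ⟨2 / η, by positivity, fun t ht => ?_⟩
  rcases ht.1.eq_or_lt with rfl | ht0
  · have := abs_sliceIntegral_le hμ hfb (t := 0) ⟨le_rfl, zero_le_one⟩
    simpa using this
  rcases lt_or_ge t η with hlt | hge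
  · have h2 : |t⁻¹ * sliceIntegral μ f t - m| < ε := hη' ⟨ht0, hlt⟩
    have h3 : sliceIntegral μ f t - m * t = t * (t⁻¹ * sliceIntegral μ f t - m) := by
      field_simp
    rw [h3, abs_mul, abs_of_pos ht0]
    have : 0 ≤ 2 / η * t ^ 2 := by positivity
    nlinarith
  · have h2 : |sliceIntegral μ f t - m * t| ≤ 2 * t := by
      have h4 := abs_sliceIntegral_le hμ hfb ht
      have h5 : |m * t| ≤ t := by
        rw [abs_mul, abs_of_pos ht0]; nlinarith
      calc _ ≤ |sliceIntegral μ f t| + |m * t| := abs_sub _ _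
        _ ≤ 2 * t := by linarith
    have h3 : 2 * t ≤ 2 / η * t ^ 2 := by
      rw [div_mul_eq_mul_div, le_div_iff₀ hη0]; nlinarith
    have : 0 ≤ ε * t := by positivity
    linarith

theorem integral_one_sub_pow (n : ℕ) {s : ℝ} :
    ∫ t in s..1, ((n : ℝ) + 1) * (1 - t) ^ n = (1 - s) ^ (n + 1) := by
  rw [intervalIntegral.integral_const_mul,
    intervalIntegral.integral_comp_sub_left (fun t => t ^ n) 1, integral_pow]
  have : (n : ℝ) + 1 ≠ 0 := by positivity
  field_simp
  simp

/-- The density of the abscissa of the second point from the left among `n + 2`, divided by the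
abscissa. -/
noncomputable def powKernel (n : ℕ) (t : ℝ) : ℝ := ((n : ℝ) + 2) * ((n + 1) * (1 - t) ^ n)

theorem continuous_powKernel (n : ℕ) : Continuous (powKernel n) := by
  unfold powKernel; fun_prop

theorem powKernel_nonneg (n : ℕ) {t : ℝ} (ht : t ≤ 1) : 0 ≤ powKernel n t := by
  have : 0 ≤ 1 - t := by linarith
  unfold powKernel; positivity

theorem integral_powKernel (n : ℕ) (s : ℝ) :
    ∫ t in s..1, powKernel n t = (n + 2) * (1 - s) ^ (n + 1) := by
  simp only [powKernel]
  rw [intervalIntegral.integral_const_mul, integral_one_sub_pow]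

theorem integral_powKernel_mul (n : ℕ) (ε K : ℝ) :
    ∫ t in (0 : ℝ)..1, powKernel n t * (ε * t + K * t ^ 2) = ε + 2 * K / (n + 3) := by
  have h : ∀ t : ℝ, powKernel n t * (ε * t + K * t ^ 2) =
      (fun s : ℝ => ((n : ℝ) + 2) * (n + 1) *
        ((ε + K) * s ^ n - (ε + 2 * K) * s ^ (n + 1) + K * s ^ (n + 2))) (1 - t) := by
    intro t; simp only [powKernel]; ring
  simp_rw [h]
  rw [intervalIntegral.integral_comp_sub_left (fun s : ℝ => ((n : ℝ) + 2) * (n + 1) *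
        ((ε + K) * s ^ n - (ε + 2 * K) * s ^ (n + 1) + K * s ^ (n + 2))) 1, sub_self, sub_zero,
    intervalIntegral.integral_const_mul, intervalIntegral.integral_add,
    intervalIntegral.integral_sub, intervalIntegral.integral_const_mul,
    intervalIntegral.integral_const_mul, intervalIntegral.integral_const_mul,
    integral_pow, integral_pow, integral_pow]
  · have h1 : (n : ℝ) + 1 ≠ 0 := by positivity
    have h2 : (n : ℝ) + 2 ≠ 0 := by positivity
    have h3 : (n : ℝ) + 3 ≠ 0 := by positivity
    have e2 : ((n + 1 : ℕ) : ℝ) + 1 = n + 2 := by push_cast; ring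
    have e3 : ((n + 2 : ℕ) : ℝ) + 1 = n + 3 := by push_cast; ring
    rw [e2, e3]
    simp only [one_pow, ne_eq, Nat.add_eq_zero_iff, one_ne_zero, and_false, not_false_eq_true,
      zero_pow, sub_zero, OfNat.ofNat_ne_zero]
    field_simp
    ring
  all_goals exact Continuous.intervalIntegrable (by fun_prop) _ _

/-- Fubini's theorem: integration by parts against the measure `f dμ`. -/
theorem setIntegral_pow_eq {f : I → ℝ} (hf : Measurable f)
    {C : ℝ} (hfb : ∀ y, |f y| ≤ C) (n : ℕ) {x : ℝ} (hx : x ∈ Set.Icc (0 : ℝ) 1) :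
    ∫ q in {q : I × I | x < q.1}, (n + 2) * (1 - (q.1 : ℝ)) ^ (n + 1) * f q.2 ∂μ =
      ∫ t in x..1, powKernel n t * (sliceIntegral μ f t - sliceIntegral μ f x) := by
  have hC : 0 ≤ C := (abs_nonneg _).trans (hfb 0)
  have hS : MeasurableSet {q : I × I | x < q.1} := measurableSet_lt measurable_const (by fun_prop)
  let F : (I × I) → ℝ → ℝ := fun q t =>
    {q : I × I | x < q.1}.indicator (fun q => f q.2) q *
      (Set.Ici (q.1 : ℝ)).indicator (powKernel n) t
  have hFm : Measurable (Function.uncurry F) := by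
    refine (((hf.comp measurable_snd).indicator hS).comp measurable_fst).mul ?_
    have : MeasurableSet {z : (I × I) × ℝ | (z.1.1 : ℝ) ≤ z.2} :=
      measurableSet_le (by fun_prop) (by fun_prop)
    exact ((continuous_powKernel n).measurable.comp measurable_snd).indicator this
  have hFi : Integrable (Function.uncurry F) (μ.prod (volume.restrict (Set.Ioc x 1))) := by
    refine Integrable.of_bound hFm.aestronglyMeasurable
      (C * ((n + 2) * (n + 1))) ?_
    have hae : ∀ᵐ z ∂(μ.prod (volume.restrict (Set.Ioc x 1))), z.2 ∈ Set.Ioc x 1 :=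
      Measure.quasiMeasurePreserving_snd.ae (ae_restrict_mem measurableSet_Ioc)
    filter_upwards [hae] with z hz
    rw [Real.norm_eq_abs, Function.uncurry, abs_mul]
    refine mul_le_mul ?_ ?_ (abs_nonneg _) hC
    · by_cases h : z.1 ∈ {q : I × I | x < q.1} <;> simp [h, hfb, hC]
    · have h0 : 0 ≤ 1 - z.2 := by linarith [hz.2]
      have h1 : 1 - z.2 ≤ 1 := by linarith [hz.1, hx.1]
      have : |powKernel n z.2| ≤ (n + 2) * (n + 1) := by
        rw [abs_of_nonneg (powKernel_nonneg n hz.2), powKernel]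
        have := pow_le_one₀ (n := n) h0 h1
        gcongr
        nlinarith [(Nat.cast_nonneg n : (0 : ℝ) ≤ n)]
      by_cases h : z.2 ∈ Set.Ici (z.1.1 : ℝ)
      · rw [Set.indicator_of_mem h]; exact this
      · rw [Set.indicator_of_notMem h, abs_zero]; positivity
  have hswap := integral_integral_swap hFi
  have hL : ∫ q, (∫ t in Set.Ioc x 1, F q t) ∂μ =
      ∫ q in {q : I × I | x < q.1}, (n + 2) * (1 - (q.1 : ℝ)) ^ (n + 1) * f q.2 ∂μ := by
    rw [← integral_indicator hS]
    refine integral_congr_ae (Eventually.of_forall fun q => ?_)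
    simp only [F]
    rw [integral_const_mul, setIntegral_indicator measurableSet_Ici]
    by_cases h : q ∈ {q : I × I | x < q.1}
    · have h' : x < q.1 := h
      have : Set.Ioc x 1 ∩ Set.Ici (q.1 : ℝ) = Set.Icc (q.1 : ℝ) 1 := by
        ext t
        simp only [Set.mem_inter_iff, Set.mem_Ioc, Set.mem_Ici, Set.mem_Icc]
        exact ⟨fun h => ⟨h.2, h.1.2⟩, fun h => ⟨⟨h'.trans_le h.1, h.2⟩, h.1⟩⟩
      rw [this, integral_Icc_eq_integral_Ioc, ← intervalIntegral.integral_of_le q.1.2.2,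
        integral_powKernel, Set.indicator_of_mem h, Set.indicator_of_mem h]
      ring
    · rw [Set.indicator_of_notMem h, Set.indicator_of_notMem h, zero_mul]
  have hR : ∫ t in Set.Ioc x 1, (∫ q, F q t ∂μ) =
      ∫ t in x..1, powKernel n t * (sliceIntegral μ f t - sliceIntegral μ f x) := by
    rw [intervalIntegral.integral_of_le hx.2]
    refine setIntegral_congr_fun measurableSet_Ioc fun t ht => ?_
    have hi : ∀ s, Integrable ({q : I × I | (q.1 : ℝ) ≤ s}.indicator fun q => f q.2) μ := fun s =>
      (integrable_of_abs_le (hf.comp measurable_snd) fun q => hfb q.2).indicator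
        (measurableSet_fst_le s)
    simp only [F, sliceIntegral]
    rw [← integral_indicator (measurableSet_fst_le t),
      ← integral_indicator (measurableSet_fst_le x), ← integral_sub (hi t) (hi x),
      ← integral_const_mul]
    refine integral_congr_ae (Eventually.of_forall fun q => ?_)
    simp only [Set.indicator_apply, Set.mem_ofPred_eq, Set.mem_Ici]
    have hxt := ht.1
    split_ifs <;> linarith
  rw [← hL, hswap, hR]

theorem measurable_sliceIntegral {f : I → ℝ} (hf : Measurable f) :
    Measurable (sliceIntegral μ f) := by
  have hs : MeasurableSet {z : ℝ × (I × I) | (z.2.1 : ℝ) ≤ z.1} :=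
    measurableSet_le (by fun_prop) (by fun_prop)
  have hm : Measurable fun z : ℝ × (I × I) =>
      {q : I × I | (q.1 : ℝ) ≤ z.1}.indicator (fun q => f q.2) z.2 :=
    ((hf.comp measurable_snd).comp measurable_snd).indicator hs
  have := (hm.stronglyMeasurable.integral_prod_right' (ν := μ)).measurable
  convert this using 2 with t
  rw [sliceIntegral, integral_indicator (measurableSet_fst_le t)]

/-- The contribution of one more leftmost point, uniformly in the abscissa `x`. -/
theorem abs_setIntegral_pow_sub_le (hμ : μ.map Prod.fst = volume) {f : I → ℝ} (hf : Measurable f)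
    (hfb : ∀ y, |f y| ≤ 1) {m ε K : ℝ} (hε : 0 ≤ ε) (hK : 0 ≤ K)
    (hD : ∀ t ∈ Set.Icc (0 : ℝ) 1, |sliceIntegral μ f t - m * t| ≤ ε * t + K * t ^ 2)
    (n : ℕ) {x : ℝ} (hx : x ∈ Set.Icc (0 : ℝ) 1) :
    |(∫ q in {q : I × I | x < q.1}, (n + 2) * (1 - (q.1 : ℝ)) ^ (n + 1) * f q.2 ∂μ) -
      m * (1 - x) ^ (n + 2)| ≤ 2 * (ε + 2 * K / (n + 3)) := by
  have hGi : IntervalIntegrable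
      (fun t => powKernel n t * (sliceIntegral μ f t - sliceIntegral μ f x)) volume x 1 := by
    rw [intervalIntegrable_iff_integrableOn_Ioc_of_le hx.2]
    refine Integrable.of_bound (C := (n + 2) * (n + 1) * 2) ((continuous_powKernel n).measurable.mul
      ((measurable_sliceIntegral hf).sub_const _)).aestronglyMeasurable ?_
    filter_upwards [ae_restrict_mem measurableSet_Ioc] with t ht
    have ht' : t ∈ Set.Icc (0 : ℝ) 1 := ⟨hx.1.trans ht.1.le, ht.2⟩
    rw [Real.norm_eq_abs, abs_mul]
    refine mul_le_mul ?_ ?_ (abs_nonneg _) (by positivity)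
    · rw [abs_of_nonneg (powKernel_nonneg n ht.2), powKernel]
      have := pow_le_one₀ (n := n) (a := 1 - t) (by linarith [ht.2]) (by linarith [ht'.1])
      have h2 : ((n : ℝ) + 1) * (1 - t) ^ n ≤ (n + 1) * 1 := by gcongr
      nlinarith [(Nat.cast_nonneg n : (0 : ℝ) ≤ n)]
    · have h1 := abs_sliceIntegral_le hμ hfb ht'
      have h2 := abs_sliceIntegral_le hμ hfb hx
      calc _ ≤ |sliceIntegral μ f t| + |sliceIntegral μ f x| := abs_sub _ _
        _ ≤ 2 := by linarith [ht'.2, hx.2]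
  have hlin : m * (1 - x) ^ (n + 2) = ∫ t in x..1, powKernel n t * (m * t - m * x) := by
    have h : ∀ t : ℝ, powKernel n t * (m * t - m * x) =
        (fun s : ℝ => ((n : ℝ) + 2) * (n + 1) * m * ((1 - x) * s ^ n - s ^ (n + 1))) (1 - t) := by
      intro t; simp only [powKernel]; ring
    simp_rw [h]
    rw [intervalIntegral.integral_comp_sub_left
        (fun s : ℝ => ((n : ℝ) + 2) * (n + 1) * m * ((1 - x) * s ^ n - s ^ (n + 1))) 1, sub_self,
      intervalIntegral.integral_const_mul, intervalIntegral.integral_sub,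
      intervalIntegral.integral_const_mul, integral_pow, integral_pow]
    · have h1 : (n : ℝ) + 1 ≠ 0 := by positivity
      have h2 : (n : ℝ) + 2 ≠ 0 := by positivity
      have e2 : ((n + 1 : ℕ) : ℝ) + 1 = n + 2 := by push_cast; ring
      rw [e2]
      simp only [ne_eq, Nat.add_eq_zero_iff, one_ne_zero, and_false, not_false_eq_true,
        zero_pow, sub_zero]
      field_simp
      ring
    all_goals exact Continuous.intervalIntegrable (by fun_prop) _ _
  rw [setIntegral_pow_eq hf hfb n hx, hlin, ← intervalIntegral.integral_sub hGi
    (Continuous.intervalIntegrable (u := fun t => powKernel n t * (m * t - m * x))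
      ((continuous_powKernel n).mul (by fun_prop)) _ _)]
  have hBc : Continuous fun t : ℝ => 2 * (powKernel n t * (ε * t + K * t ^ 2)) :=
    continuous_const.mul ((continuous_powKernel n).mul (by fun_prop))
  calc _ ≤ ∫ t in x..1, 2 * (powKernel n t * (ε * t + K * t ^ 2)) := by
        rw [← Real.norm_eq_abs]
        refine intervalIntegral.norm_integral_le_of_norm_le hx.2 ?_ (hBc.intervalIntegrable _ _)
        refine Eventually.of_forall fun t ht => ?_
        have ht' : t ∈ Set.Icc (0 : ℝ) 1 := ⟨hx.1.trans ht.1.le, ht.2⟩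
        have h0 := powKernel_nonneg n ht.2
        have h1 := hD t ht'
        have h2 := hD x hx
        have h3 : ε * x + K * x ^ 2 ≤ ε * t + K * t ^ 2 := by
          have := ht.1.le
          have := hx.1
          gcongr
        have h4 : powKernel n t * (sliceIntegral μ f t - sliceIntegral μ f x) -
            powKernel n t * (m * t - m * x) = powKernel n t *
              ((sliceIntegral μ f t - m * t) - (sliceIntegral μ f x - m * x)) := by ring
        rw [h4, Real.norm_eq_abs, abs_mul, abs_of_nonneg h0]
        have h5 := abs_sub (sliceIntegral μ f t - m * t) (sliceIntegral μ f x - m * x)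
        nlinarith
    _ ≤ ∫ t in (0 : ℝ)..1, 2 * (powKernel n t * (ε * t + K * t ^ 2)) := by
        refine intervalIntegral.integral_mono_interval hx.1 hx.2 le_rfl ?_
          (hBc.intervalIntegrable _ _)
        filter_upwards [ae_restrict_mem measurableSet_Ioc] with t ht
        have := powKernel_nonneg n ht.2
        have := ht.1.le
        simp only [Pi.zero_apply]
        positivity
    _ = 2 * (ε + 2 * K / (n + 3)) := by
        rw [intervalIntegral.integral_const_mul, integral_powKernel_mul]

theorem integral_sqrt_one_sub_pow (n : ℕ) :
    ∫ t in (0 : ℝ)..1, √((1 - t) ^ n) = 2 / (n + 2) := by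
  rw [intervalIntegral.integral_comp_sub_left (fun t => √(t ^ n)) 1, sub_self, sub_zero]
  have : ∫ t in (0 : ℝ)..1, √(t ^ n) = ∫ t in (0 : ℝ)..1, t ^ ((n : ℝ) / 2) := by
    refine intervalIntegral.integral_congr fun t ht => ?_
    rw [Set.uIcc_of_le zero_le_one] at ht
    rw [Real.sqrt_eq_rpow, ← Real.rpow_natCast, ← Real.rpow_mul ht.1]
    congr 1
    ring
  rw [this, integral_rpow (Or.inl (by have : (0 : ℝ) ≤ n / 2 := by positivity
                                      linarith))]
  have h : (n : ℝ) / 2 + 1 ≠ 0 := by positivity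
  rw [Real.one_rpow, Real.zero_rpow h]
  field_simp
  ring

/-- If the slices of `μ` have the mean `m f` against each `f` of a list, then the second
coordinates of the leftmost points are asymptotically independent with these means, and
independent of the abscissa of the leftmost point. The uniformity in `x` is what makes the induction
on the number of points work. -/
theorem eventually_abs_leftmostExp_sub_le (hμ : μ.map Prod.fst = volume) {m : (I → ℝ) → ℝ}
    {fs : List (I → ℝ)} (hfs : ∀ f ∈ fs, Measurable f) (hfsb : ∀ f ∈ fs, ∀ y, |f y| ≤ 1)
    (hm : ∀ f ∈ fs, HasSliceMean μ f (m f)) {η : ℝ} (hη : 0 < η) :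
    ∀ᶠ n : ℕ in atTop, ∀ x ∈ Set.Icc (0 : ℝ) 1,
      |leftmostExp μ fs n x - (fs.map m).prod * (1 - x) ^ n| ≤ η := by
  induction fs generalizing η with
  | nil =>
    refine Eventually.of_forall fun n x hx => ?_
    simp [leftmostExp_nil hμ n hx, hη.le]
  | cons f fs ih =>
    simp only [List.mem_cons, forall_eq_or_imp] at hfs hfsb hm
    obtain ⟨hf, hfs⟩ := hfs
    obtain ⟨hfb, hfsb⟩ := hfsb
    obtain ⟨hmf, hm⟩ := hm
    set c := (fs.map m).prod with hc
    have hc1 : |c| ≤ 1 := by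
      have : ∀ gs : List (I → ℝ), (∀ f ∈ gs, |m f| ≤ 1) → |(gs.map m).prod| ≤ 1 := by
        intro gs
        induction gs with
        | nil => simp
        | cons g gs ih =>
          intro h
          rw [List.map_cons, List.prod_cons, abs_mul]
          exact mul_le_one₀ (h g (by simp)) (abs_nonneg _) (ih fun f hf => h f (by simp [hf]))
      exact this fs fun g hg => (hm g hg).abs_le_one hμ (hfsb g hg)
    obtain ⟨K, hK, hD⟩ := hmf.exists_bound hμ hfb (ε := η / 8) (by positivity)
    -- `2 * √(2 * θ) = η / 2`
    set θ := η ^ 2 / 32 with hθ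
    have hθ0 : 0 < θ := by positivity
    have hKlim : ∀ᶠ n : ℕ in atTop, 2 * K / ((n : ℝ) + 3) ≤ η / 8 := by
      have : Tendsto (fun n : ℕ => 2 * K / ((n : ℝ) + 3)) atTop (𝓝 0) :=
        tendsto_const_nhds.div_atTop
          (tendsto_atTop_add_const_right _ _ tendsto_natCast_atTop_atTop)
      exact (this.eventually_lt_const (by positivity)).mono fun n hn => hn.le
    have key : ∀ᶠ n : ℕ in atTop, ∀ x ∈ Set.Icc (0 : ℝ) 1,
        |leftmostExp μ (f :: fs) (n + 2) x - m f * c * (1 - x) ^ (n + 2)| ≤ η := by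
      filter_upwards [(tendsto_add_atTop_nat 1).eventually (ih hfs hfsb hm hθ0), hKlim]
        with n hn hKn x hx
      set Δ : ℝ → ℝ := fun t => leftmostExp μ fs (n + 1) t - c * (1 - t) ^ (n + 1) with hΔ
      have hΔm : Measurable Δ := (measurable_leftmostExp hfs (n + 1)).sub (by fun_prop)
      have hΔ2 : ∀ t ∈ Set.Icc (0 : ℝ) 1, |Δ t| ≤ 2 * (1 - t) ^ (n + 1) := fun t ht => by
        have h0 : 0 ≤ (1 - t) ^ (n + 1) := pow_nonneg (by linarith [ht.2]) _
        calc |Δ t| ≤ |leftmostExp μ fs (n + 1) t| + |c * (1 - t) ^ (n + 1)| := abs_sub _ _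
          _ ≤ (1 - t) ^ (n + 1) + 1 * (1 - t) ^ (n + 1) := by
            rw [abs_mul, abs_of_nonneg h0]
            gcongr
            exact abs_leftmostExp_le hμ hfsb _ ht
          _ = _ := by ring
      -- the geometric mean of the bounds `θ` and `2 * (1 - t) ^ (n + 1)`: it is small and its
      -- integral is of order `1 / n`, which compensates the factor `n + 2` of the recursion
      have hΔs : ∀ t ∈ Set.Icc (0 : ℝ) 1, |Δ t| ≤ √(2 * θ) * √((1 - t) ^ (n + 1)) :=
        fun t ht => by
          rw [← Real.sqrt_mul (by positivity)]
          refine Real.le_sqrt_of_sq_le ?_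
          have h1 := hΔ2 t ht
          have h2 : |Δ t| ≤ θ := hn t ht
          have h3 := abs_nonneg (Δ t)
          nlinarith
      have hΔ1 : ∀ q : I × I, |Δ q.1| ≤ 2 := fun q => by
        have h1 := hΔ2 q.1 q.1.2
        have h2 := pow_le_one₀ (n := n + 1) (a := 1 - (q.1 : ℝ)) (by linarith [q.1.2.2])
          (by linarith [q.1.2.1])
        linarith
      have hΔi : Integrable (fun q : I × I => Δ q.1) μ :=
        integrable_of_abs_le (hΔm.comp (by fun_prop)) hΔ1
      have hfΔi : Integrable (fun q : I × I => f q.2 * Δ q.1) μ :=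
        integrable_of_abs_le (C := 2) ((hf.comp measurable_snd).mul (hΔm.comp (by fun_prop)))
          fun q => by
            rw [abs_mul]
            nlinarith [hfb q.2, hΔ1 q, abs_nonneg (Δ q.1), abs_nonneg (f q.2)]
      have hpi : Integrable (fun q : I × I => (1 - (q.1 : ℝ)) ^ (n + 1) * f q.2) μ := by
        refine integrable_of_abs_le (C := 1) (by fun_prop) fun q => ?_
        rw [abs_mul]
        have h0 : 0 ≤ 1 - (q.1 : ℝ) := by linarith [q.1.2.2]
        rw [abs_of_nonneg (pow_nonneg h0 _)]
        exact mul_le_one₀ (pow_le_one₀ h0 (by linarith [q.1.2.1])) (abs_nonneg _) (hfb _)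
      have hsplit : leftmostExp μ (f :: fs) (n + 2) x - m f * c * (1 - x) ^ (n + 2) =
          (n + 2) * (∫ q in {q : I × I | x < q.1}, f q.2 * Δ q.1 ∂μ) +
          c * ((∫ q in {q : I × I | x < q.1}, (n + 2) * (1 - (q.1 : ℝ)) ^ (n + 1) * f q.2 ∂μ) -
            m f * (1 - x) ^ (n + 2)) := by
        have h1 : ∫ q in {q : I × I | x < q.1}, f q.2 * leftmostExp μ fs (n + 1) q.1 ∂μ =
            (∫ q in {q : I × I | x < q.1}, f q.2 * Δ q.1 ∂μ) +
              c * ∫ q in {q : I × I | x < q.1}, (1 - (q.1 : ℝ)) ^ (n + 1) * f q.2 ∂μ := by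
          rw [← integral_const_mul, ← integral_add hfΔi.integrableOn
            (hpi.const_mul c).integrableOn]
          refine integral_congr_ae (Eventually.of_forall fun q => ?_)
          simp only [hΔ]
          ring
        have h2 : ∫ q in {q : I × I | x < q.1}, (n + 2) * (1 - (q.1 : ℝ)) ^ (n + 1) * f q.2 ∂μ =
            (n + 2) * ∫ q in {q : I × I | x < q.1}, (1 - (q.1 : ℝ)) ^ (n + 1) * f q.2 ∂μ := by
          rw [← integral_const_mul]
          simp_rw [mul_assoc]
        rw [leftmostExp_cons hμ hf hfb hfs hfsb (n + 1) x, h1, h2]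
        push_cast
        ring
      have hfirst : |((n : ℝ) + 2) * (∫ q in {q : I × I | x < q.1}, f q.2 * Δ q.1 ∂μ)| ≤ η / 2 := by
        have h1 : |∫ q in {q : I × I | x < q.1}, f q.2 * Δ q.1 ∂μ| ≤
            √(2 * θ) * (2 / (n + 3)) := by
          calc _ ≤ ∫ q in {q : I × I | x < q.1}, |f q.2 * Δ q.1| ∂μ := abs_integral_le_integral_abs
            _ ≤ ∫ q, |f q.2 * Δ q.1| ∂μ :=
              setIntegral_le_integral hfΔi.abs (Eventually.of_forall fun q => abs_nonneg _)
            _ ≤ ∫ q, √(2 * θ) * √((1 - (q.1 : ℝ)) ^ (n + 1)) ∂μ := by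
              refine integral_mono hfΔi.abs ?_ fun q => ?_
              · refine integrable_of_abs_le (C := √(2 * θ)) (by fun_prop) fun q => ?_
                rw [abs_of_nonneg (by positivity)]
                have h0 : 0 ≤ 1 - (q.1 : ℝ) := by linarith [q.1.2.2]
                have : √((1 - (q.1 : ℝ)) ^ (n + 1)) ≤ 1 :=
                  Real.sqrt_le_one.2 (pow_le_one₀ h0 (by linarith [q.1.2.1]))
                nlinarith [Real.sqrt_nonneg (2 * θ)]
              · simp only [abs_mul]
                have := hΔs q.1 q.1.2
                nlinarith [hfb q.2, abs_nonneg (Δ q.1), abs_nonneg (f q.2)]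
            _ = √(2 * θ) * (2 / (n + 3)) := by
              rw [integral_fst hμ (h := fun t => √(2 * θ) * √((1 - t) ^ (n + 1))) (by fun_prop),
                intervalIntegral.integral_const_mul, integral_sqrt_one_sub_pow]
              push_cast
              ring_nf
        have h2 : √(2 * θ) = η / 4 := by
          rw [Real.sqrt_eq_iff_mul_self_eq (by positivity) (by positivity), hθ]
          ring
        rw [abs_mul, abs_of_nonneg (by positivity)]
        rw [h2] at h1
        calc _ ≤ ((n : ℝ) + 2) * (η / 4 * (2 / (n + 3))) := by gcongr
          _ = η / 2 * ((n + 2) / (n + 3)) := by ring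
          _ ≤ η / 2 * 1 := by
            gcongr
            rw [div_le_one (by positivity)]
            linarith
          _ = η / 2 := mul_one _
      have hsecond := abs_setIntegral_pow_sub_le hμ hf hfb (by positivity) hK hD n hx
      rw [hsplit]
      calc _ ≤ _ := abs_add_le _ _
        _ ≤ η / 2 + 1 * (2 * (η / 8 + 2 * K / (n + 3))) := by
          rw [abs_mul c]
          gcongr
        _ ≤ η := by linarith
    rw [List.map_cons, List.prod_cons, ← hc]
    obtain ⟨n₀, hn₀⟩ := eventually_atTop.1 key
    filter_upwards [eventually_ge_atTop (n₀ + 2)] with n hn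
    obtain ⟨k, rfl⟩ := Nat.exists_eq_add_of_le' (le_of_add_le_right hn)
    exact hn₀ k (by omega)

theorem tendsto_leftmostExp (hμ : μ.map Prod.fst = volume) {m : (I → ℝ) → ℝ}
    {fs : List (I → ℝ)} (hfs : ∀ f ∈ fs, Measurable f) (hfsb : ∀ f ∈ fs, ∀ y, |f y| ≤ 1)
    (hm : ∀ f ∈ fs, HasSliceMean μ f (m f)) :
    Tendsto (fun n => leftmostExp μ fs n 0) atTop (𝓝 (fs.map m).prod) := by
  rw [Metric.tendsto_atTop']
  intro ε hε
  obtain ⟨N, hN⟩ := eventually_atTop.1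
    (eventually_abs_leftmostExp_sub_le hμ hfs hfsb hm (half_pos hε))
  refine ⟨N, fun n hn => ?_⟩
  have := hN n hn.le 0 ⟨le_rfl, zero_le_one⟩
  rw [sub_zero, one_pow, mul_one] at this
  rw [Real.dist_eq]
  linarith

end Asymptotics

/-! ### Uniform law of large numbers for the second coordinates -/

section Empirical

theorem countP_Ioo_add_countP_le {a b : ℝ} (hab : a < b) (L : List I) :
    L.countP (fun x : I => a < x ∧ (x : ℝ) < b) + L.countP (fun x : I => (x : ℝ) ≤ a) =
      L.countP (fun x : I => (x : ℝ) < b) := by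
  induction L with
  | nil => simp
  | cons x L ih =>
    simp only [List.countP_cons]
    rw [← ih]
    simp only [decide_eq_true_eq]
    split_ifs <;> first | omega | (exfalso; grind)

/-- If the empirical distribution function is close to the identity on a grid, then the
proportion of points in any interval is close to its length. -/
theorem abs_countP_sub_le {L : List I} {M : ℕ} (hM : 0 < M) {η : ℝ} (hη : 0 ≤ η)
    (h : ∀ j ≤ M,
      |(L.countP (fun x : I => (x : ℝ) ≤ (j : ℝ) / M) : ℝ) / L.length - (j : ℝ) / M| ≤ η)
    {a b : ℝ} (ha : a ∈ Set.Icc (0 : ℝ) 1) (hb : b ∈ Set.Icc (0 : ℝ) 1) (hab : a < b) :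
    |(L.countP (fun x : I => a < x ∧ (x : ℝ) < b) : ℝ) / L.length - (b - a)| ≤
      2 * (η + 1 / M) := by
  have hM' : (0 : ℝ) < M := by exact_mod_cast hM
  have hl : (0 : ℝ) ≤ L.length := Nat.cast_nonneg _
  have hup : ∀ t ∈ Set.Icc (0 : ℝ) 1,
      (L.countP (fun x : I => (x : ℝ) ≤ t) : ℝ) / L.length ≤ t + (η + 1 / M) := by
    intro t ht
    have hj : ⌈t * M⌉₊ ≤ M := Nat.ceil_le.2 (by nlinarith [ht.2])
    have h1 : t ≤ (⌈t * M⌉₊ : ℝ) / M := by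
      rw [le_div_iff₀ hM']; exact Nat.le_ceil _
    have h2 : (⌈t * M⌉₊ : ℝ) / M ≤ t + 1 / M := by
      rw [div_le_iff₀ hM', add_mul, one_div_mul_cancel hM'.ne']
      exact (Nat.ceil_lt_add_one (mul_nonneg ht.1 hM'.le)).le
    have h3 := (abs_le.1 (h _ hj)).2
    have h4 : (L.countP (fun x : I => (x : ℝ) ≤ t) : ℝ) / L.length ≤
        (L.countP (fun x : I => (x : ℝ) ≤ (⌈t * M⌉₊ : ℝ) / M) : ℝ) / L.length := by
      gcongr
      exact List.countP_mono_left fun x _ hx => by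
        simp only [decide_eq_true_eq] at hx ⊢; exact hx.trans h1
    linarith
  have hlow : ∀ t ∈ Set.Icc (0 : ℝ) 1,
      t - (η + 1 / M) ≤ (L.countP (fun x : I => (x : ℝ) < t) : ℝ) / L.length := by
    intro t ht
    rcases ht.1.eq_or_lt with rfl | ht0
    · have : 0 ≤ (L.countP (fun x : I => (x : ℝ) < 0) : ℝ) / L.length := by positivity
      have : 0 ≤ 1 / (M : ℝ) := by positivity
      linarith
    have hc : 0 < ⌈t * M⌉₊ := Nat.ceil_pos.2 (by positivity)
    have hj : ⌈t * M⌉₊ ≤ M := Nat.ceil_le.2 (by nlinarith [ht.2])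
    obtain ⟨j, hj'⟩ := Nat.exists_eq_add_of_le' hc
    have hjM : j ≤ M := by omega
    have h1 : (j : ℝ) / M < t := by
      rw [div_lt_iff₀ hM']
      have : j < ⌈t * M⌉₊ := by omega
      exact Nat.lt_ceil.1 this
    have h2 : t - 1 / M ≤ (j : ℝ) / M := by
      rw [le_div_iff₀ hM', sub_mul, one_div_mul_cancel hM'.ne']
      have := Nat.le_ceil (t * M)
      rw [hj'] at this
      push_cast at this
      linarith
    have h3 := (abs_le.1 (h _ hjM)).1
    have h4 : (L.countP (fun x : I => (x : ℝ) ≤ (j : ℝ) / M) : ℝ) / L.length ≤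
        (L.countP (fun x : I => (x : ℝ) < t) : ℝ) / L.length := by
      gcongr
      exact List.countP_mono_left fun x _ hx => by
        simp only [decide_eq_true_eq] at hx ⊢; exact hx.trans_lt h1
    linarith
  have hle : ∀ t : ℝ, (L.countP (fun x : I => (x : ℝ) < t) : ℝ) / L.length ≤
      (L.countP (fun x : I => (x : ℝ) ≤ t) : ℝ) / L.length := fun t => by
    gcongr
    exact List.countP_mono_left fun x _ hx => by
      simp only [decide_eq_true_eq] at hx ⊢; exact hx.le
  have hsplit := congrArg (fun k : ℕ => (k : ℝ) / L.length) (countP_Ioo_add_countP_le hab L)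
  simp only [Nat.cast_add, add_div] at hsplit
  have := hup a ha
  have := hup b hb
  have := hlow a ha
  have := hlow b hb
  have := hle a
  have := hle b
  rw [abs_le]
  constructor <;> linarith

theorem countP_ofFn {n : ℕ} (y : Fin n → I) (t : ℝ) :
    ((List.ofFn y).countP (fun x : I => (x : ℝ) ≤ t) : ℝ) =
      ∑ i, if (y i : ℝ) ≤ t then (1 : ℝ) else 0 := by
  induction n with
  | zero => simp
  | succ n ih =>
    rw [List.ofFn_succ, List.countP_cons, Fin.sum_univ_succ, Nat.cast_add, ih]
    simp [add_comm]

variable {μ : Measure (I × I)} [IsProbabilityMeasure μ]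

theorem measurable_sum_indicator (n : ℕ) (t : ℝ) :
    Measurable fun p : Fin n → I × I => ∑ i, if ((p i).2 : ℝ) ≤ t then (1 : ℝ) else 0 :=
  Finset.measurable_sum _ fun i _ => Measurable.ite
    (measurableSet_le (by fun_prop) measurable_const) measurable_const measurable_const

/-- Chebyshev's inequality for the empirical distribution function at one point. -/
theorem measureReal_empirical_le (hμ : μ.map Prod.snd = volume) {n : ℕ} (hn : 0 < n) {t η : ℝ}
    (ht : t ∈ Set.Icc (0 : ℝ) 1) (hη : 0 < η) :
    (Measure.pi fun _ : Fin n => μ).real {p | η ≤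
      |(∑ i, if ((p i).2 : ℝ) ≤ t then (1 : ℝ) else 0) / n - t|} ≤ 1 / (n * η ^ 2) := by
  have hn' : (0 : ℝ) < n := by exact_mod_cast hn
  set Q := Measure.pi fun _ : Fin n => μ with hQ
  let g : I × I → ℝ := fun q => if (q.2 : ℝ) ≤ t then 1 else 0
  have hg : Measurable g := Measurable.ite
    (measurableSet_le (by fun_prop) measurable_const) measurable_const measurable_const
  let X : Fin n → (Fin n → I × I) → ℝ := fun i p => g (p i)
  have hXm : ∀ i, Measurable (X i) := fun i => hg.comp (measurable_pi_apply i)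
  have hX1 : ∀ i p, |X i p| ≤ 1 := fun i p => by
    simp only [X, g]; split_ifs <;> simp
  have hL2 : ∀ i, MemLp (X i) 2 Q := fun i =>
    MemLp.of_bound (hXm i).aestronglyMeasurable 1 (Eventually.of_forall (hX1 i))
  have hint : ∀ i, ∫ p, X i p ∂Q = t := fun i => by
    have h1 : ∫ p, X i p ∂Q = ∫ q, g q ∂μ := by
      rw [← (measurePreserving_eval (fun _ : Fin n => μ) i).map_eq,
        integral_map (measurable_pi_apply i).aemeasurable hg.aestronglyMeasurable]
    have hg' : g = fun q : I × I => Set.indicator {y : I | (y : ℝ) ≤ t} 1 q.2 := by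
      ext q; simp [g, Set.indicator_apply]
    have hS : MeasurableSet {y : I | (y : ℝ) ≤ t} :=
      measurableSet_le measurable_subtype_coe measurable_const
    have h2 : ∫ q, g q ∂μ = ∫ y, Set.indicator {y : I | (y : ℝ) ≤ t} 1 y ∂(volume : Measure I) := by
      rw [hg', ← hμ, integral_map measurable_snd.aemeasurable]
      exact (measurable_one.indicator hS).aestronglyMeasurable
    have h3 : {y : I | (y : ℝ) ≤ t} = Set.Iic ⟨t, ht⟩ := rfl
    rw [h1, h2, integral_indicator_one hS, h3, Measure.real, unitInterval.volume_Iic,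
      ENNReal.toReal_ofReal ht.1]
  have hind : iIndepFun X Q := iIndepFun_pi (X := fun _ => g) fun _ => hg.aemeasurable
  have hvar : Var[∑ i, X i; Q] ≤ n := by
    rw [IndepFun.variance_sum (fun i _ => hL2 i) fun i _ j _ hij => hind.indepFun hij]
    calc _ ≤ ∑ _i : Fin n, (1 : ℝ) := by
          refine Finset.sum_le_sum fun i _ => ?_
          refine (variance_le_expectation_sq (hXm i).aestronglyMeasurable).trans ?_
          have : ∫ p, (X i ^ 2) p ∂Q ≤ ∫ _, (1 : ℝ) ∂Q := by
            refine integral_mono ((hL2 i).integrable_sq) (integrable_const _) fun p => ?_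
            have := hX1 i p
            rw [Pi.pow_apply, sq_le_one_iff_abs_le_one]
            exact this
          simpa using this
      _ = n := by simp
  have hmean : ∫ p, (∑ i, X i) p ∂Q = n * t := by
    simp only [Finset.sum_apply]
    rw [integral_finsetSum _ fun i _ => (hL2 i).integrable (by norm_num)]
    simp [hint]
  have hcheb := meas_ge_le_variance_div_sq (memLp_finsetSum' Finset.univ fun i _ => hL2 i)
    (c := n * η) (by positivity)
  rw [hmean] at hcheb
  have hset : {p : Fin n → I × I | η ≤
      |(∑ i, if ((p i).2 : ℝ) ≤ t then (1 : ℝ) else 0) / n - t|} =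
      {p | n * η ≤ |(∑ i, X i) p - n * t|} := by
    ext p
    have : (∑ i, if ((p i).2 : ℝ) ≤ t then (1 : ℝ) else 0) / n - t =
        ((∑ i, X i) p - n * t) / n := by
      simp only [Finset.sum_apply, X, g]
      field_simp
    simp only [Set.mem_ofPred_eq]
    rw [this, abs_div, abs_of_pos hn', le_div_iff₀ hn', mul_comm]
  rw [hset]
  refine (ENNReal.toReal_mono ENNReal.ofReal_ne_top hcheb).trans ?_
  rw [ENNReal.toReal_ofReal (div_nonneg (variance_nonneg _ _) (sq_nonneg _)),
    div_le_div_iff₀ (by positivity) (by positivity)]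
  have : 0 ≤ (n : ℝ) * η ^ 2 := by positivity
  nlinarith

/-- Outside an event of vanishing probability, all intervals contain a proportion of the sampled
second coordinates that is close to their length. -/
theorem exists_uniform_law (hμ : μ.map Prod.snd = volume) {δ : ℝ} (hδ : 0 < δ) :
    ∃ B : ∀ n, Set (Fin n → I × I), (∀ n, MeasurableSet (B n)) ∧
      Tendsto (fun n => (Measure.pi fun _ : Fin n => μ).real (B n)) atTop (𝓝 0) ∧
      ∀ n, ∀ p ∉ B n, ∀ a ∈ Set.Icc (0 : ℝ) 1, ∀ b ∈ Set.Icc (0 : ℝ) 1, a < b →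
        |((sortedY p).countP (fun x : I => a < x ∧ (x : ℝ) < b) : ℝ) / (sortedY p).length -
          (b - a)| ≤ δ := by
  obtain ⟨M, hM⟩ := exists_nat_gt (4 / δ)
  have hM0 : (0 : ℝ) < M := lt_trans (by positivity) hM
  have hMpos : 0 < M := by exact_mod_cast hM0
  have hMδ : 1 / (M : ℝ) ≤ δ / 4 := by
    rw [div_le_iff₀ hM0]
    rw [div_lt_iff₀ hδ] at hM
    linarith
  let B : ∀ n, Set (Fin n → I × I) := fun n => ⋃ j ∈ Finset.range (M + 1), {p | δ / 4 ≤
    |(∑ i, if ((p i).2 : ℝ) ≤ (j : ℝ) / M then (1 : ℝ) else 0) / n - (j : ℝ) / M|}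
  refine ⟨B, fun n => ?_, ?_, fun n p hp a ha b hb hab => ?_⟩
  · refine Finset.measurableSet_biUnion _ fun j _ => measurableSet_le measurable_const ?_
    exact (((measurable_sum_indicator n _).div_const _).sub_const _).abs
  · have hbound : ∀ᶠ n : ℕ in atTop, (Measure.pi fun _ : Fin n => μ).real (B n) ≤
        ∑ _j ∈ Finset.range (M + 1), 1 / ((n : ℝ) * (δ / 4) ^ 2) := by
      filter_upwards [eventually_gt_atTop 0] with n hn
      refine (measureReal_biUnion_finset_le _ _).trans (Finset.sum_le_sum fun j hj => ?_)
      refine measureReal_empirical_le hμ hn ⟨by positivity, ?_⟩ (by positivity)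
      rw [div_le_one hM0]
      exact_mod_cast Nat.lt_succ_iff.1 (Finset.mem_range.1 hj)
    refine squeeze_zero' (Eventually.of_forall fun n => measureReal_nonneg) hbound ?_
    rw [← Finset.sum_const_zero (s := Finset.range (M + 1))]
    refine tendsto_finsetSum _ fun j _ => ?_
    exact tendsto_const_nhds.div_atTop
      (tendsto_natCast_atTop_atTop.atTop_mul_const (by positivity))
  · refine (abs_countP_sub_le hMpos (η := δ / 4) (by positivity) (fun j hj => ?_) ha hb hab).trans
      (by linarith)
    simp only [B, Set.mem_iUnion, not_exists, Set.mem_ofPred_eq, not_le] at hp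
    rw [(sortedY_perm p).countP_eq, countP_ofFn, length_sortedY]
    exact (hp j (Finset.mem_range.2 (by omega))).le

end Empirical

/-! ### Sequences of i.i.d. points with an atomless law are scattered -/

section Scattered

theorem measure_exists_Ioo_null_right (m : Measure I) (hm : ∀ y, m {y} = 0) :
    m {a | ∃ b, a < b ∧ m (Set.Ioo a b) = 0} = 0 := by
  obtain ⟨D, hDc, hD⟩ := TopologicalSpace.exists_countable_dense I
  have hsub : {a | ∃ b, a < b ∧ m (Set.Ioo a b) = 0} ⊆
      ⋃ q ∈ D, {a | a < q ∧ m (Set.Ioo a q) = 0} := by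
    rintro a ⟨b, hab, h⟩
    obtain ⟨q, hq, h1, h2⟩ := hD.exists_between hab
    exact Set.mem_biUnion hq ⟨h1, measure_mono_null (Set.Ioo_subset_Ioo_right h2.le) h⟩
  refine measure_mono_null hsub ((measure_biUnion_null_iff hDc).2 fun q _ => ?_)
  set S := {a | a < q ∧ m (Set.Ioo a q) = 0} with hS
  rcases S.eq_empty_or_nonempty with h | hne
  · simp [h]
  -- approach the infimum of `S` by elements of `S`
  obtain ⟨u, -, hu, huS⟩ := exists_seq_tendsto_sInf hne (OrderBot.bddBelow S)
  have hsub : S ⊆ {sInf S} ∪ ⋃ k, Set.Ico (u k) q := by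
    intro a ha
    rcases (sInf_le ha).eq_or_lt with h | h
    · exact Or.inl h.symm
    · obtain ⟨k, hk⟩ := (hu.eventually_lt_const h).exists
      exact Or.inr (Set.mem_iUnion.2 ⟨k, hk.le, ha.1⟩)
  refine measure_mono_null hsub (measure_union_null (hm _) (measure_iUnion_null fun k => ?_))
  rw [← Set.Ioo_union_left (huS k).1]
  exact measure_union_null (huS k).2 (hm _)

theorem measure_exists_Ioo_null_left (m : Measure I) (hm : ∀ y, m {y} = 0) :
    m {b | ∃ a, a < b ∧ m (Set.Ioo a b) = 0} = 0 := by
  have hmap : ∀ s : Set I, m.map unitInterval.symm s = m (unitInterval.symm ⁻¹' s) := fun s =>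
    unitInterval.symmMeasurableEquiv.map_apply s
  have h := measure_exists_Ioo_null_right (m.map unitInterval.symm) fun y => by
    rw [hmap]
    have : unitInterval.symm ⁻¹' {y} = {unitInterval.symm y} := by
      ext z
      simp only [Set.mem_preimage, Set.mem_singleton_iff]
      exact ⟨fun h => by rw [← h, unitInterval.symm_symm],
        fun h => by rw [h, unitInterval.symm_symm]⟩
    rw [this]; exact hm _
  rw [hmap] at h
  refine measure_mono_null ?_ h
  rintro b ⟨a, hab, h0⟩
  refine ⟨unitInterval.symm a, unitInterval.symm_lt_symm.2 hab, ?_⟩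
  rw [hmap]
  refine measure_mono_null (fun z hz => ?_) h0
  exact ⟨unitInterval.symm_lt_symm.1 hz.2, unitInterval.symm_lt_symm.1 hz.1⟩

variable {Ω : Type*} [MeasurableSpace Ω] {P : Measure Ω}
  {m : Measure I} [IsProbabilityMeasure m] {Y : ℕ → Ω → I}

theorem ae_exists_mem_of_pos (hind : iIndepFun Y P) (hlaw : ∀ k, HasLaw (Y k) m P) {A : Set I}
    (hA : MeasurableSet A) (hpos : m A ≠ 0) : ∀ᵐ ω ∂P, ∃ k, Y k ω ∈ A := by
  have hlt : m Aᶜ < 1 := by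
    rw [prob_compl_eq_one_sub hA]
    exact ENNReal.sub_lt_self ENNReal.one_ne_top one_ne_zero hpos
  have hle : ∀ M : ℕ, P {ω | ¬ ∃ k, Y k ω ∈ A} ≤ (m Aᶜ) ^ M := fun M => by
    have h1 := hind.measure_inter_preimage_eq_mul (Finset.range M) (sets := fun _ => Aᶜ)
      fun _ _ => hA.compl
    have h2 : ∀ k, P (Y k ⁻¹' Aᶜ) = m Aᶜ := fun k => by
      rw [← (hlaw k).map_eq, Measure.map_apply_of_aemeasurable (hlaw k).aemeasurable hA.compl]
    simp only [h2, Finset.prod_const, Finset.card_range] at h1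
    rw [← h1]
    refine measure_mono fun ω hω => ?_
    simp only [Set.mem_iInter]
    exact fun k _ hk => hω ⟨k, hk⟩
  rw [ae_iff]
  exact le_antisymm (ge_of_tendsto' (ENNReal.tendsto_pow_atTop_nhds_zero_of_lt_one hlt) hle)
    zero_le

/-- Almost surely, an i.i.d. sequence with an atomless law is scattered: its values avoid the
endpoints of the gaps of the support of the law. -/
theorem ae_isScattered [IsProbabilityMeasure P] (hm : ∀ y, m {y} = 0) (hind : iIndepFun Y P)
    (hlaw : ∀ k, HasLaw (Y k) m P) : ∀ᵐ ω ∂P, IsScattered fun k => Y k ω := by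
  have hnot : ∀ s : Set I, m s = 0 → ∀ᵐ ω ∂P, ∀ k, Y k ω ∉ s := fun s hs => by
    rw [ae_all_iff]
    intro k
    have : ∀ᵐ y ∂(P.map (Y k)), y ∉ s := by
      rw [(hlaw k).map_eq]
      exact measure_eq_zero_iff_ae_notMem.1 hs
    exact ae_of_ae_map (hlaw k).aemeasurable this
  obtain ⟨D, hDc, hD⟩ := TopologicalSpace.exists_countable_dense I
  have hhit : ∀ᵐ ω ∂P, ∀ q ∈ D, ∀ q' ∈ D, m (Set.Ioo q q') ≠ 0 → ∃ k, Y k ω ∈ Set.Ioo q q' := by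
    rw [ae_ball_iff hDc]
    intro q _
    rw [ae_ball_iff hDc]
    intro q' _
    by_cases h : m (Set.Ioo q q') = 0
    · simp [h]
    · filter_upwards [ae_exists_mem_of_pos hind hlaw measurableSet_Ioo h] with ω hω _ using hω
  have hdense : ∀ a b : I, m (Set.Ioo a b) ≠ 0 →
      ∃ q ∈ D, ∃ q' ∈ D, a < q ∧ q' < b ∧ m (Set.Ioo q q') ≠ 0 := by
    intro a b h
    by_contra! hcon
    refine h (measure_mono_null (t := ⋃ q ∈ D, ⋃ q' ∈ D, {y | y ∈ Set.Ioo q q' ∧ a < q ∧ q' < b})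
      (fun y hy => ?_) ?_)
    · obtain ⟨q, hq, h1, h2⟩ := hD.exists_between hy.1
      obtain ⟨q', hq', h3, h4⟩ := hD.exists_between hy.2
      simp only [Set.mem_iUnion]
      exact ⟨q, hq, q', hq', ⟨h2, h3⟩, h1, h4⟩
    · refine (measure_biUnion_null_iff hDc).2 fun q hq => (measure_biUnion_null_iff hDc).2
        fun q' hq' => ?_
      by_cases hh : a < q ∧ q' < b
      · exact measure_mono_null (fun y hy => hy.1) (hcon q hq q' hq' hh.1 hh.2)
      · simp [hh]
  have hroot : m (Set.Ioo 0 1) ≠ 0 := by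
    intro h
    have : (Set.univ : Set I) ⊆ Set.Ioo 0 1 ∪ ({0} ∪ {1}) := by
      intro y _
      rcases eq_or_ne y 0 with rfl | h0
      · simp
      rcases eq_or_ne y 1 with rfl | h1
      · simp
      exact Or.inl ⟨unitInterval.pos_iff_ne_zero.2 h0, unitInterval.lt_one_iff_ne_one.2 h1⟩
    have h0 := measure_mono_null this
      (measure_union_null h (measure_union_null (hm 0) (hm 1)))
    simp at h0
  filter_upwards [ae_injective_of_iIndepFun (fun k => (hlaw k).aemeasurable) hind
      (fun k c => by rw [(hlaw k).map_eq]; exact hm c), hnot {0} (hm 0), hnot {1} (hm 1),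
    hnot _ (measure_exists_Ioo_null_right m hm), hnot _ (measure_exists_Ioo_null_left m hm), hhit]
    with ω h1 h2 h3 h4 h5 h6
  refine ⟨h1, fun k => ?_, fun k => ?_, fun a b ha hb hab => ?_⟩
  · exact unitInterval.pos_iff_ne_zero.2 (h2 k)
  · exact unitInterval.lt_one_iff_ne_one.2 (h3 k)
  · have hpos : m (Set.Ioo a b) ≠ 0 := by
      intro h
      rcases ha with rfl | ⟨j, rfl⟩
      · rcases hb with rfl | ⟨k, rfl⟩
        · exact hroot h
        · exact h5 k ⟨0, hab, h⟩
      · exact h4 j ⟨b, hab, h⟩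
    obtain ⟨q, hq, q', hq', haq, hqb, hne⟩ := hdense a b hpos
    obtain ⟨k, hk⟩ := h6 q hq q' hq' hne
    exact ⟨k, haq.trans hk.1, hk.2.trans hqb⟩

end Scattered

/-! ### A Tauberian theorem -/

section Tauberian

variable {μ : Measure (I × I)}

/-- The image of the measure `(n + 1) (1 - s) ^ n f dμ` by `s ↦ (1 - s) ^ (n + 1)`, integrated
against `φ`. -/
noncomputable def powAverage (μ : Measure (I × I)) (f : I → ℝ) (n : ℕ) (φ : ℝ → ℝ) : ℝ :=
  ∫ q, (n + 1) * (1 - (q.1 : ℝ)) ^ n * φ ((1 - (q.1 : ℝ)) ^ (n + 1)) * f q.2 ∂μ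

theorem integral_pow_comp (n : ℕ) (g : ℝ → ℝ) :
    ∫ s in (0 : ℝ)..1, (n + 1) * (1 - s) ^ n * g ((1 - s) ^ (n + 1)) = ∫ u in (0 : ℝ)..1, g u := by
  rw [intervalIntegral.integral_comp_sub_left
    (fun s : ℝ => ((n : ℝ) + 1) * s ^ n * g (s ^ (n + 1))) 1, sub_self, sub_zero,
    intervalIntegral.integral_of_le zero_le_one, intervalIntegral.integral_of_le zero_le_one,
    ← integral_Icc_eq_integral_Ioc, ← integral_Icc_eq_integral_Ioc]
  have himg : (fun s : ℝ => s ^ (n + 1)) '' Set.Icc 0 1 = Set.Icc 0 1 := by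
    ext u
    constructor
    · rintro ⟨s, hs, rfl⟩
      exact ⟨pow_nonneg hs.1 _, pow_le_one₀ hs.1 hs.2⟩
    · intro hu
      have h0 : ((n + 1 : ℕ) : ℝ) ≠ 0 := by positivity
      refine ⟨u ^ ((n + 1 : ℕ) : ℝ)⁻¹, ⟨Real.rpow_nonneg hu.1 _,
        Real.rpow_le_one hu.1 hu.2 (by positivity)⟩, ?_⟩
      simp only
      rw [← Real.rpow_natCast, ← Real.rpow_mul hu.1, inv_mul_cancel₀ h0, Real.rpow_one]
  conv_rhs => rw [← himg]
  rw [integral_image_eq_integral_abs_deriv_smul (f := fun s : ℝ => s ^ (n + 1))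
    (f' := fun s => ((n : ℝ) + 1) * s ^ n) measurableSet_Icc]
  · refine setIntegral_congr_fun measurableSet_Icc fun s hs => ?_
    have : 0 ≤ ((n : ℝ) + 1) * s ^ n := mul_nonneg (by positivity) (pow_nonneg hs.1 _)
    simp only [smul_eq_mul, abs_of_nonneg this]
  · intro s _
    have := (hasDerivAt_pow (n + 1) s).hasDerivWithinAt (s := Set.Icc 0 1)
    simpa using this
  · intro s hs t ht hst
    exact (pow_left_inj₀ hs.1 ht.1 (Nat.succ_ne_zero n)).1 hst

theorem one_sub_pow_mem (s : I) (n : ℕ) : (1 - (s : ℝ)) ^ n ∈ Set.Icc (0 : ℝ) 1 := by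
  have h0 : 0 ≤ 1 - (s : ℝ) := by linarith [s.2.2]
  exact ⟨pow_nonneg h0 _, pow_le_one₀ h0 (by linarith [s.2.1])⟩

variable [IsProbabilityMeasure μ] {f : I → ℝ} {C : ℝ}

theorem integrable_powAverage (hf : Measurable f) (hfb : ∀ y, |f y| ≤ C) (n : ℕ) {φ : ℝ → ℝ}
    (hφ : Measurable φ) {B : ℝ} (hB : ∀ u ∈ Set.Icc (0 : ℝ) 1, |φ u| ≤ B) :
    Integrable (fun q : I × I =>
      (n + 1) * (1 - (q.1 : ℝ)) ^ n * φ ((1 - (q.1 : ℝ)) ^ (n + 1)) * f q.2) μ := by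
  refine integrable_of_abs_le (C := (n + 1) * 1 * B * C) (by fun_prop) fun q => ?_
  rw [abs_mul, abs_mul, abs_mul, abs_of_nonneg (one_sub_pow_mem q.1 n).1,
    abs_of_nonneg (by positivity : (0 : ℝ) ≤ n + 1)]
  have hB0 : 0 ≤ B := (abs_nonneg _).trans (hB 0 ⟨le_rfl, zero_le_one⟩)
  gcongr
  · exact (one_sub_pow_mem q.1 n).2
  · exact hB _ (one_sub_pow_mem q.1 (n + 1))
  · exact hfb _

theorem abs_powAverage_sub_le (hμ : μ.map Prod.fst = volume) (hf : Measurable f)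
    (hfb : ∀ y, |f y| ≤ C) (n : ℕ) {φ φ' : ℝ → ℝ} (hφ : Measurable φ) (hφ' : Measurable φ')
    {B B' : ℝ} (hB : ∀ u ∈ Set.Icc (0 : ℝ) 1, |φ u| ≤ B)
    (hB' : ∀ u ∈ Set.Icc (0 : ℝ) 1, |φ' u| ≤ B') :
    |powAverage μ f n φ - powAverage μ f n φ'| ≤ C * ∫ u in (0 : ℝ)..1, |φ u - φ' u| := by
  have hC : 0 ≤ C := (abs_nonneg _).trans (hfb 0)
  rw [powAverage, powAverage, ← integral_sub (integrable_powAverage hf hfb n hφ hB)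
    (integrable_powAverage hf hfb n hφ' hB')]
  have hi := integrable_powAverage (μ := μ) (f := fun _ => C) measurable_const
    (fun _ => (abs_of_nonneg hC).le) n (φ := fun u => |φ u - φ' u|) (by fun_prop) (B := B + B')
    fun u hu => by
      rw [abs_abs]
      exact (abs_sub _ _).trans (add_le_add (hB u hu) (hB' u hu))
  calc _ ≤ ∫ q, (n + 1) * (1 - (q.1 : ℝ)) ^ n *
        |φ ((1 - (q.1 : ℝ)) ^ (n + 1)) - φ' ((1 - (q.1 : ℝ)) ^ (n + 1))| * C ∂μ := by
        rw [← Real.norm_eq_abs]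
        refine norm_integral_le_of_norm_le hi (Eventually.of_forall fun q => ?_)
        have h1 : ((n : ℝ) + 1) * (1 - (q.1 : ℝ)) ^ n * φ ((1 - (q.1 : ℝ)) ^ (n + 1)) * f q.2 -
            (n + 1) * (1 - (q.1 : ℝ)) ^ n * φ' ((1 - (q.1 : ℝ)) ^ (n + 1)) * f q.2 =
            (n + 1) * (1 - (q.1 : ℝ)) ^ n *
              (φ ((1 - (q.1 : ℝ)) ^ (n + 1)) - φ' ((1 - (q.1 : ℝ)) ^ (n + 1))) * f q.2 := by ring
        have h0 : 0 ≤ ((n : ℝ) + 1) * (1 - (q.1 : ℝ)) ^ n :=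
          mul_nonneg (by positivity) (one_sub_pow_mem q.1 n).1
        rw [h1, Real.norm_eq_abs, abs_mul, abs_mul, abs_of_nonneg h0]
        exact mul_le_mul_of_nonneg_left (hfb _) (by positivity)
    _ = (∫ q, (fun s : ℝ => (n + 1) * (1 - s) ^ n *
          (fun u => |φ u - φ' u|) ((1 - s) ^ (n + 1))) q.1 ∂μ) * C := by
        rw [← integral_mul_const]
    _ = _ := by
        rw [integral_fst hμ (h := fun s : ℝ => (n + 1) * (1 - s) ^ n *
            (fun u => |φ u - φ' u|) ((1 - s) ^ (n + 1))) (by fun_prop),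
          integral_pow_comp n (fun u => |φ u - φ' u|), mul_comm]

theorem tendsto_powAverage_polynomial (hf : Measurable f) (hfb : ∀ y, |f y| ≤ C) {L : ℝ}
    (hL : Tendsto (fun n => powAverage μ f n fun _ => 1) atTop (𝓝 L)) (p : Polynomial ℝ) :
    Tendsto (fun n => powAverage μ f n fun u => p.eval u) atTop
      (𝓝 (L * ∫ u in (0 : ℝ)..1, p.eval u)) := by
  have hbdd : ∀ p : Polynomial ℝ, ∃ B, ∀ u ∈ Set.Icc (0 : ℝ) 1, |p.eval u| ≤ B := fun p =>
    isCompact_Icc.exists_bound_of_continuousOn p.continuous.continuousOn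
  induction p using Polynomial.induction_on' with
  | add p r hp hr =>
    obtain ⟨B, hB⟩ := hbdd p
    obtain ⟨B', hB'⟩ := hbdd r
    have h1 : ∀ n, powAverage μ f n (fun u => (p + r).eval u) =
        powAverage μ f n (fun u => p.eval u) + powAverage μ f n (fun u => r.eval u) := fun n => by
      rw [powAverage, powAverage, powAverage, ← integral_add
        (integrable_powAverage hf hfb n p.continuous.measurable hB)
        (integrable_powAverage hf hfb n r.continuous.measurable hB')]
      refine integral_congr_ae (Eventually.of_forall fun q => ?_)
      simp only [Polynomial.eval_add]
      ring
    have h2 : ∫ u in (0 : ℝ)..1, (p + r).eval u =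
        (∫ u in (0 : ℝ)..1, p.eval u) + ∫ u in (0 : ℝ)..1, r.eval u := by
      simp only [Polynomial.eval_add]
      exact intervalIntegral.integral_add (p.continuous.intervalIntegrable _ _)
        (r.continuous.intervalIntegrable _ _)
    simp_rw [h1]
    rw [h2, mul_add]
    exact hp.add hr
  | monomial k a =>
    have h1 : ∀ n, powAverage μ f n (fun u => (Polynomial.monomial k a).eval u) =
        a / (k + 1) * powAverage μ f ((n + 1) * (k + 1) - 1) fun _ => 1 := fun n => by
      rw [powAverage, powAverage, ← integral_const_mul]
      refine integral_congr_ae (Eventually.of_forall fun q => ?_)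
      have h2 : (n + 1) * (k + 1) - 1 = n + (n + 1) * k := by
        have : (n + 1) * (k + 1) = n + (n + 1) * k + 1 := by ring
        omega
      have h3 : (k : ℝ) + 1 ≠ 0 := by positivity
      have h4 : (1 - (q.1 : ℝ)) ^ (n + (n + 1) * k) =
          (1 - (q.1 : ℝ)) ^ n * ((1 - (q.1 : ℝ)) ^ (n + 1)) ^ k := by rw [pow_add, pow_mul]
      simp only [Polynomial.eval_monomial]
      rw [h2, h4]
      push_cast
      field_simp
      ring
    have h2 : ∫ u in (0 : ℝ)..1, (Polynomial.monomial k a).eval u = a / (k + 1) := by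
      simp only [Polynomial.eval_monomial]
      rw [intervalIntegral.integral_const_mul, integral_pow]
      simp
      ring
    simp_rw [h1]
    rw [h2, mul_comm L]
    refine (hL.comp ?_).const_mul _
    refine tendsto_atTop_mono (fun n => ?_) tendsto_id
    have : (n + 1) * (k + 1) = n + (n + 1) * k + 1 := by ring
    have : (n + 1) * (k + 1) - 1 = n + (n + 1) * k := by omega
    rw [id, this]
    exact Nat.le_add_right _ _

theorem tendsto_powAverage (hμ : μ.map Prod.fst = volume) (hf : Measurable f)
    (hfb : ∀ y, |f y| ≤ C) {L : ℝ}
    (hL : Tendsto (fun n => powAverage μ f n fun _ => 1) atTop (𝓝 L)) {φ : ℝ → ℝ}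
    (hφ : Measurable φ) {B : ℝ} (hB : ∀ u ∈ Set.Icc (0 : ℝ) 1, |φ u| ≤ B) :
    Tendsto (fun n => powAverage μ f n φ) atTop (𝓝 (L * ∫ u in (0 : ℝ)..1, φ u)) := by
  have hC : 0 ≤ C := (abs_nonneg _).trans (hfb 0)
  have hφi : Integrable φ (volume.restrict (Set.Ioc (0 : ℝ) 1)) := by
    refine Integrable.of_bound hφ.aestronglyMeasurable B ?_
    filter_upwards [ae_restrict_mem measurableSet_Ioc] with u hu using hB u ⟨hu.1.le, hu.2⟩
  rw [Metric.tendsto_atTop']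
  intro ε hε
  -- approximate `φ` by a polynomial in the mean
  set θ := ε / (2 * (C + |L| + 1)) with hθ
  have hθ0 : 0 < θ := by positivity
  obtain ⟨g, hg, hgi⟩ := hφi.exists_boundedContinuous_integral_sub_le (half_pos hθ0)
  obtain ⟨p, hp⟩ := exists_polynomial_near_of_continuousOn 0 1 g g.continuous.continuousOn
    (θ / 2) (half_pos hθ0)
  have hpi : Integrable (fun u => p.eval u) (volume.restrict (Set.Ioc (0 : ℝ) 1)) :=
    (p.continuous.intervalIntegrable (μ := volume) 0 1).1
  have hgn : Integrable (fun u => ‖φ u - g u‖) (volume.restrict (Set.Ioc (0 : ℝ) 1)) :=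
    (hφi.sub hgi).norm
  have hdist : ∫ u in (0 : ℝ)..1, |φ u - p.eval u| ≤ θ := by
    rw [intervalIntegral.integral_of_le zero_le_one]
    calc _ ≤ ∫ u in Set.Ioc (0 : ℝ) 1, (‖φ u - g u‖ + θ / 2) := by
          refine setIntegral_mono_on (hφi.sub hpi).abs
            (hgn.add (integrable_const _)) measurableSet_Ioc fun u hu => ?_
          have h1 := hp u ⟨hu.1.le, hu.2⟩
          rw [abs_sub_comm] at h1
          calc |φ u - p.eval u| ≤ |φ u - g u| + |g u - p.eval u| := abs_sub_le _ _ _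
            _ ≤ _ := by rw [Real.norm_eq_abs]; linarith
      _ ≤ θ := by
          rw [integral_add hgn (integrable_const _)]
          simp only [integral_const, MeasurableSet.univ, measureReal_restrict_apply,
            Set.univ_inter, Real.volume_real_Ioc, smul_eq_mul]
          norm_num
          have : (∫ u in Set.Ioc (0 : ℝ) 1, |φ u - g u|) ≤ θ / 2 := hg
          linarith
  obtain ⟨B', hB'⟩ := isCompact_Icc.exists_bound_of_continuousOn
    (s := Set.Icc (0 : ℝ) 1) p.continuous.continuousOn
  obtain ⟨N, hN⟩ := Metric.tendsto_atTop'.1 (tendsto_powAverage_polynomial hf hfb hL p) (ε / 2)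
    (by positivity)
  refine ⟨N, fun n hn => ?_⟩
  have h1 := hN n hn
  have h2 := abs_powAverage_sub_le hμ hf hfb n hφ p.continuous.measurable hB hB'
  have h3 : |L * (∫ u in (0 : ℝ)..1, p.eval u) - L * ∫ u in (0 : ℝ)..1, φ u| ≤ |L| * θ := by
    rw [← mul_sub, abs_mul]
    refine mul_le_mul_of_nonneg_left ?_ (abs_nonneg _)
    rw [← intervalIntegral.integral_sub (p.continuous.intervalIntegrable _ _)
      ((intervalIntegrable_iff_integrableOn_Ioc_of_le zero_le_one).2 hφi)]
    refine (intervalIntegral.abs_integral_le_integral_abs zero_le_one).trans ?_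
    simp_rw [abs_sub_comm]
    exact hdist
  have h4 : C * ∫ u in (0 : ℝ)..1, |φ u - p.eval u| ≤ C * θ := mul_le_mul_of_nonneg_left hdist hC
  have h5 : (C + |L|) * θ < ε / 2 := by
    have : (C + |L| + 1) * θ = ε / 2 := by rw [hθ]; field_simp
    linarith
  rw [Real.dist_eq] at h1 ⊢
  calc |powAverage μ f n φ - L * ∫ u in (0 : ℝ)..1, φ u|
      ≤ |powAverage μ f n φ - powAverage μ f n fun u => p.eval u| +
        |powAverage μ f n (fun u => p.eval u) - L * ∫ u in (0 : ℝ)..1, φ u| := abs_sub_le _ _ _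
    _ ≤ |powAverage μ f n φ - powAverage μ f n fun u => p.eval u| +
        (|powAverage μ f n (fun u => p.eval u) - L * ∫ u in (0 : ℝ)..1, p.eval u| +
        |L * (∫ u in (0 : ℝ)..1, p.eval u) - L * ∫ u in (0 : ℝ)..1, φ u|) := by
        gcongr; exact abs_sub_le _ _ _
    _ < ε := by linarith

theorem abs_sliceIntegral_sub_le (hμ : μ.map Prod.fst = volume) (hf : Measurable f)
    (hfb : ∀ y, |f y| ≤ C) {s t : ℝ} (hs : s ∈ Set.Icc (0 : ℝ) 1) (ht : t ∈ Set.Icc (0 : ℝ) 1) :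
    |sliceIntegral μ f t - sliceIntegral μ f s| ≤ C * |t - s| := by
  wlog hst : s ≤ t generalizing s t
  · rw [abs_sub_comm, abs_sub_comm t]
    exact this ht hs (not_le.1 hst).le
  have hsub : {q : I × I | (q.1 : ℝ) ≤ s} ⊆ {q : I × I | (q.1 : ℝ) ≤ t} := fun q hq =>
    le_trans (show (q.1 : ℝ) ≤ s from hq) hst
  have hi : Integrable (fun q : I × I => f q.2) μ :=
    integrable_of_abs_le (hf.comp measurable_snd) fun q => hfb q.2
  have h1 := setIntegral_sdiff (μ := μ) (f := fun q : I × I => f q.2) (measurableSet_fst_le s)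
    hi.integrableOn hsub
  have h2 := norm_setIntegral_le_of_norm_le_const (μ := μ)
    (s := {q : I × I | (q.1 : ℝ) ≤ t} \ {q : I × I | (q.1 : ℝ) ≤ s}) (f := fun q => f q.2) (C := C)
    (measure_lt_top _ _) fun q _ => hfb _
  rw [h1, measureReal_sdiff hsub (measurableSet_fst_le s), measureReal_fst_le hμ ht,
    measureReal_fst_le hμ hs] at h2
  rwa [abs_of_nonneg (sub_nonneg.2 hst)]

/-- A Tauberian theorem of Karamata type: if the averages of `f` at the leftmost of `n` points
converge, then so do the averages of `f` over the slices `[0, x] × [0, 1]`. -/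
theorem hasSliceMean_of_tendsto_powAverage (hμ : μ.map Prod.fst = volume) (hf : Measurable f)
    (hfb : ∀ y, |f y| ≤ C) {L : ℝ}
    (hL : Tendsto (fun n => powAverage μ f n fun _ => 1) atTop (𝓝 L)) : HasSliceMean μ f L := by
  have hC : 0 ≤ C := (abs_nonneg _).trans (hfb 0)
  -- after the change of variables `u = (1 - s) ^ (n + 1)`, the condition `exp (-1) ≤ u` selects
  -- the slice of width `1 - exp (-1 / (n + 1))`, and the factor `1 / u` removes the density
  set c := Real.exp (-1) with hc
  have hc0 : 0 < c := Real.exp_pos _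
  let φ : ℝ → ℝ := fun u => (Set.Ici c).indicator (fun u => u⁻¹) u
  have hφm : Measurable φ := measurable_inv.indicator measurableSet_Ici
  have hφb : ∀ u ∈ Set.Icc (0 : ℝ) 1, |φ u| ≤ c⁻¹ := fun u _ => by
    by_cases h : u ∈ Set.Ici c
    · have hu : 0 < u := hc0.trans_le h
      simp only [φ, Set.indicator_of_mem h]
      rw [abs_of_nonneg (by positivity)]
      exact inv_anti₀ hc0 h
    · simp only [φ, Set.indicator_of_notMem h, abs_zero]
      positivity
  have hc1 : c ≤ 1 := Real.exp_le_one_iff.2 (by norm_num)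
  have hφ1 : ∫ u in (0 : ℝ)..1, φ u = 1 := by
    rw [intervalIntegral.integral_of_le zero_le_one, setIntegral_indicator measurableSet_Ici]
    have : Set.Ioc (0 : ℝ) 1 ∩ Set.Ici c = Set.Icc c 1 := by
      ext u
      simp only [Set.mem_inter_iff, Set.mem_Ioc, Set.mem_Ici, Set.mem_Icc]
      exact ⟨fun h => ⟨h.2, h.1.2⟩, fun h => ⟨⟨hc0.trans_le h.1, h.2⟩, h.1⟩⟩
    rw [this, integral_Icc_eq_integral_Ioc, ← intervalIntegral.integral_of_le hc1,
      integral_inv_of_pos hc0 one_pos, one_div, Real.log_inv, hc, Real.log_exp]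
    norm_num
  have hlim := tendsto_powAverage hμ hf hfb hL hφm hφb
  rw [hφ1, mul_one] at hlim
  let z : ℕ → ℝ := fun N => 1 - Real.exp (-(1 / (N : ℝ)))
  have hz1 : ∀ N, z N ≤ 1 / N := fun N => by
    have := Real.one_sub_le_exp_neg (1 / (N : ℝ))
    simp only [z]; linarith
  have hz2 : ∀ N : ℕ, 0 < N → 1 / ((N : ℝ) + 1) ≤ z N := fun N hN => by
    have hN' : (0 : ℝ) < N := by exact_mod_cast hN
    have h1 := Real.add_one_le_exp (1 / (N : ℝ))
    have h2 : Real.exp (-(1 / (N : ℝ))) ≤ (1 / (N : ℝ) + 1)⁻¹ := by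
      rw [Real.exp_neg]
      exact inv_anti₀ (by positivity) h1
    have h3 : 1 - (1 / (N : ℝ) + 1)⁻¹ = 1 / ((N : ℝ) + 1) := by field_simp; ring
    simp only [z]; linarith
  have hzI : ∀ N : ℕ, 0 < N → z N ∈ Set.Icc (0 : ℝ) 1 := fun N hN =>
    ⟨le_trans (by positivity) (hz2 N hN), by
      simp only [z]; linarith [Real.exp_pos (-(1 / (N : ℝ)))]⟩
  have hclose : ∀ n : ℕ, |powAverage μ f n φ - (n + 1) * sliceIntegral μ f (z (n + 1))| ≤
      C * c⁻¹ / (n + 1) := fun n => by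
    have hzn := hzI (n + 1) n.succ_pos
    have h1z : 1 - z (n + 1) = Real.exp (-(1 / ((n + 1 : ℕ) : ℝ))) := by simp only [z]; ring
    have hmem : ∀ q : I × I, (1 - (q.1 : ℝ)) ^ (n + 1) ∈ Set.Ici c ↔
        q ∈ {q : I × I | (q.1 : ℝ) ≤ z (n + 1)} := fun q => by
      have h0 : 0 ≤ 1 - (q.1 : ℝ) := by linarith [q.1.2.2]
      have hcp : c = (1 - z (n + 1)) ^ (n + 1) := by
        rw [h1z, ← Real.exp_nat_mul, hc]
        congr 1
        have : ((n + 1 : ℕ) : ℝ) ≠ 0 := by positivity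
        field_simp
      rw [Set.mem_Ici, hcp, pow_le_pow_iff_left₀ (by linarith [hzn.2]) h0 n.succ_ne_zero]
      exact ⟨fun h => show (q.1 : ℝ) ≤ z (n + 1) by linarith,
        fun h => by linarith [show (q.1 : ℝ) ≤ z (n + 1) from h]⟩
    have hlow : c ≤ 1 - z (n + 1) := by
      rw [h1z, hc]
      refine Real.exp_le_exp.2 (neg_le_neg ?_)
      rw [div_le_one (by positivity)]
      push_cast
      linarith [(Nat.cast_nonneg n : (0 : ℝ) ≤ n)]
    have hsl : ((n : ℝ) + 1) * sliceIntegral μ f (z (n + 1)) =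
        ∫ q, (n + 1) * {q : I × I | (q.1 : ℝ) ≤ z (n + 1)}.indicator (fun q => f q.2) q ∂μ := by
      rw [integral_const_mul, integral_indicator (measurableSet_fst_le _), sliceIntegral]
    have hind : Integrable (fun q : I × I => ((n : ℝ) + 1) *
        {q : I × I | (q.1 : ℝ) ≤ z (n + 1)}.indicator (fun q => f q.2) q) μ :=
      ((integrable_of_abs_le (hf.comp measurable_snd) fun q => hfb q.2).indicator
        (measurableSet_fst_le _)).const_mul _
    rw [hsl, powAverage, ← integral_sub (integrable_powAverage hf hfb n hφm hφb) hind]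
    calc _ ≤ ∫ q, {q : I × I | (q.1 : ℝ) ≤ z (n + 1)}.indicator (fun _ => c⁻¹ * C) q ∂μ := by
          rw [← Real.norm_eq_abs]
          refine norm_integral_le_of_norm_le
            ((integrable_const _).indicator (measurableSet_fst_le _))
            (Eventually.of_forall fun q => ?_)
          by_cases h : q ∈ {q : I × I | (q.1 : ℝ) ≤ z (n + 1)}
          · have hq : (q.1 : ℝ) ≤ z (n + 1) := h
            have hpos : 0 < 1 - (q.1 : ℝ) := by linarith
            simp only [φ]
            rw [Set.indicator_of_mem h, Set.indicator_of_mem h,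
              Set.indicator_of_mem ((hmem q).2 h)]
            have h1 : ((n : ℝ) + 1) * (1 - (q.1 : ℝ)) ^ n * ((1 - (q.1 : ℝ)) ^ (n + 1))⁻¹ * f q.2 -
                (n + 1) * f q.2 = ((n : ℝ) + 1) * q.1 * (1 - (q.1 : ℝ))⁻¹ * f q.2 := by
              field_simp
              ring
            have h2 : ((n : ℝ) + 1) * q.1 ≤ 1 := by
              have h3 := hz1 (n + 1)
              push_cast at h3
              calc _ ≤ ((n : ℝ) + 1) * (1 / (n + 1)) := by gcongr; linarith
                _ = 1 := by field_simp
            have h4 : (1 - (q.1 : ℝ))⁻¹ ≤ c⁻¹ := inv_anti₀ hc0 (by linarith)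
            have h5 : 0 ≤ ((n : ℝ) + 1) * q.1 := mul_nonneg (by positivity) q.1.2.1
            rw [h1, Real.norm_eq_abs, abs_mul, abs_of_nonneg (by positivity)]
            refine mul_le_mul ?_ (hfb _) (abs_nonneg _) (by positivity)
            calc _ ≤ 1 * c⁻¹ := by gcongr
              _ = c⁻¹ := one_mul _
          · simp only [φ]
            rw [Set.indicator_of_notMem h, Set.indicator_of_notMem h,
              Set.indicator_of_notMem (fun h' => h ((hmem q).1 h'))]
            simp
      _ = z (n + 1) * (c⁻¹ * C) := by
          rw [integral_indicator (measurableSet_fst_le _), setIntegral_const,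
            measureReal_fst_le hμ hzn, smul_eq_mul]
      _ ≤ 1 / (n + 1) * (c⁻¹ * C) := by
          have h3 := hz1 (n + 1)
          push_cast at h3
          gcongr
      _ = _ := by ring
  have hseq : Tendsto (fun N : ℕ => (N : ℝ) * sliceIntegral μ f (z N)) atTop (𝓝 L) := by
    rw [← tendsto_add_atTop_iff_nat 1]
    have h0 : Tendsto (fun n : ℕ => C * c⁻¹ / ((n : ℝ) + 1)) atTop (𝓝 0) :=
      tendsto_const_nhds.div_atTop
        (tendsto_atTop_add_const_right _ _ tendsto_natCast_atTop_atTop)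
    have h1 := squeeze_zero_norm (fun n => (Real.norm_eq_abs _).trans_le (hclose n)) h0
    have h2 := hlim.sub h1
    simp only [sub_sub_cancel, sub_zero] at h2
    simpa using h2
  -- interpolation between the abscissas `z N`
  have hfloor : Tendsto (fun x : ℝ => ⌊x⁻¹⌋₊) (𝓝[>] 0) atTop :=
    tendsto_nat_floor_atTop.comp tendsto_inv_nhdsGT_zero
  have herr : ∀ᶠ x in 𝓝[>] (0 : ℝ), ‖x⁻¹ * sliceIntegral μ f x -
      (⌊x⁻¹⌋₊ : ℝ) * sliceIntegral μ f (z ⌊x⁻¹⌋₊)‖ ≤ 2 * C / (⌊x⁻¹⌋₊ : ℝ) := by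
    filter_upwards [Ioc_mem_nhdsGT (zero_lt_one (α := ℝ))] with x hx
    have hx0 := hx.1
    have hN : 0 < ⌊x⁻¹⌋₊ := Nat.floor_pos.2 ((one_le_inv₀ hx0).2 hx.2)
    have h1 : (⌊x⁻¹⌋₊ : ℝ) ≤ x⁻¹ := Nat.floor_le (by positivity)
    have h2 : x⁻¹ < ⌊x⁻¹⌋₊ + 1 := Nat.lt_floor_add_one _
    set N := ⌊x⁻¹⌋₊
    have hN' : (0 : ℝ) < N := by exact_mod_cast hN
    have h3 : x ≤ 1 / N := by rw [one_div]; exact (le_inv_comm₀ hx0 hN').2 h1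
    have h4 : 1 / ((N : ℝ) + 1) ≤ x := by
      rw [one_div]; exact (inv_le_comm₀ (by positivity) hx0).2 h2.le
    have h5 := hz1 N
    have h6 := hz2 N hN
    have h7 : (1 : ℝ) / N - 1 / (N + 1) = 1 / (N * (N + 1)) := by field_simp; ring
    have h8 : |x - z N| ≤ 1 / (N * (N + 1)) := by
      rw [abs_le]; constructor <;> linarith
    have h9 : x⁻¹ * sliceIntegral μ f x - (N : ℝ) * sliceIntegral μ f (z N) =
        x⁻¹ * (sliceIntegral μ f x - sliceIntegral μ f (z N)) +
          (x⁻¹ - N) * sliceIntegral μ f (z N) := by ring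
    rw [h9, Real.norm_eq_abs]
    have h10 := abs_sliceIntegral_sub_le hμ hf hfb (hzI N hN) ⟨hx0.le, hx.2⟩
    have h11 := abs_sliceIntegral_le hμ hfb (hzI N hN)
    calc _ ≤ x⁻¹ * |sliceIntegral μ f x - sliceIntegral μ f (z N)| +
          (x⁻¹ - N) * |sliceIntegral μ f (z N)| := by
          refine (abs_add_le _ _).trans (le_of_eq ?_)
          rw [abs_mul, abs_mul, abs_of_pos (inv_pos.2 hx0), abs_of_nonneg (sub_nonneg.2 h1)]
      _ ≤ (N + 1) * (C * (1 / (N * (N + 1)))) + 1 * (C * (1 / N)) := by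
          gcongr
          · exact h10.trans (by gcongr)
          · linarith
          · exact h11.trans (by gcongr)
      _ = 2 * C / N := by field_simp; ring
  have herr0 : Tendsto (fun x : ℝ => 2 * C / (⌊x⁻¹⌋₊ : ℝ)) (𝓝[>] 0) (𝓝 0) :=
    tendsto_const_nhds.div_atTop (tendsto_natCast_atTop_atTop.comp hfloor)
  have hsum := (squeeze_zero_norm' herr herr0).add (hseq.comp hfloor)
  simp only [Function.comp_def, sub_add_cancel, zero_add] at hsum
  exact hsum

end Tauberian

/-! ### Slices of a permuton and cells of a grid -/

section Slices

theorem integral_leftSlice (μ : ProbabilityMeasure (I × I)) {f : I → ℝ} (hf : Measurable f) {x : ℝ}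
    (hx : 0 < x) : ∫ y, f y ∂(leftSlice μ x : Measure I) =
      x⁻¹ * sliceIntegral (μ : Measure (I × I)) f x := by
  rw [leftSlice, FiniteMeasure.toMeasure_smul, FiniteMeasure.toMeasure_map,
    FiniteMeasure.restrict_measure_eq, integral_smul_nnreal_measure,
    integral_map measurable_snd.aemeasurable hf.aestronglyMeasurable, sliceIntegral,
    NNReal.smul_def, NNReal.coe_inv, Real.coe_toNNReal x hx.le, smul_eq_mul]
  rfl

theorem hasLeftLimit_iff (μ : ProbabilityMeasure (I × I)) (μ₀ : ProbabilityMeasure I) :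
    HasLeftLimit μ μ₀ ↔ ∀ f : BoundedContinuousFunction I ℝ,
      HasSliceMean (μ : Measure (I × I)) f (∫ y, f y ∂(μ₀ : Measure I)) := by
  rw [HasLeftLimit, FiniteMeasure.tendsto_iff_forall_integral_tendsto]
  refine forall_congr' fun f => tendsto_congr' ?_
  filter_upwards [self_mem_nhdsWithin] with x hx
  exact integral_leftSlice μ f.continuous.measurable hx

theorem HasLeftLimit.hasSliceMean_indicator {μ : ProbabilityMeasure (I × I)}
    {μ₀ : ProbabilityMeasure I} (h : HasLeftLimit μ μ₀) {A : Set I} (hA : MeasurableSet A)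
    (hfr : (μ₀ : Measure I) (frontier A) = 0) :
    HasSliceMean (μ : Measure (I × I)) (A.indicator 1) ((μ₀ : Measure I).real A) := by
  have h1 := FiniteMeasure.tendsto_normalize_of_tendsto h μ₀.toFiniteMeasure_nonzero
  rw [ProbabilityMeasure.toFiniteMeasure_normalize_eq_self] at h1
  have h2 := ProbabilityMeasure.tendsto_measure_of_null_frontier_of_tendsto h1
    (E := A) (by simpa using hfr)
  have h4 := (FiniteMeasure.continuous_mass.tendsto μ₀.toFiniteMeasure).comp h
  have h5 := h4.mul h2
  rw [ProbabilityMeasure.mass_toFiniteMeasure, one_mul] at h5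
  have h6 := (NNReal.continuous_coe.tendsto _).comp h5
  refine h6.congr' ?_
  filter_upwards [self_mem_nhdsWithin] with x hx
  rw [← integral_leftSlice μ (measurable_one.indicator hA) hx, integral_indicator_one hA]
  simp only [Function.comp_apply]
  rw [← FiniteMeasure.self_eq_mass_mul_normalize]
  rfl

theorem measurable_cell (N : ℕ) : Measurable (cell N) := by
  unfold cell
  exact Nat.measurable_floor.comp (by fun_prop)

theorem measure_frontier_cell {m : Measure I} (hm : ∀ y, m {y} = 0) {N : ℕ} (hN : 0 < N) (c : ℕ) :
    m (frontier (cell N ⁻¹' {c})) = 0 := by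
  have hN' : (N : ℝ) ≠ 0 := by positivity
  have hA : cell N ⁻¹' {c} = {y : I | (c : ℝ) ≤ N * y} ∩ {y : I | (N : ℝ) * y < c + 1} := by
    ext y
    simp only [Set.mem_preimage, Set.mem_singleton_iff, Set.mem_inter_iff, Set.mem_ofPred_eq, cell]
    exact Nat.floor_eq_iff (mul_nonneg (Nat.cast_nonneg N) y.2.1)
  have hpt : ∀ a : ℝ, m {y : I | (N : ℝ) * y = a} = 0 := fun a => by
    have hs : {y : I | (N : ℝ) * y = a}.Subsingleton := fun y hy z hz => by
      have : (N : ℝ) * y = N * z := Eq.trans hy (Eq.symm hz)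
      exact Subtype.ext (mul_left_cancel₀ hN' this)
    rcases hs.eq_empty_or_singleton with h | ⟨y, h⟩
    · rw [h, measure_empty]
    · rw [h]; exact hm y
  refine measure_mono_null ?_ (measure_union_null (hpt c) (hpt (c + 1)))
  rw [hA]
  refine (frontier_inter_subset _ _).trans (Set.union_subset_union ?_ ?_)
  · refine Set.inter_subset_left.trans fun y hy => ?_
    exact (frontier_le_subset_eq (continuous_const (y := (c : ℝ)))
      (by fun_prop : Continuous fun y : I => (N : ℝ) * y) hy).symm
  · refine Set.inter_subset_right.trans fun y hy => ?_
    exact frontier_lt_subset_eq (by fun_prop : Continuous fun y : I => (N : ℝ) * y)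
      (continuous_const (y := (c : ℝ) + 1)) hy

end Slices

/-! ### The cells of the leftmost points -/

section Cells

/-- The cells of the first `k` terms of a list of points. -/
noncomputable def cells (k N : ℕ) (L : List I) (i : Fin k) : ℕ := cell N (L.getD i 0)

theorem prodAlong_ofFn {k : ℕ} (f : Fin k → I → ℝ) {L : List I} (hL : k ≤ L.length) :
    prodAlong (List.ofFn f) L = ∏ i : Fin k, f i (L.getD i 0) := by
  induction k generalizing L with
  | zero => simp [prodAlong]
  | succ k ih =>
    rcases L with _ | ⟨y, L⟩
    · simp at hL
    · rw [List.ofFn_succ, prodAlong, ih _ (by simpa using hL), Fin.prod_univ_succ]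
      simp

/-- A function of finitely many cells is a combination of products of indicators. -/
theorem eq_sum_prod_indicator {k N : ℕ} (Φ : (Fin k → ℕ) → ℝ) (y : Fin k → I) :
    Φ (fun i => cell N (y i)) = ∑ c ∈ Fintype.piFinset fun _ : Fin k => Finset.range (N + 1),
      Φ c * ∏ i, (cell N ⁻¹' {c i}).indicator (1 : I → ℝ) (y i) := by
  rw [Finset.sum_eq_single fun i => cell N (y i)]
  · simp
  · intro c _ hc
    obtain ⟨i, hi⟩ := Function.ne_iff.1 hc
    rw [Finset.prod_eq_zero (Finset.mem_univ i), mul_zero]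
    have hne : y i ∉ cell N ⁻¹' {c i} := fun h => hi (Eq.symm h)
    exact Set.indicator_of_notMem hne _
  · intro h
    exact absurd (Fintype.mem_piFinset.2 fun i => Finset.mem_range.2
      (Nat.lt_succ_of_le (cell_le N (y i)))) h

variable {μ : ProbabilityMeasure (I × I)} {μ₀ : ProbabilityMeasure I}

theorem integral_prodAlong_eq_leftmostExp {μ : Measure (I × I)} [IsProbabilityMeasure μ]
    (hμ : μ.map Prod.fst = volume) (fs : List (I → ℝ)) (n : ℕ) :
    ∫ p, prodAlong fs (sortedY p) ∂(Measure.pi fun _ : Fin n => μ) = leftmostExp μ fs n 0 := by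
  have h1 := measureReal_rightOf hμ n (x := 0) ⟨le_rfl, zero_le_one⟩
  rw [sub_zero, one_pow] at h1
  have h2 : ∀ᵐ p ∂(Measure.pi fun _ : Fin n => μ), p ∈ rightOf n 0 := by
    rw [Measure.real, ENNReal.toReal_eq_one_iff] at h1
    exact (mem_ae_iff_prob_eq_one (measurableSet_rightOf n 0)).2 h1
  refine integral_congr_ae ?_
  filter_upwards [h2] with p hp
  rw [Set.indicator_of_mem hp]

/-- The cells of the leftmost points are asymptotically i.i.d. -/
theorem tendsto_integral_cells (hμ : IsPermuton μ) (hlim : HasLeftLimit μ μ₀)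
    (hatom : ∀ y : I, (μ₀ : Measure I) {y} = 0) {k N : ℕ} (hN : 0 < N) (Φ : (Fin k → ℕ) → ℝ)
    {ν : Measure (ℕ → I)} [IsProbabilityMeasure ν]
    (hν : ∀ A : Fin k → Set I, (∀ i, MeasurableSet (A i)) →
      ν.real {y | ∀ i : Fin k, y i ∈ A i} = ∏ i, (μ₀ : Measure I).real (A i)) :
    Tendsto (fun n => ∫ p, Φ (cells k N (sortedY p))
        ∂(Measure.pi fun _ : Fin n => (μ : Measure (I × I)))) atTop
      (𝓝 (∫ y, Φ (fun i : Fin k => cell N (y i)) ∂ν)) := by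
  set S := Fintype.piFinset fun _ : Fin k => Finset.range (N + 1)
  have hA : ∀ c : ℕ, MeasurableSet (cell N ⁻¹' {c}) := fun c =>
    measurable_cell N (measurableSet_singleton c)
  have hf1 : ∀ (c : ℕ) (y : I), |(cell N ⁻¹' {c}).indicator (1 : I → ℝ) y| ≤ 1 := fun c y => by
    by_cases h : y ∈ cell N ⁻¹' {c} <;> simp only [Set.indicator_of_mem, Set.indicator_of_notMem, h,
      not_false_eq_true, Pi.one_apply, abs_one, abs_zero, le_refl, zero_le_one]
  let fs : (Fin k → ℕ) → List (I → ℝ) := fun c =>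
    List.ofFn fun i => (cell N ⁻¹' {c i}).indicator 1
  have hfs : ∀ c, ∀ f ∈ fs c, ∃ a, f = (cell N ⁻¹' {a}).indicator 1 := fun c f hf => by
    obtain ⟨i, rfl⟩ := List.mem_ofFn.1 hf
    exact ⟨c i, rfl⟩
  have hfsm : ∀ c, ∀ f ∈ fs c, Measurable f := fun c f hf => by
    obtain ⟨a, rfl⟩ := hfs c f hf
    exact measurable_one.indicator (hA a)
  have hfsb : ∀ c, ∀ f ∈ fs c, ∀ y, |f y| ≤ 1 := fun c f hf => by
    obtain ⟨a, rfl⟩ := hfs c f hf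
    exact hf1 a
  have hlimit : ∫ y, Φ (fun i : Fin k => cell N (y i)) ∂ν =
      ∑ c ∈ S, Φ c * ∏ i, (μ₀ : Measure I).real (cell N ⁻¹' {c i}) := by
    have hind : ∀ (c : Fin k → ℕ) (y : ℕ → I),
        ∏ i, (cell N ⁻¹' {c i}).indicator (1 : I → ℝ) (y i) =
          {y : ℕ → I | ∀ i : Fin k, y i ∈ cell N ⁻¹' {c i}}.indicator 1 y := fun c y => by
      by_cases h : ∀ i : Fin k, y i ∈ cell N ⁻¹' {c i}
      · rw [Set.indicator_of_mem (by exact h)]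
        exact Finset.prod_eq_one fun i _ => Set.indicator_of_mem (h i) _
      · rw [Set.indicator_of_notMem (by exact h)]
        push Not at h
        obtain ⟨i, hi⟩ := h
        exact Finset.prod_eq_zero (Finset.mem_univ i) (Set.indicator_of_notMem hi _)
    have hmeas : ∀ c : Fin k → ℕ,
        MeasurableSet {y : ℕ → I | ∀ i : Fin k, y i ∈ cell N ⁻¹' {c i}} := fun c => by
      have : {y : ℕ → I | ∀ i : Fin k, y i ∈ cell N ⁻¹' {c i}} =
          ⋂ i : Fin k, (fun y : ℕ → I => y i) ⁻¹' (cell N ⁻¹' {c i}) := by ext; simp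
      rw [this]
      exact MeasurableSet.iInter fun i => measurable_pi_apply _ (hA _)
    simp_rw [fun y : ℕ → I => eq_sum_prod_indicator (N := N) Φ fun i : Fin k => y i, hind]
    rw [integral_finsetSum]
    · refine Finset.sum_congr rfl fun c _ => ?_
      rw [integral_const_mul, integral_indicator_one (hmeas c), hν _ fun i => hA _]
    · exact fun c _ => ((integrable_const (1 : ℝ)).indicator (hmeas c)).const_mul _
  have hpre : ∀ᶠ n in atTop, ∑ c ∈ S, Φ c * leftmostExp (μ : Measure (I × I)) (fs c) n 0 =
      ∫ p, Φ (cells k N (sortedY p)) ∂(Measure.pi fun _ : Fin n => (μ : Measure (I × I))) := by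
    filter_upwards [eventually_ge_atTop k] with n hn
    have h1 : ∀ p : Fin n → I × I, Φ (cells k N (sortedY p)) =
        ∑ c ∈ S, Φ c * prodAlong (fs c) (sortedY p) := fun p => by
      have := eq_sum_prod_indicator (N := N) Φ fun i : Fin k => (sortedY p).getD i 0
      rw [show cells k N (sortedY p) = fun i : Fin k => cell N ((sortedY p).getD i 0) from rfl,
        this]
      refine Finset.sum_congr rfl fun c _ => ?_
      rw [prodAlong_ofFn _ (by rw [length_sortedY]; exact hn)]
    simp_rw [h1]
    rw [integral_finsetSum]
    · refine Finset.sum_congr rfl fun c _ => ?_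
      rw [integral_const_mul, integral_prodAlong_eq_leftmostExp hμ.map_fst]
    · exact fun c _ => (integrable_of_abs_le (measurable_prodAlong_sortedY (hfsm c))
        fun p => abs_prodAlong_le (hfsb c) _).const_mul _
  rw [hlimit]
  refine Tendsto.congr' hpre (tendsto_finsetSum _ fun c _ => Tendsto.const_mul _ ?_)
  have hmean : ∀ a : ℕ, ∫ y, (cell N ⁻¹' {a}).indicator (1 : I → ℝ) y ∂(μ₀ : Measure I) =
      (μ₀ : Measure I).real (cell N ⁻¹' {a}) := fun a => integral_indicator_one (hA a)
  have := tendsto_leftmostExp hμ.map_fst (m := fun f => ∫ y, f y ∂(μ₀ : Measure I))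
    (hfsm c) (hfsb c) fun f hf => by
      obtain ⟨a, rfl⟩ := hfs c f hf
      rw [hmean a]
      exact hlim.hasSliceMean_indicator (hA a) (measure_frontier_cell hatom hN a)
  convert this using 2
  simp only [fs, List.map_ofFn, List.prod_ofFn, Function.comp_apply, hmean]

end Cells

/-! ### Continuous functions of finitely many words -/

section UniformContinuity

/-- The coordinatewise projection onto the cube `[0, 1] ^ 𝕍`. -/
noncomputable def clampCube (w : List Bool → ℝ) (v : List Bool) : ℝ :=
  (Set.projIcc (0 : ℝ) 1 zero_le_one (w v) : ℝ)

/-- A continuous function on the cube depends, up to `ε`, only on finitely many coordinates. -/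
theorem exists_forall_abs_sub_lt {F : (List Bool → ℝ) → ℝ} (hF : Continuous F) {ε : ℝ}
    (hε : 0 < ε) : ∃ d : ℕ, ∃ δ > 0, ∀ w w' : List Bool → ℝ, (∀ v, w v ∈ Set.Icc (0 : ℝ) 1) →
      (∀ v : List Bool, v.length ≤ d → |w v - w' v| < δ) → |F w - F (clampCube w')| < ε := by
  have hK : IsCompact (Set.univ.pi fun _ : List Bool => Set.Icc (0 : ℝ) 1) :=
    isCompact_univ_pi fun _ => isCompact_Icc
  have hU := hK.uniformContinuousOn_of_continuous hF.continuousOn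
  rw [UniformContinuousOn, Filter.tendsto_def] at hU
  have h1 := hU _ (Metric.dist_mem_uniformity hε)
  rw [Filter.mem_inf_principal, Pi.uniformity, Filter.mem_iInf] at h1
  obtain ⟨J, hJ, V, hV, hVeq⟩ := h1
  have h2 : ∀ v : J, ∃ δ > 0, ∀ w w' : List Bool → ℝ, |w v - w' v| < δ → (w, w') ∈ V v := by
    intro v
    obtain ⟨t, ht, hts⟩ := Filter.mem_comap.1 (hV v)
    obtain ⟨δ, hδ, hδt⟩ := Metric.mem_uniformity_dist.1 ht
    exact ⟨δ, hδ, fun w w' h => hts (hδt (by rwa [Real.dist_eq]))⟩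
  choose δ hδ hδV using h2
  have := hJ.fintype
  obtain ⟨δ₀, hδ₀, hδ₀le⟩ : ∃ δ₀ > 0, ∀ v : J, δ₀ ≤ δ v := by
    rcases isEmpty_or_nonempty J with h | h
    · exact ⟨1, one_pos, fun v => h.elim v⟩
    · obtain ⟨v, hv⟩ := Finite.exists_min δ
      exact ⟨δ v, hδ v, hv⟩
  obtain ⟨d, hd⟩ := (hJ.image List.length).bddAbove
  refine ⟨d, δ₀, hδ₀, fun w w' hw h => ?_⟩
  have hmem : (w, clampCube w') ∈ ⋂ v, V v := by
    refine Set.mem_iInter.2 fun v => hδV v _ _ ?_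
    refine lt_of_le_of_lt ?_ ((h v (hd (Set.mem_image_of_mem _ v.2))).trans_le (hδ₀le v))
    have h3 : w v = (Set.projIcc (0 : ℝ) 1 zero_le_one (w v) : ℝ) := by
      rw [Set.projIcc_of_mem _ (hw v)]
    rw [clampCube]
    conv_lhs => rw [h3]
    exact Set.abs_projIcc_sub_projIcc _
  rw [← hVeq] at hmem
  have h4 : dist (F w) (F (clampCube w')) < ε :=
    hmem ⟨fun v _ => hw v, fun v _ => (Set.projIcc (0 : ℝ) 1 zero_le_one (w' v)).2⟩
  rwa [Real.dist_eq] at h4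

end UniformContinuity

/-! ### Approximation of the trees by finitely many cells -/

section Approximation

theorem take_eq_ofFn {L : List I} {k : ℕ} (hk : k ≤ L.length) :
    L.take k = List.ofFn fun i : Fin k => L.getD i 0 := by
  refine List.ext_getElem (by simp [hk]) fun i h1 h2 => ?_
  have hi : i < L.length := by
    rw [List.length_take] at h1
    omega
  simp [hi]

theorem IsFull.of_nodes_eq {α β : Type*} {T : BinaryTree α} {T' : BinaryTree β} {d : ℕ}
    (h : nodes T = nodes T') (hT : IsFull T d) : IsFull T' d := fun u hu => h ▸ hT u hu

theorem subtreeProportion_mem_Icc {α : Type*} (T : BinaryTree α) (v : List Bool) :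
    subtreeProportion T v ∈ Set.Icc (0 : ℝ) 1 := by
  refine ⟨by unfold subtreeProportion; positivity, div_le_one_of_le₀ ?_ (Nat.cast_nonneg _)⟩
  exact_mod_cast Finset.card_filter_le _ _

/-- The gap function of the tree of a tuple of cells. -/
noncomputable def gridGap {k : ℕ} (N : ℕ) (c : Fin k → ℕ) (v : List Bool) : ℝ :=
  gap (gridLabel N (bst (List.ofFn c))) v

/-- The tuples of distinct cells whose binary search tree is full up to depth `d`. -/
def goodCells (k d : ℕ) : Set (Fin k → ℕ) :=
  {c | Function.Injective c ∧ IsFull (bst (List.ofFn c)) d}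

theorem abs_gap_sub_gridGap_le {k N : ℕ} (hN : 0 < N) {y : Fin k → I}
    (hinj : Function.Injective fun i => cell N (y i)) (v : List Bool) :
    |gap (labelFun (bst (List.ofFn y))) v - gridGap N (fun i => cell N (y i)) v| ≤
      2 * (1 / N) :=
  abs_gap_sub_le (by positivity) v fun u _ => (cell_bst hN hinj).2 u

theorem abs_subtreeProportion_sub_gridGap_le {L : List I} (hL : L.Nodup)
    (hpos : ∀ x ∈ L, (0 : ℝ) < x ∧ (x : ℝ) < 1) {k d N : ℕ} (hN : 0 < N) (hk : k ≤ L.length)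
    (hgood : cells k N L ∈ goodCells k d)
    {δ : ℝ} (hδ : ∀ a ∈ Set.Icc (0 : ℝ) 1, ∀ b ∈ Set.Icc (0 : ℝ) 1, a < b →
      |(L.countP (fun x : I => a < x ∧ x < b) : ℝ) / L.length - (b - a)| ≤ δ)
    {v : List Bool} (hv : v.length ≤ d) :
    |subtreeProportion (bst L) v - gridGap N (cells k N L) v| ≤ δ + 2 * (1 / N) := by
  have hfull : IsFull (bst (L.take k)) d := by
    rw [take_eq_ofFn hk]
    exact hgood.2.of_nodes_eq (cell_bst hN hgood.1).1
  have h1 := abs_subtreeProportion_sub_gap_le hL hpos hfull hδ hv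
  rw [take_eq_ofFn hk] at h1
  exact (abs_sub_le _ _ _).trans (add_le_add h1 (abs_gap_sub_gridGap_le hN hgood.1 v))

theorem abs_psi_sub_gridGap_le {Y : ℕ → I} {k d N : ℕ} (hN : 0 < N)
    (hgood : (fun i : Fin k => cell N (Y i)) ∈ goodCells k d) {v : List Bool}
    (hv : v.length ≤ d) :
    |psi Y v - gridGap N (fun i : Fin k => cell N (Y i)) v| ≤ 2 * (1 / N) := by
  have hfull : IsFull (bstPrefix Y k) d := by
    rw [← bst_ofFn_eq_bstPrefix]
    exact hgood.2.of_nodes_eq (cell_bst hN hgood.1).1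
  rw [psi_eq_gap_of_isFull hfull hv, ← bst_ofFn_eq_bstPrefix]
  exact abs_gap_sub_gridGap_le hN hgood.1 v

theorem measurable_cells {n : ℕ} (k N : ℕ) :
    Measurable fun p : Fin n → I × I => cells k N (sortedY p) := by
  refine measurable_of_sort (G := fun τ p => cells k N (List.ofFn fun j => (p (τ j)).2))
    fun τ => measurable_pi_lambda _ fun i => (measurable_cell N).comp ?_
  by_cases hi : (i : ℕ) < n
  · have : (fun p : Fin n → I × I => (List.ofFn fun j => (p (τ j)).2).getD i 0) =
        fun p => (p (τ ⟨i, hi⟩)).2 := by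
      ext p
      simp [hi]
    rw [this]
    fun_prop
  · have : (fun p : Fin n → I × I => (List.ofFn fun j => (p (τ j)).2).getD i 0) = fun _ => 0 := by
      ext p
      simp [hi]
    rw [this]
    fun_prop

theorem ae_sortedY_nodup {μ : Measure (I × I)} [IsProbabilityMeasure μ]
    (hμ : μ.map Prod.snd = volume) (n : ℕ) :
    ∀ᵐ p ∂(Measure.pi fun _ : Fin n => μ), (sortedY p).Nodup ∧
      ∀ x ∈ sortedY p, (0 : ℝ) < x ∧ (x : ℝ) < 1 := by
  have hne : ∀ (c : I), ∀ᵐ p ∂(Measure.pi fun _ : Fin n => μ), ∀ i, (p i).2 ≠ c := fun c => by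
    rw [ae_all_iff]
    intro i
    have h1 : ∀ᵐ y ∂(μ.map Prod.snd), y ≠ c := by
      rw [hμ]
      exact measure_eq_zero_iff_ae_notMem.1 (measure_singleton (μ := (volume : Measure I)) c)
    have h2 : ∀ᵐ q ∂μ, q.2 ≠ c := ae_of_ae_map measurable_snd.aemeasurable h1
    exact (measurePreserving_eval (fun _ : Fin n => μ) i).quasiMeasurePreserving.ae h2
  filter_upwards [ae_injective_pi (n := n) measurable_snd hμ, hne 0, hne 1] with p h1 h2 h3
  refine ⟨(sortedY_perm p).nodup_iff.2 (List.nodup_ofFn.2 h1), fun x hx => ?_⟩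
  obtain ⟨i, rfl⟩ := List.mem_ofFn.1 ((sortedY_perm p).mem_iff.1 hx)
  exact ⟨unitInterval.pos_iff_ne_zero.2 (h2 i), unitInterval.lt_one_iff_ne_one.2 (h3 i)⟩

theorem tendsto_measureReal_zero {X : Type*} [MeasurableSpace X] {ν : Measure X}
    [IsProbabilityMeasure ν] {E : ℕ → Set X} (hE : ∀ n, MeasurableSet (E n))
    (h : ∀ᵐ x ∂ν, ∀ᶠ n in atTop, x ∉ E n) : Tendsto (fun n => ν.real (E n)) atTop (𝓝 0) := by
  have h1 := tendsto_integral_of_dominated_convergence (μ := ν)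
    (F := fun n => (E n).indicator (1 : X → ℝ)) (f := fun _ => 0) (fun _ => 1)
    (fun n => (measurable_one.indicator (hE n)).aestronglyMeasurable) (integrable_const _)
    (fun n => Eventually.of_forall fun x => by
      by_cases hx : x ∈ E n <;> simp [hx])
    (by
      filter_upwards [h] with x hx
      refine tendsto_const_nhds.congr' ?_
      filter_upwards [hx] with n hn
      rw [Set.indicator_of_notMem hn])
  simpa [integral_indicator_one, hE] using h1

theorem measurableSet_isFull (k d : ℕ) :
    MeasurableSet {y : ℕ → I | IsFull (bstPrefix y k) d} := by
  have h := measurable_of_comparisons (n := k)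
    (G := fun r _ => IsFull (bstBy r (List.finRange k)) d) fun r => measurable_const
  have h2 : {y : ℕ → I | IsFull (bstPrefix y k) d} = (fun (y : ℕ → I) (i : Fin k) => y i) ⁻¹'
      {y | IsFull (bstBy (fun i j => y i < y j) (List.finRange k)) d} := by
    ext y
    simp only [Set.mem_preimage, Set.mem_ofPred_eq]
    rw [← bst_ofFn_eq_bstPrefix, List.ofFn_eq_map, bst_map, IsFull, IsFull, nodes_map]
  rw [h2]
  exact (measurableSet_setOfPred.2 h).preimage (by fun_prop)

theorem eventually_injective_cell {y : ℕ → I} (hy : Function.Injective y) (k : ℕ) :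
    ∀ᶠ N in atTop, Function.Injective fun i : Fin k => cell N (y i) := by
  have h : ∀ i j : Fin k, i ≠ j → ∀ᶠ N in atTop, cell N (y i) ≠ cell N (y j) := by
    intro i j hij
    have hd : 0 < |(y i : ℝ) - y j| := abs_pos.2 (sub_ne_zero.2 fun h =>
      hij (Fin.ext (hy (Subtype.ext h))))
    obtain ⟨N₀, hN₀⟩ := exists_nat_gt (2 / |(y i : ℝ) - y j|)
    filter_upwards [eventually_ge_atTop N₀] with N hN heq
    have hN' : 2 / |(y i : ℝ) - y j| < N := hN₀.trans_le (by exact_mod_cast hN)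
    have hN0 : (0 : ℝ) < N := lt_trans (by positivity) hN'
    have h1 := abs_sub_cell_le (by exact_mod_cast hN0) (y i)
    have h2 := abs_sub_cell_le (by exact_mod_cast hN0) (y j)
    rw [heq] at h1
    rw [abs_sub_comm] at h2
    have h3 := (abs_sub_le (y i : ℝ) (cell N (y j) / N) (y j)).trans (add_le_add h1 h2)
    rw [div_lt_iff₀ hd] at hN'
    have h4 : (1 : ℝ) / N + 1 / N = 2 / N := by ring
    rw [h4, le_div_iff₀ hN0] at h3
    linarith
  have h2 := eventually_all.2 fun i : Fin k => eventually_all.2 fun j : Fin k =>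
    (show ∀ᶠ N in atTop, i ≠ j → cell N (y i) ≠ cell N (y j) by
      by_cases hij : i = j
      · simp [hij]
      · filter_upwards [h i j hij] with N hN _ using hN)
  filter_upwards [h2] with N hN i j hij
  by_contra hne
  exact hN i j hne hij

/-- With a fine grid, the first few terms of a scattered random sequence have good cells with
probability close to one. -/
theorem exists_goodCells {ν : Measure (ℕ → I)} [IsProbabilityMeasure ν]
    (hsc : ∀ᵐ y ∂ν, IsScattered y) (d N₀ : ℕ) {η : ℝ} (hη : 0 < η) :
    ∃ k N, N₀ ≤ N ∧
      ν.real {y | (fun i : Fin k => cell N (y i)) ∉ goodCells k d} ≤ η := by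
  have h1 := tendsto_measureReal_zero (ν := ν) (E := fun k => {y | IsFull (bstPrefix y k) d}ᶜ)
    (fun k => (measurableSet_isFull k d).compl) (by
      filter_upwards [hsc] with y hy
      filter_upwards [eventually_isFull_bstPrefix fun u _ => hy.isSome_infiniteBST u] with k hk
      simpa using hk)
  obtain ⟨k, hk⟩ := (h1.eventually_lt_const (half_pos hη)).exists
  have hcell : ∀ N,
      MeasurableSet {y : ℕ → I | Function.Injective fun i : Fin k => cell N (y i)} := by
    intro N
    have : Measurable fun (y : ℕ → I) (i : Fin k) => cell N (y i) :=
      measurable_pi_lambda _ fun i => (measurable_cell N).comp (measurable_pi_apply _)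
    exact this (MeasurableSet.of_discrete (s := {c : Fin k → ℕ | Function.Injective c}))
  have h2 := tendsto_measureReal_zero (ν := ν)
    (E := fun N => {y | Function.Injective fun i : Fin k => cell N (y i)}ᶜ)
    (fun N => (hcell N).compl) (by
      filter_upwards [hsc] with y hy
      filter_upwards [eventually_injective_cell hy.injective k] with N hN
      simpa using hN)
  obtain ⟨N, hN, hN₀, hN1⟩ := ((h2.eventually_lt_const (half_pos hη)).and
    ((eventually_ge_atTop N₀).and (eventually_gt_atTop 0))).exists
  refine ⟨k, N, hN₀, ?_⟩
  have hsub : {y : ℕ → I | (fun i : Fin k => cell N (y i)) ∉ goodCells k d} ⊆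
      {y | IsFull (bstPrefix y k) d}ᶜ ∪
        {y | Function.Injective fun i : Fin k => cell N (y i)}ᶜ := by
    intro y hy
    by_contra hcon
    simp only [Set.mem_union, Set.mem_compl_iff, Set.mem_ofPred_eq, not_or, not_not] at hcon
    refine hy ⟨hcon.2, ?_⟩
    rw [← bst_ofFn_eq_bstPrefix] at hcon
    exact hcon.1.of_nodes_eq (cell_bst hN1 hcon.2).1.symm
  calc _ ≤ _ := measureReal_mono hsub
    _ ≤ _ := measureReal_union_le _ _
    _ ≤ η := by linarith

theorem abs_integral_sub_integral_le {X : Type*} [MeasurableSpace X] {ν : Measure X}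
    [IsProbabilityMeasure ν] {g h χ : X → ℝ} (hg : Integrable g ν) (hh : Integrable h ν)
    (hχ : Integrable χ ν) {ε M : ℝ} (hle : ∀ᵐ x ∂ν, |g x - h x| ≤ ε + M * χ x) :
    |∫ x, g x ∂ν - ∫ x, h x ∂ν| ≤ ε + M * ∫ x, χ x ∂ν := by
  rw [← integral_sub hg hh]
  calc _ ≤ ∫ x, (ε + M * χ x) ∂ν := by
        rw [← Real.norm_eq_abs]
        exact norm_integral_le_of_norm_le ((integrable_const _).add (hχ.const_mul _)) hle
    _ = _ := by
        rw [integral_add (integrable_const _) (hχ.const_mul _), integral_const_mul]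
        simp

end Approximation

/-! ### Convergence to the limit tree -/

section Forward

variable {μ : ProbabilityMeasure (I × I)} {μ₀ : ProbabilityMeasure I}

/-- The subtree size functions of the trees of samples of `μ` converge in distribution to `psi` of
an i.i.d. sequence with law `μ₀`. Here `ν` is the law of that sequence. -/
theorem tendsto_integral_subtreeProportion (hμ : IsPermuton μ) (hlim : HasLeftLimit μ μ₀)
    (hatom : ∀ y : I, (μ₀ : Measure I) {y} = 0) {ν : Measure (ℕ → I)} [IsProbabilityMeasure ν]
    (hsc : ∀ᵐ y ∂ν, IsScattered y)
    (hν : ∀ (k : ℕ) (A : Fin k → Set I), (∀ i, MeasurableSet (A i)) →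
      ν.real {y | ∀ i : Fin k, y i ∈ A i} = ∏ i, (μ₀ : Measure I).real (A i))
    (F : BoundedContinuousFunction (List Bool → ℝ) ℝ) :
    Tendsto (fun n => ∫ p, F (subtreeProportion (pointsBST p))
        ∂(Measure.pi fun _ : Fin n => (μ : Measure (I × I)))) atTop
      (𝓝 (∫ y, F (psi y) ∂ν)) := by
  rw [Metric.tendsto_atTop']
  intro ε₀ hε₀
  set M := ‖F‖ with hM
  have hM0 : 0 ≤ M := norm_nonneg F
  have hFb : ∀ w, |F w| ≤ M := fun w => F.norm_coe_le_norm w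
  -- the three comparisons below cost at most `ε + 6ε`, `ε` and `ε + 2ε`
  set ε := ε₀ / 12 with hε
  have hε0 : 0 < ε := by positivity
  set η := ε / (M + 1) with hη
  have hη0 : 0 < η := by positivity
  have hMη : M * η ≤ ε := by
    rw [hη, mul_div_assoc', div_le_iff₀ (by positivity)]
    nlinarith
  obtain ⟨d, δ, hδ0, hδ⟩ := exists_forall_abs_sub_lt F.continuous hε0
  obtain ⟨B, hBm, hB0, hB⟩ := exists_uniform_law (μ := (μ : Measure (I × I))) hμ.map_snd
    (half_pos hδ0)
  obtain ⟨N₀, hN₀⟩ := exists_nat_gt (4 / δ)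
  obtain ⟨k, N, hN, hgood⟩ := exists_goodCells hsc d N₀ hη0
  have hN' : 4 / δ < N := hN₀.trans_le (by exact_mod_cast hN)
  have hNr : (0 : ℝ) < N := lt_trans (by positivity) hN'
  have hN0 : 0 < N := by exact_mod_cast hNr
  have hNδ : 2 * (1 / (N : ℝ)) < δ / 2 := by
    rw [div_lt_iff₀ hδ0] at hN'
    rw [mul_one_div, div_lt_iff₀ hNr]
    linarith
  let Φ : (Fin k → ℕ) → ℝ := fun c => F (clampCube (gridGap N c))
  let χ : (Fin k → ℕ) → ℝ := (goodCells k d)ᶜ.indicator 1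
  have hχb : ∀ c, |χ c| ≤ 1 := fun c => by
    by_cases h : c ∈ (goodCells k d)ᶜ
    · simp only [χ, Set.indicator_of_mem h, Pi.one_apply, abs_one, le_refl]
    · simp only [χ, Set.indicator_of_notMem h, abs_zero, zero_le_one]
  have hlimΦ := tendsto_integral_cells hμ hlim hatom hN0 Φ (hν k)
  have hlimχ := tendsto_integral_cells hμ hlim hatom hN0 χ (hν k)
  have hcellm : Measurable fun (y : ℕ → I) (i : Fin k) => cell N (y i) :=
    measurable_pi_lambda _ fun i => (measurable_cell N).comp (measurable_pi_apply _)
  have hΦm : Measurable Φ := Measurable.of_discrete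
  have hχm : Measurable χ := Measurable.of_discrete
  -- the approximation of the limit
  have hright : |∫ y, F (psi y) ∂ν - ∫ y, Φ (fun i : Fin k => cell N (y i)) ∂ν| ≤
      ε + 2 * M * ∫ y, χ (fun i : Fin k => cell N (y i)) ∂ν := by
    refine abs_integral_sub_integral_le
      (integrable_of_abs_le (F.continuous.measurable.comp measurable_psi) fun y => hFb _)
      (integrable_of_abs_le (hΦm.comp hcellm) fun y => hFb _)
      (integrable_of_abs_le (hχm.comp hcellm) fun y => hχb _) ?_
    filter_upwards [hsc] with y hy
    change |F (psi y) - F (clampCube (gridGap N fun i : Fin k => cell N (y i)))| ≤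
      ε + 2 * M * (goodCells k d)ᶜ.indicator 1 (fun i : Fin k => cell N (y i))
    by_cases h : (fun i : Fin k => cell N (y i)) ∈ goodCells k d
    · rw [Set.indicator_of_notMem (by simpa using h), mul_zero, add_zero]
      exact (hδ _ _ (fun v => hy.psi_mem_Psi.1 v) fun v hv => by
        have := abs_psi_sub_gridGap_le hN0 h hv
        linarith).le
    · rw [Set.indicator_of_mem (by simpa using h), Pi.one_apply]
      have h1 := hFb (psi y)
      have h2 := hFb (clampCube (gridGap N fun i : Fin k => cell N (y i)))
      have h3 := abs_sub (F (psi y)) (F (clampCube (gridGap N fun i : Fin k => cell N (y i))))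
      linarith
  have hχright : ∫ y, χ (fun i : Fin k => cell N (y i)) ∂ν ≤ η := by
    have h1 : ∀ y : ℕ → I, χ (fun i : Fin k => cell N (y i)) =
        {y : ℕ → I | (fun i : Fin k => cell N (y i)) ∉ goodCells k d}.indicator 1 y :=
      fun y => rfl
    simp_rw [h1]
    rw [integral_indicator_one]
    · exact hgood
    · exact hcellm (MeasurableSet.of_discrete (s := (goodCells k d)ᶜ))
  -- the approximation of the finite trees
  have hleft : ∀ n, k ≤ n → |∫ p, F (subtreeProportion (pointsBST p))
        ∂(Measure.pi fun _ : Fin n => (μ : Measure (I × I))) -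
      ∫ p, Φ (cells k N (sortedY p)) ∂(Measure.pi fun _ : Fin n => (μ : Measure (I × I)))| ≤
      ε + 2 * M * (∫ p, χ (cells k N (sortedY p))
          ∂(Measure.pi fun _ : Fin n => (μ : Measure (I × I))) +
        (Measure.pi fun _ : Fin n => (μ : Measure (I × I))).real (B n)) := by
    intro n hn
    have hχi : Integrable (fun p : Fin n → I × I => χ (cells k N (sortedY p)))
        (Measure.pi fun _ : Fin n => (μ : Measure (I × I))) :=
      integrable_of_abs_le (hχm.comp (measurable_cells k N)) fun p => hχb _
    have hBi : Integrable ((B n).indicator (1 : (Fin n → I × I) → ℝ))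
        (Measure.pi fun _ : Fin n => (μ : Measure (I × I))) :=
      (integrable_const (1 : ℝ)).indicator (hBm n)
    rw [← integral_indicator_one (hBm n), ← integral_add hχi hBi]
    refine abs_integral_sub_integral_le
      (integrable_of_abs_le (F.continuous.measurable.comp measurable_subtreeProportion_pointsBST)
        fun p => hFb _)
      (integrable_of_abs_le (hΦm.comp (measurable_cells k N)) fun p => hFb _)
      (hχi.add hBi) ?_
    filter_upwards [ae_sortedY_nodup hμ.map_snd n] with p hp
    have h1 := hFb (subtreeProportion (pointsBST p))
    have h2 := hFb (clampCube (gridGap N (cells k N (sortedY p))))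
    have h3 := abs_sub (F (subtreeProportion (pointsBST p)))
      (F (clampCube (gridGap N (cells k N (sortedY p)))))
    change |F (subtreeProportion (pointsBST p)) - F (clampCube (gridGap N (cells k N (sortedY p))))|
      ≤ ε + 2 * M * ((goodCells k d)ᶜ.indicator 1 (cells k N (sortedY p)) + (B n).indicator 1 p)
    by_cases h : cells k N (sortedY p) ∈ goodCells k d
    · by_cases hpB : p ∈ B n
      · rw [Set.indicator_of_notMem (by simpa using h), Set.indicator_of_mem hpB, Pi.one_apply]
        linarith
      · rw [Set.indicator_of_notMem (by simpa using h), Set.indicator_of_notMem hpB, add_zero,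
          mul_zero, add_zero]
        refine (hδ _ _ (fun v => subtreeProportion_mem_Icc _ v) fun v hv => ?_).le
        have := abs_subtreeProportion_sub_gridGap_le hp.1 hp.2 hN0
          (by rw [length_sortedY]; exact hn) h (hB n p hpB) hv
        rw [pointsBST_eq_bst]
        linarith
    · have h4 : 0 ≤ (B n).indicator (1 : (Fin n → I × I) → ℝ) p :=
        Set.indicator_nonneg (fun _ _ => zero_le_one) p
      rw [Set.indicator_of_mem (by simpa using h), Pi.one_apply]
      nlinarith
  have e1 := (Metric.tendsto_nhds.1 hlimΦ) ε hε0
  have e2 := (Metric.tendsto_nhds.1 hlimχ) η hη0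
  have e3 := (Metric.tendsto_nhds.1 hB0) η hη0
  obtain ⟨n₀, hn₀⟩ := eventually_atTop.1 (e1.and (e2.and (e3.and (eventually_ge_atTop k))))
  refine ⟨n₀, fun n hn => ?_⟩
  obtain ⟨f1, f2, f3, f4⟩ := hn₀ n hn.le
  have f5 := hleft n f4
  rw [Real.dist_eq] at f1 f2 f3 ⊢
  have g2 := (abs_lt.1 f2).2
  have g3 := (abs_lt.1 f3).2
  have g4 : 2 * M * (∫ p, χ (cells k N (sortedY p))
          ∂(Measure.pi fun _ : Fin n => (μ : Measure (I × I))) +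
        (Measure.pi fun _ : Fin n => (μ : Measure (I × I))).real (B n)) ≤ 2 * M * (3 * η) := by
    gcongr
    linarith
  have g5 : 2 * M * ∫ y, χ (fun i : Fin k => cell N (y i)) ∂ν ≤ 2 * M * η := by
    gcongr
  have hA := abs_le.1 (f5.trans (add_le_add_right g4 ε))
  have hC := abs_le.1 (hright.trans (add_le_add_right g5 ε))
  have hD := abs_lt.1 f1
  have hE : 2 * M * (3 * η) + 2 * M * η ≤ 8 * ε := by nlinarith
  rw [abs_lt]
  constructor <;> linarith [hA.1, hA.2, hC.1, hC.2, hD.1, hD.2]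

end Forward

/-! ### The label of the root determines the slices -/

section Converse

variable {μ : ProbabilityMeasure (I × I)}

/-- The mean of `f` at the leftmost of `n + 1` points is a weighted integral of `f`. -/
theorem leftmostExp_singleton_eq_powAverage {μ : Measure (I × I)} [IsProbabilityMeasure μ]
    (hμ : μ.map Prod.fst = volume) {f : I → ℝ} (hf : Measurable f) (hfb : ∀ y, |f y| ≤ 1) (n : ℕ) :
    leftmostExp μ [f] (n + 1) 0 = powAverage μ f n fun _ => 1 := by
  have hae : ∀ᵐ q ∂μ, q ∈ {q : I × I | (0 : ℝ) < q.1} := by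
    refine (mem_ae_iff_prob_eq_one (measurableSet_lt measurable_const
      (measurable_subtype_coe.comp measurable_fst))).2 ?_
    change μ {q | (0 : ℝ) < q.1} = 1
    rw [measure_fst_gt hμ ⟨le_rfl, zero_le_one⟩]
    simp
  rw [leftmostExp_cons hμ hf hfb (by simp) (by simp), Measure.restrict_eq_self_of_ae_mem hae,
    powAverage, ← integral_const_mul]
  refine integral_congr_ae (Eventually.of_forall fun q => ?_)
  simp only [leftmostExp_nil hμ n q.1.2]
  ring

/-- The proportion of nodes in the left subtree is close to the label of the root. -/
theorem abs_subtreeProportion_left_sub_le {L : List I} (hL : L.Nodup)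
    (hpos : ∀ x ∈ L, (0 : ℝ) < x ∧ (x : ℝ) < 1) {δ : ℝ}
    (hδ : ∀ a ∈ Set.Icc (0 : ℝ) 1, ∀ b ∈ Set.Icc (0 : ℝ) 1, a < b →
      |(L.countP (fun x : I => a < x ∧ x < b) : ℝ) / L.length - (b - a)| ≤ δ)
    {y : I} {L' : List I} (hy : L = y :: L') :
    |subtreeProportion (bst L) [false] - y| ≤ δ := by
  have htake : bst (L.take 1) = .node y .nil .nil := by
    rw [hy]; simp [bst, bstInsert]
  have hfull : IsFull (bst (L.take 1)) 1 := fun u hu => by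
    rw [List.length_eq_zero_iff.1 (Nat.lt_one_iff.1 hu), htake]
    exact nil_mem_nodes_node
  have h := abs_subtreeProportion_sub_gap_le hL hpos hfull hδ (v := [false]) (by simp)
  have hgap : gap (labelFun (bst (L.take 1))) [false] = y := by
    have h1 := leftAncestor_concat (labelFun (bst (L.take 1))) [] false
    have h2 := rightAncestor_concat (labelFun (bst (L.take 1))) [] false
    simp only [List.nil_append, Bool.false_eq_true, if_false, leftAncestor_nil] at h1 h2
    rw [gap, h1, h2, htake]
    simp [labelFun, label]
  rwa [hgap] at h

/-- If the proportions of nodes in the left subtrees converge in distribution, then so do the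
averages over the slices. -/
theorem hasSliceMean_of_tendsto (hμ : IsPermuton μ) {Q : Measure (List Bool → ℝ)}
    (hQ : ∀ F : BoundedContinuousFunction (List Bool → ℝ) ℝ,
      Tendsto (fun n => ∫ p, F (subtreeProportion (pointsBST p))
        ∂(Measure.pi fun _ : Fin n => (μ : Measure (I × I)))) atTop (𝓝 (∫ w, F w ∂Q)))
    (f : BoundedContinuousFunction I ℝ) (hfb : ∀ y, |f y| ≤ 1) :
    HasSliceMean (μ : Measure (I × I)) f
      (∫ w, f (Set.projIcc (0 : ℝ) 1 zero_le_one (w [false])) ∂Q) := by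
  let F : BoundedContinuousFunction (List Bool → ℝ) ℝ := f.compContinuous
    ⟨fun w => Set.projIcc (0 : ℝ) 1 zero_le_one (w [false]),
      continuous_projIcc.comp (continuous_apply _)⟩
  have hfm : Measurable f := f.continuous.measurable
  have hlim := hQ F
  have hprod : ∀ g ∈ [(f : I → ℝ)], ∀ y, |g y| ≤ 1 := by simpa using hfb
  have hprodm : ∀ g ∈ [(f : I → ℝ)], Measurable g := by simpa using hfm
  have hroot : Tendsto (fun n => leftmostExp (μ : Measure (I × I)) [f] n 0) atTop
      (𝓝 (∫ w, F w ∂Q)) := by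
    rw [Metric.tendsto_atTop']
    intro ε₀ hε₀
    set ε := ε₀ / 4 with hε
    have hε0 : 0 < ε := by positivity
    obtain ⟨δ, hδ0, hδ⟩ := Metric.uniformContinuous_iff.1
      (CompactSpace.uniformContinuous_of_continuous f.continuous) ε hε0
    obtain ⟨B, hBm, hB0, hB⟩ := exists_uniform_law (μ := (μ : Measure (I × I))) hμ.map_snd
      (half_pos hδ0)
    have hclose : ∀ n : ℕ, 0 < n → |∫ p, F (subtreeProportion (pointsBST p))
          ∂(Measure.pi fun _ : Fin n => (μ : Measure (I × I))) -
        leftmostExp (μ : Measure (I × I)) [f] n 0| ≤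
        ε + 2 * (Measure.pi fun _ : Fin n => (μ : Measure (I × I))).real (B n) := by
      intro n hn
      rw [← integral_prodAlong_eq_leftmostExp hμ.map_fst, ← integral_indicator_one (hBm n)]
      refine abs_integral_sub_integral_le
        (integrable_of_abs_le (C := 1)
          (F.continuous.measurable.comp measurable_subtreeProportion_pointsBST) fun p => hfb _)
        (integrable_of_abs_le (measurable_prodAlong_sortedY hprodm)
          fun p => abs_prodAlong_le hprod _)
        ((integrable_const (1 : ℝ)).indicator (hBm n)) ?_
      filter_upwards [ae_sortedY_nodup hμ.map_snd n] with p hp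
      obtain ⟨y, L', hy⟩ : ∃ y L', sortedY p = y :: L' := by
        refine List.exists_cons_of_ne_nil fun h => ?_
        have := length_sortedY p
        rw [h] at this
        simp at this
        omega
      have hval : prodAlong [(f : I → ℝ)] (sortedY p) = f y := by
        rw [hy]; simp [prodAlong]
      rw [hval]
      change |f (Set.projIcc (0 : ℝ) 1 zero_le_one (subtreeProportion (pointsBST p) [false])) - f y|
        ≤ ε + 2 * (B n).indicator 1 p
      by_cases hpB : p ∈ B n
      · rw [Set.indicator_of_mem hpB, Pi.one_apply]
        have h1 := hfb (Set.projIcc (0 : ℝ) 1 zero_le_one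
          (subtreeProportion (pointsBST p) [false]))
        have h2 := hfb y
        have h3 := abs_sub (f (Set.projIcc (0 : ℝ) 1 zero_le_one
          (subtreeProportion (pointsBST p) [false]))) (f y)
        linarith
      · rw [Set.indicator_of_notMem hpB, mul_zero, add_zero]
        have h1 := abs_subtreeProportion_left_sub_le hp.1 hp.2 (hB n p hpB) hy
        have h2 : dist (Set.projIcc (0 : ℝ) 1 zero_le_one
            (subtreeProportion (pointsBST p) [false])) y < δ := by
          rw [Subtype.dist_eq, Real.dist_eq,
            Set.projIcc_of_mem _ (subtreeProportion_mem_Icc (pointsBST p) [false])]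
          rw [pointsBST_eq_bst]
          exact h1.trans_lt (by linarith)
        have h3 := hδ h2
        rw [Real.dist_eq] at h3
        exact h3.le
    have e1 := (Metric.tendsto_nhds.1 hlim) ε hε0
    have e2 := (Metric.tendsto_nhds.1 hB0) ε hε0
    obtain ⟨n₀, hn₀⟩ := eventually_atTop.1 (e1.and (e2.and (eventually_gt_atTop 0)))
    refine ⟨n₀, fun n hn => ?_⟩
    obtain ⟨f1, f2, f3⟩ := hn₀ n hn.le
    have f4 := abs_le.1 (hclose n f3)
    rw [Real.dist_eq] at f1 f2 ⊢
    have g1 := abs_lt.1 f1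
    have g2 := (abs_lt.1 f2).2
    rw [abs_lt]
    constructor <;> linarith [f4.1, f4.2, g1.1, g1.2]
  refine hasSliceMean_of_tendsto_powAverage hμ.map_fst hfm hfb ?_
  simp_rw [← leftmostExp_singleton_eq_powAverage hμ.map_fst hfm hfb]
  exact (tendsto_add_atTop_iff_nat 1).2 hroot

theorem HasSliceMean.const_mul {μ : Measure (I × I)} {f : I → ℝ} {m : ℝ}
    (h : HasSliceMean μ f m) (a : ℝ) : HasSliceMean μ (fun y => a * f y) (a * m) := by
  refine (Tendsto.const_mul a h).congr fun x => ?_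
  simp only [sliceIntegral]
  rw [integral_const_mul]
  ring

end Converse

/-! ### From random points to product measures -/

section Transfer

variable {μ : ProbabilityMeasure (I × I)} {Ω : ℕ → Type*} [∀ n, MeasurableSpace (Ω n)]
  {P : ∀ n, Measure (Ω n)} [∀ n, IsProbabilityMeasure (P n)] {Z : ∀ n, Fin n → Ω n → I × I}

theorem map_eq_pi (hZ_indep : ∀ n, iIndepFun (Z n) (P n))
    (hZ_law : ∀ n i, HasLaw (Z n i) (μ : Measure (I × I)) (P n)) (n : ℕ) :
    (P n).map (fun ω i => Z n i ω) = Measure.pi fun _ => (μ : Measure (I × I)) := by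
  rw [(iIndepFun_iff_map_fun_eq_pi_map fun i => (hZ_law n i).aemeasurable).1 (hZ_indep n)]
  simp_rw [(hZ_law n _).map_eq]

/-- Convergence in distribution of the trees, in terms of product measures. -/
theorem tendstoInDistribution_iff (hZ_indep : ∀ n, iIndepFun (Z n) (P n))
    (hZ_law : ∀ n i, HasLaw (Z n i) (μ : Measure (I × I)) (P n)) {Ω' : Type*}
    [MeasurableSpace Ω'] {P' : Measure Ω'} [IsProbabilityMeasure P'] {ψ : Ω' → List Bool → ℝ}
    (hψ : AEMeasurable ψ P') :
    TendstoInDistribution (fun n ω => subtreeProportion (pointsBST (fun i => Z n i ω))) atTop ψ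
      P P' ↔ ∀ F : BoundedContinuousFunction (List Bool → ℝ) ℝ,
        Tendsto (fun n => ∫ p, F (subtreeProportion (pointsBST p))
          ∂(Measure.pi fun _ : Fin n => (μ : Measure (I × I)))) atTop
          (𝓝 (∫ ω, F (ψ ω) ∂P')) := by
  have hs : ∀ n, AEMeasurable (fun ω i => Z n i ω) (P n) := fun n =>
    aemeasurable_pi_lambda _ fun i => (hZ_law n i).aemeasurable
  have hm : ∀ n, AEMeasurable
      (fun ω => subtreeProportion (pointsBST (fun i => Z n i ω))) (P n) := fun n =>
    measurable_subtreeProportion_pointsBST.comp_aemeasurable (hs n)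
  have hint : ∀ (F : BoundedContinuousFunction (List Bool → ℝ) ℝ) (n : ℕ),
      ∫ w, F w ∂((P n).map fun ω => subtreeProportion (pointsBST (fun i => Z n i ω))) =
        ∫ p, F (subtreeProportion (pointsBST p))
          ∂(Measure.pi fun _ : Fin n => (μ : Measure (I × I))) := fun F n => by
    rw [integral_map (hm n) F.continuous.measurable.aestronglyMeasurable,
      ← map_eq_pi hZ_indep hZ_law n, integral_map (hs n)]
    exact (F.continuous.measurable.comp
      measurable_subtreeProportion_pointsBST).aestronglyMeasurable
  have hint' : ∀ F : BoundedContinuousFunction (List Bool → ℝ) ℝ,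
      ∫ w, F w ∂(P'.map ψ) = ∫ ω, F (ψ ω) ∂P' := fun F =>
    integral_map hψ F.continuous.measurable.aestronglyMeasurable
  constructor
  · intro h F
    have := ProbabilityMeasure.tendsto_iff_forall_integral_tendsto.1 h.tendsto F
    simp only [ProbabilityMeasure.coe_mk, hint, hint'] at this
    exact this
  · intro h
    refine ⟨hm, hψ, ProbabilityMeasure.tendsto_iff_forall_integral_tendsto.2 fun F => ?_⟩
    simp only [ProbabilityMeasure.coe_mk, hint, hint']
    exact h F

end Transfer

end PermutonBST

open PermutonBST
theorem theorem1p2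
    (μ : ProbabilityMeasure (I × I)) (hμ : IsPermuton μ)
    -- for each `n`, the points `Z n i`, `i < n`, are i.i.d. with law `μ`
    {Ω : ℕ → Type*} [∀ n, MeasurableSpace (Ω n)]
    (P : ∀ n, Measure (Ω n)) [∀ n, IsProbabilityMeasure (P n)]
    (Z : ∀ n, Fin n → Ω n → I × I)
    (hZ_indep : ∀ n, iIndepFun (Z n) (P n))
    (hZ_law : ∀ n i, HasLaw (Z n i) (μ : Measure (I × I)) (P n)) :
    -- direct part
    (∀ μ₀ : ProbabilityMeasure I, (∀ y : I, (μ₀ : Measure I) {y} = 0) → HasLeftLimit μ μ₀ →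
      ∀ {Ω' : Type*} [MeasurableSpace Ω'] (P' : Measure Ω') [IsProbabilityMeasure P']
        (Y : ℕ → Ω' → I), iIndepFun Y P' → (∀ k, HasLaw (Y k) (μ₀ : Measure I) P') →
        (∀ᵐ ω ∂P', ∀ v, (infiniteBST (fun k => Y k ω) v).isSome) ∧
        SubtreeSizeTendsto (fun n ω => pointsBST (fun i => Z n i ω))
          (fun ω => psi (fun k => Y k ω)) P P') ∧
    -- converse part
    ((∃ Q : ProbabilityMeasure (List Bool → ℝ),
        SubtreeSizeTendsto (fun n ω => pointsBST (fun i => Z n i ω)) id P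
          (Q : Measure (List Bool → ℝ))) →
      ∃ μ₀ : ProbabilityMeasure I, HasLeftLimit μ μ₀) := by
  constructor
  · intro μ₀ hatom hlim Ω' _ P' _ Y hY hlaw
    have hsc := ae_isScattered hatom hY hlaw
    have hYm : AEMeasurable (fun ω k => Y k ω) P' :=
      aemeasurable_pi_lambda _ fun k => (hlaw k).aemeasurable
    have hψ : AEMeasurable (fun ω => psi fun k => Y k ω) P' := measurable_psi.comp_aemeasurable hYm
    refine ⟨?_, ?_, (tendstoInDistribution_iff hZ_indep hZ_law hψ).2 fun F => ?_⟩
    · filter_upwards [hsc] with ω hω v using hω.isSome_infiniteBST v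
    · filter_upwards [hsc] with ω hω using hω.psi_mem_Psi
    set ν : Measure (ℕ → I) := Measure.infinitePi fun _ => (μ₀ : Measure I) with hν
    have hcyl : ∀ (k : ℕ) (A : Fin k → Set I), (∀ i, MeasurableSet (A i)) →
        ν.real {y | ∀ i : Fin k, y i ∈ A i} = ∏ i, (μ₀ : Measure I).real (A i) := by
      intro k A hA
      have hset : {y : ℕ → I | ∀ i : Fin k, y i ∈ A i} =
          (fun (y : ℕ → I) (i : Fin k) => y i) ⁻¹' Set.univ.pi A := by ext; simp
      rw [hset, ← map_measureReal_apply (by fun_prop) (.univ_pi hA), hν,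
        Measure.map_infinitePi_infinitePi_of_inj Fin.val_injective, Measure.infinitePi_eq_pi,
        Measure.real, Measure.pi_pi, ENNReal.toReal_prod]
      rfl
    have hscν : ∀ᵐ y ∂ν, IsScattered y :=
      ae_isScattered hatom (Y := fun k (y : ℕ → I) => y k)
        (iIndepFun_infinitePi (X := fun _ x => x) fun _ => measurable_id) fun k =>
          ⟨(measurable_pi_apply k).aemeasurable, Measure.infinitePi_map_eval _ k⟩
    have := tendsto_integral_subtreeProportion hμ hlim hatom hscν hcyl F
    have hint : ∫ y, F (psi y) ∂ν = ∫ ω, F (psi fun k => Y k ω) ∂P' := by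
      rw [hν, ← (hY.hasLaw_infinitePi hlaw hYm).map_eq]
      exact integral_map hYm (F.continuous.measurable.comp measurable_psi).aestronglyMeasurable
    rwa [hint] at this
  · rintro ⟨Q, hQ⟩
    have hlim := (tendstoInDistribution_iff hZ_indep hZ_law aemeasurable_id).1 hQ.tendsto
    let g : (List Bool → ℝ) → I := fun w => Set.projIcc (0 : ℝ) 1 zero_le_one (w [false])
    have hg : Continuous g := continuous_projIcc.comp (continuous_apply _)
    refine ⟨Q.map hg.measurable.aemeasurable, (hasLeftLimit_iff _ _).2 fun f => ?_⟩
    rw [ProbabilityMeasure.toMeasure_map, integral_map hg.measurable.aemeasurable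
      f.continuous.measurable.aestronglyMeasurable]
    -- rescale `f` so that it is bounded by `1`
    have hpos : 0 < ‖f‖ + 1 := by positivity
    have h := (hasSliceMean_of_tendsto hμ hlim ((‖f‖ + 1)⁻¹ • f) fun y => by
      have h1 : |f y| ≤ ‖f‖ := f.norm_coe_le_norm y
      simp only [BoundedContinuousFunction.coe_smul, smul_eq_mul]
      rw [abs_mul, abs_of_pos (inv_pos.2 hpos), inv_mul_le_iff₀ hpos]
      linarith).const_mul (‖f‖ + 1)
    simp only [BoundedContinuousFunction.coe_smul, smul_eq_mul] at h
    rw [integral_const_mul] at h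
    simpa only [mul_inv_cancel_left₀ hpos.ne'] using h
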